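/- **Model.** Let $1<\gamma_1<2$ and $\gamma_1<\gamma_2$. Let $f_1,f_2\ge 0$ be measurable functions on $\mathbb R_+=(0,\infty)$ such that $F(\mathrm du)=f_1(u_1)f_2(u_2)\,\mathrm du_1\mathrm du_2$ is a probability measure on $\mathbb R_+^2$, $f_i(u)\,u^{\gamma_i+1}\to 1$ as $u\to\infty$ for $i=1,2$, and, for some constant $c_{f_1}>0$, $f_1(u)\le c_{f_1}u^{-\gamma_1-1}$ for all $u>0$. For $x\in\mathbb R^2$, $u\in\mathbb R_+^2$ let $B(x,u)=[x_1-\frac{u_1}2,x_1+\frac{u_1}2]\times[x_2-\frac{u_2}2,x_2+\frac{u_2}2]$. For $\rho>0$ let $\lambda_\rho>0$, let $F_\rho$ be the image of $F$ under $u\mapsto\rho u$, and let $N_\rho$ be a Poisson random measure on $\mathbb R^2\times\mathbb R_+^2$ with intensity measure $\lambda_\rho\,\mathrm dx\,F_\rho(\mathrm du)$. For a finite signed measure $\mu$ on $\mathbb R^2$ put $$J_\rho(\mu)=\int \mu(B(x,u))\,N_\rho(\mathrm dx,\mathrm du),\qquad \widetilde J_\rho(\mu)=J_\rho(\mu)-\mathbb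 E J_\rho(\mu).$$ Let $\mathcal M_P$ be the set of finite signed measures $\mu$ on $\mathbb R^2$ having a continuous density $f_\mu$ such that $|f_\mu(x)|\le C_\mu e^{-c_\mu(|x_1|+|x_2|)}$ for all $x\in\mathbb R^2$, with some constants $C_\mu,c_\mu>0$. **Limit.** Let $S_\alpha(\sigma,\beta,0)$, for $\alpha\in(1,2)$, denote the law with characteristic function $\theta\mapsto\exp\bigl(-\sigma^\alpha|\theta|^\alpha(1-i\beta\,\mathrm{sign}(\theta)\tan(\pi\alpha/2))\bigr)$. Let $\Lambda_{\gamma_1}$ be an independently scattered $\gamma_1$-stable random measure on $\mathbb R^2$ with unit skewness and Lebesgue control measure, that is, an almost surely $\sigma$-additive random set function on the Borel sets $A$ of finite Lebesgue measure $|A|$, with independent values on disjoint sets and with $\Lambda_{\gamma_1}(A)\sim S_{\gamma_1}(|A|^{1/\gamma_1},1,0)$. For $f\in L^{\gamma_1}(\mathbb R^2)$ the integral $\int f\,\mathrm d\Lambda_{\gamma_1}$ is the limit in probability of the integrals of simple functions that converge to $f$ in $L^{\gamma_1}$. Put $$c_{\gamma_1,\gamma_2}=\left(-\frac{\Gamma(2-\gamma_1)}{\gamma_1(\gamma_1-1)}\cos\frac{\pi\gamma_1}2\right)^{1/\gamma_1}\left(\int_0^\infty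 u^{\gamma_1}f_2(u)\,\mathrm du\right)^{1/\gamma_1}.$$ **Theorem (points scaling regime).** Suppose that $\lambda_\rho\to\infty$ and $\lambda_\rho\rho^{\gamma_1}\to0$ as $\rho\to0$. Then for every $\mu\in\mathcal M_P$ the integral $S_{\gamma_1}(\mu)=\int_{\mathbb R^2}f_\mu\,\mathrm d\Lambda_{\gamma_1}$ is well defined and has the law $S_{\gamma_1}(\sigma_\mu,\beta_\mu,0)$ with $$\sigma_\mu=\|f_\mu\|_{\gamma_1},\qquad \beta_\mu=\|f_\mu\|_{\gamma_1}^{-\gamma_1}\bigl(\|(f_\mu)_+\|_{\gamma_1}^{\gamma_1}-\|(f_\mu)_-\|_{\gamma_1}^{\gamma_1}\bigr)$$ ($\beta_\mu:=0$ if $f_\mu=0$), where $(f_\mu)_+=\max(f_\mu,0)$ and $(f_\mu)_-=-\min(f_\mu,0)$. Moreover, as $\rho\to0$, $$\frac{\widetilde J_\rho(\cdot)}{c_{\gamma_1,\gamma_2}\,\lambda_\rho^{1/\gamma_1}\rho^2}\longrightarrow S_{\gamma_1}(\cdot)$$ in finite-dimensional distributions on $\mathcal M_P$: for all $k$ and $\mu_1,\dots,\mu_k\in\mathcal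 M_P$ the vector $\bigl(\widetilde J_\rho(\mu_j)/(c_{\gamma_1,\gamma_2}\lambda_\rho^{1/\gamma_1}\rho^2)\bigr)_{j\le k}$ converges in distribution to $(S_{\gamma_1}(\mu_j))_{j\le k}$. -/

import Mathlib

open MeasureTheory ProbabilityTheory Filter Topology
open scoped ENNReal NNReal

noncomputable section

namespace RandomBoxes

/-- The plane, with Lebesgue measure as `volume`. -/
abbrev Plane : Type := ℝ × ℝ

/-! ### The model -/

/-- The rectangle `B(x,u)` with centre `x` and edge lengths `u.1`, `u.2`. -/
def box (x u : Plane) : Set Plane :=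
  Set.Icc (x.1 - u.1 / 2) (x.1 + u.1 / 2) ×ˢ Set.Icc (x.2 - u.2 / 2) (x.2 + u.2 / 2)

/-- The measure `F(du) = f₁(u₁) f₂(u₂) du₁ du₂` on the open positive quadrant. -/
def edgeMeasure (f₁ f₂ : ℝ → ℝ) : Measure Plane :=
  (volume.restrict (Set.Ioi (0 : ℝ) ×ˢ Set.Ioi (0 : ℝ))).withDensity
    (fun u => ENNReal.ofReal (f₁ u.1 * f₂ u.2))

/-- The measure `F_ρ`, the image of `F` under `u ↦ ρ u`. -/
def scaledEdgeMeasure (f₁ f₂ : ℝ → ℝ) (ρ : ℝ) : Measure Plane :=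
  (edgeMeasure f₁ f₂).map (fun u => (ρ * u.1, ρ * u.2))

/-- The intensity measure `n(dx, du) = lam dx F_ρ(du)` on the space of pairs
(centre, edge lengths). -/
def boxIntensity (f₁ f₂ : ℝ → ℝ) (lam ρ : ℝ) : Measure (Plane × Plane) :=
  ENNReal.ofReal lam • (volume : Measure Plane).prod (scaledEdgeMeasure f₁ f₂ ρ)

/-- `N` is a Poisson random measure with (σ-finite) intensity measure `n`: it is a random variable
with values in the measures, `N(A)` is Poisson distributed with mean `n(A)` whenever `n(A) < ∞`,
and the values on finitely many disjoint measurable sets are independent. -/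
structure IsPoissonRandomMeasure {Ω E : Type*} [MeasurableSpace Ω] [MeasurableSpace E]
    (N : Ω → Measure E) (n : Measure E) (P : Measure Ω) : Prop where
  measurable : Measurable N
  law : ∀ A : Set E, MeasurableSet A → n A < ∞ →
    P.map (fun ω => N ω A) =
      (poissonMeasure (n A).toNNReal).map (fun k : ℕ => (k : ℝ≥0∞))
  indep : ∀ (k : ℕ) (A : Fin k → Set E), (∀ i, MeasurableSet (A i)) →
    Pairwise (fun i j => Disjoint (A i) (A j)) → iIndepFun (fun i ω => N ω (A i)) P

/-- `J(μ) = ∫ μ(B(x,u)) N(dx,du)`. -/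
def boxField {Ω : Type*} (N : Ω → Measure (Plane × Plane)) (μ : SignedMeasure Plane) (ω : Ω) : ℝ :=
  ∫ p, μ (box p.1 p.2) ∂(N ω)

/-- The centred field `J(μ) - 𝔼 J(μ)`. -/
def centredBoxField {Ω : Type*} [MeasurableSpace Ω] (P : Measure Ω)
    (N : Ω → Measure (Plane × Plane)) (μ : SignedMeasure Plane) (ω : Ω) : ℝ :=
  boxField N μ ω - ∫ ω', boxField N μ ω' ∂P

/-! ### The space of signed measures -/

/-- `f` is a continuous density of `μ` decaying at least exponentially fast. -/
structure IsDecayingDensity (μ : SignedMeasure Plane) (f : Plane → ℝ) : Prop where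
  continuous : Continuous f
  decay : ∃ C > 0, ∃ c > 0, ∀ x : Plane, |f x| ≤ C * Real.exp (-c * (|x.1| + |x.2|))
  density : ∀ A : Set Plane, MeasurableSet A → μ A = ∫ x in A, f x

/-- The space `M_P` of signed measures with a continuous density of at least exponential decay. -/
def pointsSpace : Set (SignedMeasure Plane) :=
  {μ | ∃ f, IsDecayingDensity μ f}

/-- The continuous density `f_μ` of `μ ∈ M_P`. -/
def density (μ : pointsSpace) : Plane → ℝ := μ.2.choose

/-! ### Stable laws, stable random measures and stable integrals -/

/-- The real random variable `X` has the stable law `S_α(σ, β, 0)` (for `α ≠ 1`), with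
characteristic function `θ ↦ exp(-σ^α |θ|^α (1 - i β sign(θ) tan(πα/2)))`. -/
structure HasStableLaw {Ω : Type*} [MeasurableSpace Ω] (X : Ω → ℝ) (α σ β : ℝ)
    (P : Measure Ω) : Prop where
  aemeasurable : AEMeasurable X P
  charFun_eq : ∀ θ : ℝ, charFun (P.map X) θ =
    Complex.exp (-((σ ^ α * |θ| ^ α : ℝ) : ℂ) *
      (1 - Complex.I * ((β * Real.sign θ * Real.tan (Real.pi * α / 2) : ℝ) : ℂ)))

/-- `Λ` is an independently scattered `α`-stable random measure with unit skewness and control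
measure `m`: a random set function on the measurable sets of finite `m`-measure such that
`Λ(A)` has law `S_α(m(A)^{1/α}, 1, 0)`, values on disjoint sets are independent, and `Λ` is
almost surely countably additive along each disjoint sequence. -/
structure IsStableRandomMeasure {Ω E : Type*} [MeasurableSpace Ω] [MeasurableSpace E]
    (Λ : Set E → Ω → ℝ) (α : ℝ) (m : Measure E) (P : Measure Ω) : Prop where
  measurable : ∀ A : Set E, MeasurableSet A → m A < ∞ → Measurable (Λ A)
  law : ∀ A : Set E, MeasurableSet A → m A < ∞ →
    HasStableLaw (Λ A) α ((m A).toReal ^ (1 / α)) 1 P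
  indep : ∀ (k : ℕ) (A : Fin k → Set E), (∀ i, MeasurableSet (A i)) → (∀ i, m (A i) < ∞) →
    Pairwise (fun i j => Disjoint (A i) (A j)) → iIndepFun (fun i => Λ (A i)) P
  -- The series need not converge absolutely, so convergence is that of the partial sums.
  sigma_additive : ∀ A : ℕ → Set E, (∀ i, MeasurableSet (A i)) →
    Pairwise (fun i j => Disjoint (A i) (A j)) → m (⋃ i, A i) < ∞ →
    ∀ᵐ ω ∂P, Tendsto (fun n => ∑ i ∈ Finset.range n, Λ (A i) ω) atTop (𝓝 (Λ (⋃ i, A i) ω))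

/-- `∫ φ dΛ = ∑ c Λ(φ = c)` for a simple function `φ`. -/
def simpleStableIntegral {Ω E : Type*} [MeasurableSpace E] (Λ : Set E → Ω → ℝ)
    (φ : SimpleFunc E ℝ) (ω : Ω) : ℝ :=
  ∑ c ∈ φ.range, c * Λ (φ ⁻¹' {c}) ω

/-- The random variable `Y` is the integral `∫ f dΛ` of `f ∈ L^α(m)`: it is the limit in
probability of `∫ φ_n dΛ` for every sequence of simple functions `φ_n → f` in `L^α(m)`. -/
structure IsStableIntegral {Ω E : Type*} [MeasurableSpace Ω] [MeasurableSpace E]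
    (Λ : Set E → Ω → ℝ) (α : ℝ) (m : Measure E) (P : Measure Ω) (f : E → ℝ) (Y : Ω → ℝ) :
    Prop where
  memLp : MemLp f (ENNReal.ofReal α) m
  aemeasurable : AEMeasurable Y P
  tendsto : ∀ φ : ℕ → SimpleFunc E ℝ, (∀ n, MemLp (φ n) (ENNReal.ofReal α) m) →
    Tendsto (fun n => eLpNorm (fun x => φ n x - f x) (ENNReal.ofReal α) m) atTop (𝓝 0) →
    TendstoInMeasure P (fun n => simpleStableIntegral Λ (φ n)) atTop Y

open Classical in
/-- The integral `∫ f dΛ`, a version of it being chosen (and `0` if there is none). -/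
def stableIntegral {Ω E : Type*} [MeasurableSpace Ω] [MeasurableSpace E]
    (Λ : Set E → Ω → ℝ) (α : ℝ) (m : Measure E) (P : Measure Ω) (f : E → ℝ) : Ω → ℝ :=
  if h : ∃ Y, IsStableIntegral Λ α m P f Y then h.choose else 0

/-! ### The parameters of the limit and the normalisation -/

/-- The scale `σ_μ = ‖f‖_γ`. -/
def stableScale (γ : ℝ) (f : Plane → ℝ) : ℝ := lpNorm f (ENNReal.ofReal γ) volume

/-- The skewness `β_μ = ‖f‖_γ^{-γ} (‖f₊‖_γ^γ - ‖f₋‖_γ^γ)`. -/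
def stableSkewness (γ : ℝ) (f : Plane → ℝ) : ℝ :=
  lpNorm f (ENNReal.ofReal γ) volume ^ (-γ) *
    (lpNorm (fun x => max (f x) 0) (ENNReal.ofReal γ) volume ^ γ -
      lpNorm (fun x => -min (f x) 0) (ENNReal.ofReal γ) volume ^ γ)

/-- `c_{γ₁} = (-Γ(2-γ₁)/(γ₁(γ₁-1)) cos(πγ₁/2))^{1/γ₁}`. -/
def tailConstant (γ₁ : ℝ) : ℝ :=
  (-(Real.Gamma (2 - γ₁) / (γ₁ * (γ₁ - 1)) * Real.cos (Real.pi * γ₁ / 2))) ^ (1 / γ₁)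

/-- `c₂ = (∫_0^∞ u^{γ₁} f₂(u) du)^{1/γ₁}`. -/
def widthConstant (γ₁ : ℝ) (f₂ : ℝ → ℝ) : ℝ :=
  (∫ u in Set.Ioi (0 : ℝ), u ^ γ₁ * f₂ u) ^ (1 / γ₁)

/-- The constant `c_{γ₁,γ₂} = c_{γ₁} c₂`; it depends on `γ₂` through `f₂`. -/
def normConstant (γ₁ : ℝ) (f₂ : ℝ → ℝ) : ℝ := tailConstant γ₁ * widthConstant γ₁ f₂

/-- The filter `ρ → 0` on the positive scaling parameters. -/
def scaleToZero : Filter (Set.Ioi (0 : ℝ)) := comap Subtype.val (𝓝 0)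

end RandomBoxes

end

/-! The proof compares characteristic functions. For a Poisson random measure with intensity `n`,
the centred integral of `g` has characteristic functional `exp ∫ R(i g) dn`, where `R(w) = exp w - 1
- w` (`IsPoissonRandomMeasure.integral_exp_centred`). A linear combination of the fields `J(μ_j)` is
the field of the combined density `f`, so only one exponent per `f` has to be followed to its limit.

Put `w = λ^{1/γ₁}` and substitute `u₁ = w v₁`, `u₂ = v₂`. The box then has edges `ρ w v₁` and `ρ
v₂`. Both tend to zero, the first because `λ ρ^{γ₁} → 0`, so its `μ`-mass divided by `w ρ²` tends to
`f(x) v₁ v₂`. At the same time `w → ∞`, and the density `λ w f₁(w v₁)` tends to `v₁^{-γ₁-1}` by the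
tail of `f₁`. The limiting exponent is the integral of `R(i v₁ v₂ f(x) / c)` against `v₁^{-γ₁-1}
f₂(v₂) dv₁ dv₂ dx`. The integral over `v₁` is the Lévy integral of a totally skewed stable law
(`integral_rpow_mul_expRemainder_I_mul`). By homogeneity `v₂` contributes its moment of order `γ₁`,
and `c` is chosen so that exactly `∫ stableExponent γ₁ (f x) dx` remains
(`integral_limitIntegrand`).

Dominated convergence (`tendsto_integral_expRemainder_boxIntensity`) rests on two bounds. First, the
averages of `f` over all boxes centred at `x` are `O(1/((1+|x₁|)(1+|x₂|)))`; this is in `L^p` of the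
plane for every `p > 1`, though not for `p = 1`. Second, `|R(i s)| ≤ min(s², 2|s|) ≤ 2|s|^p` for
every `p` in `[1, 2]`, so that different exponents on either side of `γ₁` can be used for small and
for large `v₁`.

On the limit side, a tail estimate from the characteristic function shows that the integral of
simple functions is continuous from `L^α` into convergence in probability. This gives existence and
linearity of `∫ f dΛ`, and its characteristic function `exp ∫ stableExponent α (f x) dm`
(`IsStableIntegral.integral_exp`). Lévy's continuity theorem finishes the proof. -/

namespace RandomBoxes

/-! ### The remainder of the exponential series -/

/-- The remainder `exp w - 1 - w`. -/
noncomputable def expRemainder (w : ℂ) : ℂ := Complex.exp w - 1 - w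

lemma continuous_expRemainder : Continuous expRemainder := by
  unfold expRemainder; fun_prop

@[simp] lemma expRemainder_zero : expRemainder 0 = 0 := by simp [expRemainder]

/-- On the segment from 0 to `w` the real part stays nonpositive, so `t ↦ exp (t w)` has derivative
of norm at most `‖w‖`; this is the mean value inequality. -/
lemma norm_exp_sub_one_le_norm {w : ℂ} (hw : w.re ≤ 0) : ‖Complex.exp w - 1‖ ≤ ‖w‖ := by
  have h := norm_image_sub_le_of_norm_deriv_le_segment_01' (f := fun t : ℝ => Complex.exp (t * w))
    (f' := fun t => Complex.exp (t * w) * w) (C := ‖w‖) ?_ ?_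
  · simpa using h
  · intro t _
    have h1 : HasDerivAt (fun t : ℝ => (t : ℂ) * w) w t := by
      simpa using (Complex.ofRealCLM.hasDerivAt (x := t)).mul_const w
    exact h1.cexp.hasDerivWithinAt
  · intro t ht
    rw [norm_mul, Complex.norm_exp]
    have : Real.exp ((t * w : ℂ).re) ≤ 1 := by
      rw [Real.exp_le_one_iff]; simp only [Complex.re_ofReal_mul]; nlinarith [ht.1]
    nlinarith [norm_nonneg w]

lemma norm_expRemainder_le_two_mul {w : ℂ} (hw : w.re ≤ 0) : ‖expRemainder w‖ ≤ 2 * ‖w‖ := by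
  have := norm_sub_le (Complex.exp w - 1) w
  have := norm_exp_sub_one_le_norm hw
  unfold expRemainder; linarith

/-- The derivative along the segment is `(exp (t w) - 1) * w`, which the preceding mean value bound
controls by `‖w‖ ^ 2`. The sharp factor 1/2 is not needed. -/
lemma norm_expRemainder_le_sq {w : ℂ} (hw : w.re ≤ 0) : ‖expRemainder w‖ ≤ ‖w‖ ^ 2 := by
  have h := norm_image_sub_le_of_norm_deriv_le_segment_01'
    (f := fun t : ℝ => expRemainder (t * w))
    (f' := fun t => Complex.exp (t * w) * w - w) (C := ‖w‖ ^ 2) ?_ ?_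
  · simpa using h
  · intro t _
    have h1 : HasDerivAt (fun t : ℝ => (t : ℂ) * w) w t := by
      simpa using (Complex.ofRealCLM.hasDerivAt (x := t)).mul_const w
    exact ((h1.cexp.sub_const 1).sub h1).hasDerivWithinAt
  · intro t ht
    have h1 : Complex.exp (t * w) * w - w = (Complex.exp (t * w) - 1) * w := by ring
    have h2 : ‖Complex.exp (t * w) - 1‖ ≤ ‖(t : ℂ) * w‖ :=
      norm_exp_sub_one_le_norm (by simp only [Complex.re_ofReal_mul]; nlinarith [ht.1])
    rw [norm_mul, Complex.norm_real, Real.norm_eq_abs, abs_of_nonneg ht.1] at h2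
    rw [h1, norm_mul]
    nlinarith [norm_nonneg w, ht.2, mul_nonneg (norm_nonneg w) (norm_nonneg w)]

lemma norm_expRemainder_le_min {w : ℂ} (hw : w.re ≤ 0) :
    ‖expRemainder w‖ ≤ min (‖w‖ ^ 2) (2 * ‖w‖) :=
  le_min (norm_expRemainder_le_sq hw) (norm_expRemainder_le_two_mul hw)

lemma norm_expRemainder_I_mul_le_min (s : ℝ) :
    ‖expRemainder (Complex.I * s)‖ ≤ min (|s| ^ 2) (2 * |s|) := by
  simpa using norm_expRemainder_le_min (w := Complex.I * s) (by simp)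

/-! ### The Lévy integral of a stable law -/

/-- The quadratic branch gives `v ^ (1 - γ)` near zero, integrable because `γ < 2`; the linear
branch gives `v ^ (-γ)` at infinity, integrable because `γ > 1`. Multiples of this function dominate
the Lévy integrands and their derivatives in `z`. -/
lemma integrableOn_rpow_mul_min {γ : ℝ} (h1 : 1 < γ) (h2 : γ < 2) :
    IntegrableOn (fun v : ℝ => v ^ (-γ - 1) * min (v ^ 2) (2 * v)) (Set.Ioi 0) := by
  have hm : ∀ s : Set ℝ, AEStronglyMeasurable
      (fun v : ℝ => v ^ (-γ - 1) * min (v ^ 2) (2 * v)) (volume.restrict s) := fun s =>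
    (by fun_prop : Measurable fun v : ℝ => v ^ (-γ - 1) * min (v ^ 2) (2 * v)).aestronglyMeasurable
  rw [← Set.Ioc_union_Ioi_eq_Ioi zero_le_one]
  refine IntegrableOn.union ?_ ?_
  · have h : IntegrableOn (fun v : ℝ => v ^ (1 - γ)) (Set.Ioc 0 1) := by
      rw [← intervalIntegrable_iff_integrableOn_Ioc_of_le zero_le_one]
      exact intervalIntegral.intervalIntegrable_rpow' (by linarith)
    refine h.mono' (hm _) ?_
    filter_upwards [ae_restrict_mem measurableSet_Ioc] with v hv
    have hv0 : 0 < v := hv.1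
    rw [Real.norm_of_nonneg (by positivity)]
    calc _ ≤ v ^ (-γ - 1) * v ^ 2 := by gcongr; exact min_le_left _ _
      _ = v ^ (1 - γ) := by
        rw [← Real.rpow_natCast, ← Real.rpow_add hv0]; congr 1; push_cast; ring
  · have h : IntegrableOn (fun v : ℝ => 2 * v ^ (-γ)) (Set.Ioi 1) :=
      (integrableOn_Ioi_rpow_of_lt (by linarith) zero_lt_one).const_mul 2
    refine h.mono' (hm _) ?_
    filter_upwards [ae_restrict_mem measurableSet_Ioi] with v hv
    have hv0 : 0 < v := zero_lt_one.trans hv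
    rw [Real.norm_of_nonneg (by positivity)]
    calc _ ≤ v ^ (-γ - 1) * (2 * v) := by gcongr; exact min_le_right _ _
      _ = 2 * v ^ (-γ) := by
        have : v ^ (-γ) = v ^ (-γ - 1) * v := by
          nth_rw 3 [← Real.rpow_one v]
          rw [← Real.rpow_add hv0]; congr 1; ring
        rw [this]; ring

/-- `∫_0^∞ v^{-γ-1} (e^{-zv} - 1 + zv) dv`. -/
noncomputable def levyIntegral (γ : ℝ) (z : ℂ) : ℂ :=
  ∫ v in Set.Ioi (0 : ℝ), ((v ^ (-γ - 1) : ℝ) : ℂ) * expRemainder (-z * v)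

lemma min_sq_two_mul_le {R v : ℝ} (hR : 1 ≤ R) (hv : 0 ≤ v) :
    min ((R * v) ^ 2) (2 * (R * v)) ≤ R ^ 2 * min (v ^ 2) (2 * v) := by
  rw [mul_min_of_nonneg _ _ (by positivity)]
  refine min_le_min (by rw [mul_pow]) ?_
  nlinarith [mul_nonneg (sub_nonneg.2 hR) (mul_nonneg (zero_le_one.trans hR) hv)]

lemma norm_levyIntegrand_le {γ R v : ℝ} {z : ℂ} (hR : 1 ≤ R) (hz : 0 ≤ z.re) (hzR : ‖z‖ ≤ R)
    (hv : 0 < v) : ‖((v ^ (-γ - 1) : ℝ) : ℂ) * expRemainder (-z * v)‖ ≤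
      R ^ 2 * (v ^ (-γ - 1) * min (v ^ 2) (2 * v)) := by
  have h := norm_expRemainder_le_min (w := -z * v) (by
    simp only [Complex.re_mul_ofReal, Complex.neg_re]; nlinarith)
  have hn : ‖-z * (v : ℂ)‖ ≤ R * v := by
    rw [norm_mul, norm_neg, Complex.norm_real, Real.norm_of_nonneg hv.le]; gcongr
  rw [norm_mul, Complex.norm_real, Real.norm_of_nonneg (by positivity)]
  calc _ ≤ v ^ (-γ - 1) * min ((R * v) ^ 2) (2 * (R * v)) := by
        gcongr; exact h.trans (min_le_min (by gcongr) (by gcongr))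
    _ ≤ v ^ (-γ - 1) * (R ^ 2 * min (v ^ 2) (2 * v)) := by
        gcongr; exact min_sq_two_mul_le hR hv.le
    _ = _ := by ring

lemma aestronglyMeasurable_levyIntegrand (γ : ℝ) (z : ℂ) (s : Set ℝ) :
    AEStronglyMeasurable (fun v : ℝ => ((v ^ (-γ - 1) : ℝ) : ℂ) * expRemainder (-z * v))
      (volume.restrict s) := by
  have h1 : Measurable fun v : ℝ => ((v ^ (-γ - 1) : ℝ) : ℂ) := by fun_prop
  have h2 : Measurable fun v : ℝ => expRemainder (-z * v) :=
    (continuous_expRemainder.comp (by fun_prop)).measurable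
  exact (h1.mul h2).aestronglyMeasurable

lemma integrableOn_levyIntegrand {γ : ℝ} (h1 : 1 < γ) (h2 : γ < 2) {z : ℂ} (hz : 0 ≤ z.re) :
    IntegrableOn (fun v : ℝ => ((v ^ (-γ - 1) : ℝ) : ℂ) * expRemainder (-z * v))
      (Set.Ioi 0) := by
  refine ((integrableOn_rpow_mul_min h1 h2).const_mul ((max 1 ‖z‖) ^ 2)).mono'
    (aestronglyMeasurable_levyIntegrand γ z _) ?_
  filter_upwards [ae_restrict_mem measurableSet_Ioi] with v hv
  exact norm_levyIntegrand_le (le_max_left _ _) hz (le_max_right _ _) hv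

/-- Continuity is needed up to the boundary, since the characteristic exponent is the value on the
imaginary axis. -/
lemma continuousOn_levyIntegral {γ : ℝ} (h1 : 1 < γ) (h2 : γ < 2) :
    ContinuousOn (levyIntegral γ) {z | 0 ≤ z.re} := by
  intro z₀ _
  unfold levyIntegral
  refine continuousWithinAt_of_dominated
    (bound := fun v => (max 1 (‖z₀‖ + 1)) ^ 2 * (v ^ (-γ - 1) * min (v ^ 2) (2 * v)))
    (.of_forall fun z => aestronglyMeasurable_levyIntegrand γ z _) ?_
    ((integrableOn_rpow_mul_min h1 h2).const_mul _) ?_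
  · filter_upwards [self_mem_nhdsWithin,
      mem_nhdsWithin_of_mem_nhds (Metric.ball_mem_nhds z₀ zero_lt_one)] with z hz hz'
    filter_upwards [ae_restrict_mem measurableSet_Ioi] with v hv
    refine norm_levyIntegrand_le (le_max_left _ _) hz (le_max_of_le_right ?_) hv
    have := norm_le_norm_add_norm_sub' z z₀
    rw [mem_ball_iff_norm] at hz'
    linarith
  · refine .of_forall fun v => Continuous.continuousWithinAt ?_
    exact continuous_const.mul (continuous_expRemainder.comp (by fun_prop))

lemma differentiableOn_levyIntegral {γ : ℝ} (h1 : 1 < γ) (h2 : γ < 2) :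
    DifferentiableOn ℂ (levyIntegral γ) {z | 0 < z.re} := by
  intro z₀ hz₀
  have hopen : IsOpen {z : ℂ | 0 < z.re} := isOpen_lt continuous_const Complex.continuous_re
  set R := max 1 (‖z₀‖ + 1) with hR
  have hR1 : 1 ≤ R := le_max_left _ _
  refine (hasDerivAt_integral_of_dominated_loc_of_deriv_le
    (μ := volume.restrict (Set.Ioi (0 : ℝ)))
    (F := fun z v => ((v ^ (-γ - 1) : ℝ) : ℂ) * expRemainder (-z * v))
    (F' := fun z v => ((v ^ (-γ - 1) : ℝ) : ℂ) *
      (Complex.exp (-z * v) * (-v) - (-v)))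
    (bound := fun v => R * (v ^ (-γ - 1) * min (v ^ 2) (2 * v)))
    (s := {z | 0 < z.re} ∩ Metric.ball z₀ 1)
    ((hopen.inter Metric.isOpen_ball).mem_nhds ⟨hz₀, Metric.mem_ball_self one_pos⟩)
    (.of_forall fun z => aestronglyMeasurable_levyIntegrand γ z _)
    (integrableOn_levyIntegrand h1 h2 (le_of_lt hz₀)) ?_ ?_
    ((integrableOn_rpow_mul_min h1 h2).const_mul _) ?_).2.differentiableAt.differentiableWithinAt
  · have h1 : Measurable fun v : ℝ => ((v ^ (-γ - 1) : ℝ) : ℂ) := by fun_prop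
    exact (h1.mul (by fun_prop)).aestronglyMeasurable
  · filter_upwards [ae_restrict_mem measurableSet_Ioi] with v hv z hz
    have hv0 : 0 < v := hv
    have hzR : ‖z‖ ≤ R := by
      have := norm_le_norm_add_norm_sub' z z₀
      have h3 := hz.2
      rw [mem_ball_iff_norm] at h3
      exact le_max_of_le_right (by linarith)
    have hre : (-z * (v : ℂ)).re ≤ 0 := by
      have : 0 < z.re := hz.1
      simp only [Complex.re_mul_ofReal, Complex.neg_re]; nlinarith
    have e : Complex.exp (-z * v) * (-v) - (-v) = (Complex.exp (-z * v) - 1) * (-(v : ℂ)) := by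
      ring
    rw [e, norm_mul, norm_mul, Complex.norm_real, norm_neg, Complex.norm_real,
      Real.norm_of_nonneg (by positivity), Real.norm_of_nonneg hv0.le]
    have b1 : ‖Complex.exp (-z * v) - 1‖ ≤ R * v := by
      refine (norm_exp_sub_one_le_norm hre).trans ?_
      rw [norm_mul, norm_neg, Complex.norm_real, Real.norm_of_nonneg hv0.le]
      gcongr
    have b2 : ‖Complex.exp (-z * v) - 1‖ ≤ 2 := by
      refine (norm_sub_le _ _).trans ?_
      rw [Complex.norm_exp, norm_one]
      have := Real.exp_le_one_iff.2 hre
      linarith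
    have b3 : ‖Complex.exp (-z * v) - 1‖ * v ≤ R * min (v ^ 2) (2 * v) := by
      rw [mul_min_of_nonneg _ _ (by positivity)]
      refine le_min ?_ ?_
      · nlinarith
      · nlinarith [mul_le_mul_of_nonneg_right b2 hv0.le]
    calc _ ≤ v ^ (-γ - 1) * (R * min (v ^ 2) (2 * v)) := by gcongr
      _ = _ := by ring
  · refine .of_forall fun v z _ => ?_
    have h1 : HasDerivAt (fun z : ℂ => -z * (v : ℂ)) (-(v : ℂ)) z := by
      simpa using (hasDerivAt_neg z).mul_const (v : ℂ)
    exact ((h1.cexp.sub_const 1).sub h1).const_mul _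

/-- Homogeneity comes from the substitution `v ↦ x v`. -/
lemma levyIntegral_ofReal (γ : ℝ) {x : ℝ} (hx : 0 < x) :
    levyIntegral γ x = ((x ^ γ : ℝ) : ℂ) * levyIntegral γ 1 := by
  have h := integral_comp_mul_left_Ioi
    (fun v : ℝ => ((v ^ (-γ - 1) : ℝ) : ℂ) * expRemainder (-1 * v)) 0 hx
  rw [mul_zero] at h
  have h2 : ∫ v in Set.Ioi (0 : ℝ), (((x * v) ^ (-γ - 1) : ℝ) : ℂ) *
      expRemainder (-1 * ((x * v : ℝ) : ℂ)) = ((x ^ (-γ - 1) : ℝ) : ℂ) * levyIntegral γ x := by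
    rw [levyIntegral, ← integral_const_mul]
    refine setIntegral_congr_fun measurableSet_Ioi fun v hv => ?_
    have hv0 : 0 < v := hv
    rw [Real.mul_rpow hx.le hv0.le, Complex.ofReal_mul, mul_assoc]
    congr 3
    push_cast; ring
  rw [h2, Complex.real_smul] at h
  have h3 : x ^ γ * x ^ (-γ - 1) = x⁻¹ := by
    rw [← Real.rpow_add hx, ← Real.rpow_neg_one]; congr 1; ring
  have h4 : x ^ γ ≠ 0 := (Real.rpow_pos_of_pos hx _).ne'
  have h5 : x ^ (-γ - 1) ≠ 0 := (Real.rpow_pos_of_pos hx _).ne'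
  have h6 : ((x ^ (-γ - 1) : ℝ) : ℂ) ≠ 0 := by exact_mod_cast h5
  apply mul_left_cancel₀ h6
  rw [h, ← h3, levyIntegral]
  push_cast; ring

/-- Two integrations by parts lead to a Gamma integral. Their boundary terms are collected in one
function `F`, whose derivative is the difference of the two integrands and which vanishes at both
ends. -/
lemma integral_rpow_mul_exp_neg_sub {γ : ℝ} (h1 : 1 < γ) (h2 : γ < 2) :
    ∫ v in Set.Ioi (0 : ℝ), v ^ (-γ - 1) * (Real.exp (-v) - 1 + v) =
      Real.Gamma (2 - γ) / (γ * (γ - 1)) := by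
  have hb : ∀ v : ℝ, 0 ≤ v →
      0 ≤ Real.exp (-v) - 1 + v ∧ Real.exp (-v) - 1 + v ≤ min (v ^ 2) (2 * v) := by
    intro v hv
    have h := norm_expRemainder_le_min (w := -(v : ℂ)) (by simpa using hv)
    have e : expRemainder (-(v : ℂ)) = ((Real.exp (-v) - 1 + v : ℝ) : ℂ) := by
      unfold expRemainder; push_cast; ring
    have h0 : 0 ≤ Real.exp (-v) - 1 + v := by linarith [Real.add_one_le_exp (-v)]
    rw [e, Complex.norm_real, norm_neg, Complex.norm_real, Real.norm_of_nonneg h0,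
      Real.norm_of_nonneg hv] at h
    exact ⟨h0, h⟩
  have hγ : γ * (γ - 1) ≠ 0 := by
    have : 0 < γ * (γ - 1) := mul_pos (by linarith) (by linarith)
    exact this.ne'
  have i1 : IntegrableOn (fun v : ℝ => v ^ (-γ - 1) * (Real.exp (-v) - 1 + v)) (Set.Ioi 0) := by
    refine (integrableOn_rpow_mul_min h1 h2).mono' ?_ ?_
    · exact (by fun_prop : Measurable fun v : ℝ =>
        v ^ (-γ - 1) * (Real.exp (-v) - 1 + v)).aestronglyMeasurable
    · filter_upwards [ae_restrict_mem measurableSet_Ioi] with v hv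
      have hv0 : 0 < v := hv
      rw [Real.norm_of_nonneg (mul_nonneg (by positivity) (hb v hv0.le).1)]
      gcongr; exact (hb v hv0.le).2
  have i2 : IntegrableOn (fun v : ℝ => Real.exp (-v) * v ^ (1 - γ)) (Set.Ioi 0) := by
    have := Real.GammaIntegral_convergent (s := 2 - γ) (by linarith)
    convert this using 3; ring_nf
  have hG : ∫ v in Set.Ioi (0 : ℝ), Real.exp (-v) * v ^ (1 - γ) = Real.Gamma (2 - γ) := by
    rw [Real.Gamma_eq_integral (by linarith)]; ring_nf
  let F : ℝ → ℝ := fun v => -(v ^ (-γ) / γ * (Real.exp (-v) - 1 + v)) -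
    v ^ (1 - γ) / (γ * (γ - 1)) * (1 - Real.exp (-v))
  have hF : ∀ v ∈ Set.Ioi (0 : ℝ), HasDerivAt F (v ^ (-γ - 1) * (Real.exp (-v) - 1 + v) -
      (γ * (γ - 1))⁻¹ * (Real.exp (-v) * v ^ (1 - γ))) v := by
    intro v hv
    have hv0 : 0 < v := hv
    have d1 : HasDerivAt (fun v : ℝ => v ^ (-γ)) (-γ * v ^ (-γ - 1)) v :=
      Real.hasDerivAt_rpow_const (.inl hv0.ne')
    have d2 : HasDerivAt (fun v : ℝ => v ^ (1 - γ)) ((1 - γ) * v ^ (1 - γ - 1)) v :=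
      Real.hasDerivAt_rpow_const (.inl hv0.ne')
    have d3 : HasDerivAt (fun v : ℝ => Real.exp (-v)) (Real.exp (-v) * -1) v :=
      (hasDerivAt_neg v).exp
    have := (((d1.div_const γ).mul ((d3.sub_const 1).add (hasDerivAt_id v))).neg).sub
      ((d2.div_const (γ * (γ - 1))).mul (d3.const_sub 1))
    refine this.congr_deriv ?_
    have e : (1 - γ - 1) = -γ := by ring
    rw [e]
    have hγ0 : γ ≠ 0 := by linarith
    have hγ1 : γ - 1 ≠ 0 := by linarith
    simp only [Pi.add_apply, id]
    field_simp
    ring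
  have t0 : ∀ a : ℝ, 0 < a → Tendsto (fun v : ℝ => v ^ a) (𝓝[>] 0) (𝓝 0) := fun a ha => by
    have := (Real.continuousAt_rpow_const 0 a (.inr ha.le)).tendsto
    rw [Real.zero_rpow ha.ne'] at this
    exact this.mono_left nhdsWithin_le_nhds
  have tinf : ∀ a : ℝ, 0 < a → Tendsto (fun v : ℝ => v ^ (-a)) atTop (𝓝 0) := fun a ha =>
    tendsto_rpow_neg_atTop ha
  -- Since `exp (-v) - 1 + v ≤ v ^ 2` and `1 - exp (-v) ≤ v`, both terms are of order `v ^ (2 - γ)`.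
  have ht0 : Tendsto F (𝓝[>] 0) (𝓝 0) := by
    have l := (t0 (2 - γ) (by linarith)).mul_const (1 / γ + 1 / (γ * (γ - 1)))
    rw [zero_mul] at l
    refine squeeze_zero_norm' ?_ l
    filter_upwards [self_mem_nhdsWithin] with v hv
    have hv0 : 0 < v := hv
    have e1 : v ^ (-γ) * v ^ 2 = v ^ (2 - γ) := by
      rw [← Real.rpow_natCast, ← Real.rpow_add hv0]; congr 1; push_cast; ring
    have e2 : v ^ (1 - γ) * v = v ^ (2 - γ) := by
      nth_rw 2 [← Real.rpow_one v]
      rw [← Real.rpow_add hv0]; congr 1; ring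
    have hg : 0 < γ * (γ - 1) := mul_pos (by linarith) (by linarith)
    have b := hb v hv0.le
    have b2 : 1 - Real.exp (-v) ≤ v := by linarith [Real.add_one_le_exp (-v)]
    have b3 : 0 ≤ 1 - Real.exp (-v) := by
      have := Real.exp_le_one_iff.2 (neg_nonpos.2 hv0.le); linarith
    have n1 : ‖v ^ (-γ) / γ * (Real.exp (-v) - 1 + v)‖ ≤ v ^ (2 - γ) * (1 / γ) := by
      rw [Real.norm_of_nonneg (mul_nonneg (by positivity) b.1), ← e1]
      calc _ ≤ v ^ (-γ) / γ * v ^ 2 := by gcongr; exact b.2.trans (min_le_left _ _)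
        _ = _ := by ring
    have n2 : ‖v ^ (1 - γ) / (γ * (γ - 1)) * (1 - Real.exp (-v))‖ ≤
        v ^ (2 - γ) * (1 / (γ * (γ - 1))) := by
      rw [Real.norm_of_nonneg (mul_nonneg (by positivity) b3), ← e2]
      calc _ ≤ v ^ (1 - γ) / (γ * (γ - 1)) * v := by gcongr
        _ = _ := by ring
    calc ‖F v‖ ≤ _ := norm_sub_le _ _
      _ ≤ _ := by rw [norm_neg]; exact (add_le_add n1 n2).trans_eq (by ring)
  -- Here the brackets are at most `2 * v` and 1, so both terms are of order `v ^ (1 - γ)`.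
  have htinf : Tendsto F atTop (𝓝 0) := by
    have l := (tinf (γ - 1) (by linarith)).mul_const (2 / γ + 1 / (γ * (γ - 1)))
    rw [zero_mul] at l
    refine squeeze_zero_norm' ?_ l
    filter_upwards [eventually_gt_atTop 0] with v hv0
    have e1 : v ^ (-γ) * v = v ^ (-(γ - 1)) := by
      nth_rw 2 [← Real.rpow_one v]
      rw [← Real.rpow_add hv0]; congr 1; ring
    have e2 : v ^ (1 - γ) = v ^ (-(γ - 1)) := by congr 1; ring
    have hg : 0 < γ * (γ - 1) := mul_pos (by linarith) (by linarith)
    have b := hb v hv0.le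
    have b2 : 1 - Real.exp (-v) ≤ 1 := by linarith [Real.exp_pos (-v)]
    have b3 : 0 ≤ 1 - Real.exp (-v) := by
      have := Real.exp_le_one_iff.2 (neg_nonpos.2 hv0.le); linarith
    have n1 : ‖v ^ (-γ) / γ * (Real.exp (-v) - 1 + v)‖ ≤ v ^ (-(γ - 1)) * (2 / γ) := by
      rw [Real.norm_of_nonneg (mul_nonneg (by positivity) b.1), ← e1]
      calc _ ≤ v ^ (-γ) / γ * (2 * v) := by gcongr; exact b.2.trans (min_le_right _ _)
        _ = _ := by ring
    have n2 : ‖v ^ (1 - γ) / (γ * (γ - 1)) * (1 - Real.exp (-v))‖ ≤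
        v ^ (-(γ - 1)) * (1 / (γ * (γ - 1))) := by
      rw [Real.norm_of_nonneg (mul_nonneg (by positivity) b3), ← e2]
      calc _ ≤ v ^ (1 - γ) / (γ * (γ - 1)) * 1 := by gcongr
        _ = _ := by ring
    calc ‖F v‖ ≤ _ := norm_sub_le _ _
      _ ≤ _ := by rw [norm_neg]; exact (add_le_add n1 n2).trans_eq (by ring)
  have hF0 : F 0 = 0 := by simp [F]
  have hc : ContinuousWithinAt F (Set.Ici 0) 0 := by
    rw [← continuousWithinAt_Ioi_iff_Ici, ContinuousWithinAt, hF0]; exact ht0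
  have key := integral_Ioi_of_hasDerivAt_of_tendsto hc hF (i1.sub (i2.const_mul _)) htinf
  rw [integral_sub i1 (i2.const_mul _), integral_const_mul, hG, hF0, sub_zero, sub_eq_zero] at key
  rw [key]; ring

lemma levyIntegral_one {γ : ℝ} (h1 : 1 < γ) (h2 : γ < 2) :
    levyIntegral γ 1 = ((Real.Gamma (2 - γ) / (γ * (γ - 1)) : ℝ) : ℂ) := by
  rw [← integral_rpow_mul_exp_neg_sub h1 h2, levyIntegral, ← integral_complex_ofReal]
  congr 1
  ext v
  unfold expRemainder; push_cast; ring_nf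

/-- Both sides are holomorphic in the right half-plane and agree on the reals to the right of 1,
which accumulate at 1; the identity theorem applies. -/
lemma levyIntegral_eq_of_re_pos {γ : ℝ} (h1 : 1 < γ) (h2 : γ < 2) {z : ℂ} (hz : 0 < z.re) :
    levyIntegral γ z = z ^ (γ : ℂ) * levyIntegral γ 1 := by
  have hopen : IsOpen {z : ℂ | 0 < z.re} := isOpen_lt continuous_const Complex.continuous_re
  have hg : DifferentiableOn ℂ (fun z : ℂ => z ^ (γ : ℂ) * levyIntegral γ 1) {z | 0 < z.re} := by
    intro z hz
    exact ((differentiableAt_id.cpow_const (.inl hz)).mul_const _).differentiableWithinAt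
  have hconn : IsPreconnected {z : ℂ | 0 < z.re} := (convex_halfSpace_re_gt 0).isPreconnected
  refine ((differentiableOn_levyIntegral h1 h2).analyticOnNhd hopen).eqOn_of_preconnected_of_frequently_eq
    (hg.analyticOnNhd hopen) hconn (z₀ := 1) (by simp) ?_ hz
  have ht : Tendsto (fun x : ℝ => (x : ℂ)) (𝓝[>] 1) (𝓝[≠] 1) := by
    refine tendsto_nhdsWithin_iff.2 ⟨?_, ?_⟩
    · exact (Complex.continuous_ofReal.tendsto' 1 1 (by simp)).mono_left nhdsWithin_le_nhds
    · filter_upwards [self_mem_nhdsWithin] with x hx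
      have : x ≠ 1 := ne_of_gt hx
      simpa using this
  refine ht.frequently (Eventually.frequently ?_)
  filter_upwards [self_mem_nhdsWithin] with x hx
  have hx0 : 0 < x := zero_lt_one.trans hx
  rw [levyIntegral_ofReal γ hx0, Complex.ofReal_cpow hx0.le]

/-- The formula passes to the boundary along `ε + s i` as `ε` decreases to 0. The principal power is
continuous there, because `s i` with `s ≠ 0` is off the branch cut. -/
lemma levyIntegral_mul_I {γ : ℝ} (h1 : 1 < γ) (h2 : γ < 2) {s : ℝ} (hs : s ≠ 0) :
    levyIntegral γ (s * Complex.I) = (s * Complex.I) ^ (γ : ℂ) * levyIntegral γ 1 := by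
  have ht : Tendsto (fun ε : ℝ => (ε : ℂ) + s * Complex.I) (𝓝[>] 0) (𝓝 (s * Complex.I)) := by
    have : Continuous fun ε : ℝ => (ε : ℂ) + s * Complex.I := by fun_prop
    exact (this.tendsto' 0 _ (by simp)).mono_left nhdsWithin_le_nhds
  have hl : Tendsto (fun ε : ℝ => levyIntegral γ ((ε : ℂ) + s * Complex.I)) (𝓝[>] 0)
      (𝓝 (levyIntegral γ (s * Complex.I))) := by
    have hc := continuousOn_levyIntegral h1 h2 (s * Complex.I) (by simp)
    refine hc.tendsto.comp (tendsto_nhdsWithin_iff.2 ⟨ht, ?_⟩)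
    filter_upwards [self_mem_nhdsWithin] with ε hε
    have : 0 < ε := hε
    simpa using this.le
  have hr : Tendsto (fun ε : ℝ => ((ε : ℂ) + s * Complex.I) ^ (γ : ℂ) * levyIntegral γ 1) (𝓝[>] 0)
      (𝓝 ((s * Complex.I) ^ (γ : ℂ) * levyIntegral γ 1)) := by
    refine Tendsto.mul_const _ ?_
    have hslit : (s * Complex.I : ℂ) ∈ Complex.slitPlane := by
      right; simpa using hs
    exact ((continuousAt_id (x := (s * Complex.I : ℂ))).cpow continuousAt_const hslit).tendsto.comp ht
  refine tendsto_nhds_unique hl (hr.congr' ?_)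
  filter_upwards [self_mem_nhdsWithin] with ε hε
  exact (levyIntegral_eq_of_re_pos h1 h2 (by simpa using hε)).symm

/-! ### The characteristic exponent of a totally skewed stable law -/

/-- The characteristic exponent `-|s|^α (1 - i sign(s) tan(πα/2))` of `S_α(1, 1, 0)`. -/
noncomputable def stableExponent (α s : ℝ) : ℂ :=
  -((|s| ^ α : ℝ) : ℂ) *
    (1 - Complex.I * ((Real.sign s * Real.tan (Real.pi * α / 2) : ℝ) : ℂ))

lemma cos_pi_mul_half_neg {γ : ℝ} (h1 : 1 < γ) (h2 : γ < 2) :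
    Real.cos (Real.pi * γ / 2) < 0 := by
  have := Real.pi_pos
  exact Real.cos_neg_of_pi_div_two_lt_of_lt (by nlinarith) (by nlinarith)

lemma tailConstant_base_pos {γ : ℝ} (h1 : 1 < γ) (h2 : γ < 2) :
    0 < -(Real.Gamma (2 - γ) / (γ * (γ - 1)) * Real.cos (Real.pi * γ / 2)) := by
  have hG := Real.Gamma_pos_of_pos (s := 2 - γ) (by linarith)
  have hc := cos_pi_mul_half_neg h1 h2
  have : 0 < γ * (γ - 1) := mul_pos (by linarith) (by linarith)
  rw [← mul_neg]
  exact mul_pos (div_pos hG this) (by linarith)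

lemma tailConstant_pos {γ : ℝ} (h1 : 1 < γ) (h2 : γ < 2) : 0 < tailConstant γ :=
  Real.rpow_pos_of_pos (tailConstant_base_pos h1 h2) _

lemma tailConstant_rpow {γ : ℝ} (h1 : 1 < γ) (h2 : γ < 2) :
    tailConstant γ ^ γ =
      -(Real.Gamma (2 - γ) / (γ * (γ - 1)) * Real.cos (Real.pi * γ / 2)) := by
  rw [tailConstant, ← Real.rpow_mul (tailConstant_base_pos h1 h2).le,
    one_div_mul_cancel (by linarith), Real.rpow_one]

lemma stableExponent_zero {α : ℝ} (hα : α ≠ 0) : stableExponent α 0 = 0 := by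
  simp [stableExponent, Real.zero_rpow hα]

/-- The argument of `-s i` is `-sign(s) π/2`, which is the origin of the sign in the skewness term.
-/
lemma ofReal_mul_I_cpow {γ : ℝ} {s : ℝ} (hs : s ≠ 0) :
    ((-s : ℝ) * Complex.I : ℂ) ^ (γ : ℂ) = ((|s| ^ γ : ℝ) : ℂ) *
      ((Real.cos (Real.pi * γ / 2) : ℂ) -
        Complex.I * ((Real.sign s * Real.sin (Real.pi * γ / 2) : ℝ) : ℂ)) := by
  rw [Complex.cpow_ofReal]
  have hn : ‖((-s : ℝ) * Complex.I : ℂ)‖ = |s| := by simp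
  rw [hn]
  congr 1
  rcases lt_or_gt_of_ne hs with h | h
  · have ha : Complex.arg ((-s : ℝ) * Complex.I : ℂ) * γ = Real.pi * γ / 2 := by
      rw [Complex.arg_real_mul _ (by linarith), Complex.arg_I]; ring
    rw [ha, Real.sign_of_neg h]
    push_cast; ring
  · have ha : Complex.arg ((-s : ℝ) * Complex.I : ℂ) * γ = -(Real.pi * γ / 2) := by
      have : ((-s : ℝ) * Complex.I : ℂ) = (s : ℂ) * (-Complex.I) := by push_cast; ring
      rw [this, Complex.arg_real_mul _ h, Complex.arg_neg_I]; ring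
    rw [ha, Real.sign_of_pos h, Real.cos_neg, Real.sin_neg]
    push_cast; ring

/-- The Lévy integral of a totally skewed stable law. -/
theorem integral_rpow_mul_expRemainder_I_mul {γ : ℝ} (h1 : 1 < γ) (h2 : γ < 2) (s : ℝ) :
    ∫ v in Set.Ioi (0 : ℝ), ((v ^ (-γ - 1) : ℝ) : ℂ) * expRemainder (Complex.I * (s * v : ℝ)) =
      ((tailConstant γ ^ γ : ℝ) : ℂ) * stableExponent γ s := by
  rcases eq_or_ne s 0 with rfl | hs
  · simp [stableExponent_zero (show γ ≠ 0 by linarith)]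
  -- At `z = -s i` the factor `-z v` is `i s v`.
  have e : ∫ v in Set.Ioi (0 : ℝ), ((v ^ (-γ - 1) : ℝ) : ℂ) *
      expRemainder (Complex.I * (s * v : ℝ)) = levyIntegral γ ((-s : ℝ) * Complex.I) := by
    unfold levyIntegral
    congr 1
    ext v
    congr 2
    push_cast; ring
  rw [e, levyIntegral_mul_I h1 h2 (neg_ne_zero.2 hs), levyIntegral_one h1 h2, ofReal_mul_I_cpow hs,
    tailConstant_rpow h1 h2, stableExponent, Real.tan_eq_sin_div_cos]
  -- Factoring out the nonzero cosine turns the sine into the tangent; the minus sign in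
  -- `stableExponent` matches the one that makes `tailConstant γ ^ γ` positive.
  have hc : ((Real.cos (Real.pi * γ / 2) : ℝ) : ℂ) ≠ 0 := by
    exact_mod_cast (cos_pi_mul_half_neg h1 h2).ne
  have h0 : (γ : ℂ) ≠ 0 := by exact_mod_cast (by linarith : γ ≠ 0)
  have h1' : (γ : ℂ) - 1 ≠ 0 := by exact_mod_cast (by linarith : γ - 1 ≠ 0)
  push_cast at hc ⊢
  field_simp

/-! ### Poisson random measures -/

lemma lintegral_natCast_poissonMeasure (r : ℝ≥0) :
    ∫⁻ k : ℕ, (k : ℝ≥0∞) ∂(poissonMeasure r) = r := by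
  have hs : HasSum (fun k : ℕ => Real.exp (-r) * (r : ℝ) ^ k / (k.factorial : ℝ) * k) r := by
    rw [← hasSum_nat_add_iff' 1]
    have h := (hasSum_one_poissonMeasure r).mul_left (r : ℝ)
    simp only [mul_one] at h
    simp only [Finset.range_one, Finset.sum_singleton, Nat.cast_zero, mul_zero, sub_zero]
    refine h.congr_fun fun k => ?_
    rw [Nat.factorial_succ]
    push_cast
    field_simp
    ring
  rw [poissonMeasure, lintegral_sum_measure]
  simp only [lintegral_smul_measure, lintegral_dirac, smul_eq_mul]
  have e : ∀ k : ℕ, ENNReal.ofReal (Real.exp (-r) * (r : ℝ) ^ k / (k.factorial : ℝ)) * (k : ℝ≥0∞) =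
      ENNReal.ofReal (Real.exp (-r) * (r : ℝ) ^ k / (k.factorial : ℝ) * k) := fun k => by
    rw [ENNReal.ofReal_mul (by positivity), ENNReal.ofReal_natCast]
  simp only [e]
  rw [← ENNReal.ofReal_tsum_of_nonneg (fun k => by positivity) hs.summable, hs.tsum_eq]
  simp

section Poisson

variable {Ω E : Type*} [MeasurableSpace Ω] [MeasurableSpace E]
  {N : Ω → Measure E} {n : Measure E} {P : Measure Ω}

lemma IsPoissonRandomMeasure.lintegral_apply (hN : IsPoissonRandomMeasure N n P) {A : Set E}
    (hA : MeasurableSet A) (hnA : n A < ∞) : ∫⁻ ω, N ω A ∂P = n A := by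
  have hm : Measurable fun ω => N ω A := (Measure.measurable_coe hA).comp hN.measurable
  have h1 : ∫⁻ ω, N ω A ∂P = ∫⁻ x, x ∂(P.map fun ω => N ω A) :=
    (lintegral_map measurable_id hm).symm
  rw [h1, hN.law A hA hnA, lintegral_map (f := fun x => x) measurable_id .of_discrete,
    lintegral_natCast_poissonMeasure, ENNReal.coe_toNNReal hnA.ne]

/-- Means are prescribed only on sets of finite intensity, so the two measures are compared on an
exhausting sequence of such sets. Campbell's formula is this identity integrated. -/
lemma IsPoissonRandomMeasure.bind_eq [SigmaFinite n] (hN : IsPoissonRandomMeasure N n P) :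
    P.bind N = n := by
  rw [Measure.ext_iff_of_iUnion_eq_univ (iUnion_spanningSets n)]
  intro i
  ext A hA
  have hB : MeasurableSet (A ∩ spanningSets n i) := hA.inter (measurableSet_spanningSets n i)
  rw [Measure.restrict_apply hA, Measure.restrict_apply hA,
    Measure.bind_apply hB hN.measurable.aemeasurable]
  exact hN.lintegral_apply hB
    ((measure_mono Set.inter_subset_right).trans_lt (measure_spanningSets_lt_top n i))

lemma IsPoissonRandomMeasure.lintegral_lintegral [SigmaFinite n]
    (hN : IsPoissonRandomMeasure N n P) {h : E → ℝ≥0∞} (hh : Measurable h) :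
    ∫⁻ ω, ∫⁻ x, h x ∂(N ω) ∂P = ∫⁻ x, h x ∂n := by
  conv_rhs => rw [← hN.bind_eq]
  exact (Measure.lintegral_bind hN.measurable.aemeasurable hh.aemeasurable).symm

lemma IsPoissonRandomMeasure.measurable_lintegral (hN : IsPoissonRandomMeasure N n P)
    {h : E → ℝ≥0∞} (hh : Measurable h) : Measurable fun ω => ∫⁻ x, h x ∂(N ω) :=
  (Measure.measurable_lintegral hh).comp hN.measurable

lemma IsPoissonRandomMeasure.ae_integrable [SigmaFinite n] (hN : IsPoissonRandomMeasure N n P)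
    {g : E → ℝ} (hg : Measurable g) (hgi : Integrable g n) :
    ∀ᵐ ω ∂P, Integrable g (N ω) := by
  have h : ∫⁻ ω, ∫⁻ x, ‖g x‖ₑ ∂(N ω) ∂P ≠ ∞ := by
    rw [hN.lintegral_lintegral hg.enorm]; exact hgi.2.ne
  filter_upwards [ae_lt_top (hN.measurable_lintegral hg.enorm) h] with ω hω
  exact ⟨hg.aestronglyMeasurable, hω⟩

lemma IsPoissonRandomMeasure.integrable_integral_and_integral_integral [SigmaFinite n]
    (hN : IsPoissonRandomMeasure N n P) {g : E → ℝ} (hg : Measurable g) (hgi : Integrable g n) :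
    Integrable (fun ω => ∫ x, g x ∂(N ω)) P ∧ ∫ ω, ∫ x, g x ∂(N ω) ∂P = ∫ x, g x ∂n := by
  have part : ∀ f : E → ℝ, Measurable f → Integrable f n →
      Integrable (fun ω => (∫⁻ x, ENNReal.ofReal (f x) ∂(N ω)).toReal) P ∧
      ∫ ω, (∫⁻ x, ENNReal.ofReal (f x) ∂(N ω)).toReal ∂P =
        (∫⁻ x, ENNReal.ofReal (f x) ∂n).toReal := by
    intro f hf hfi
    have hm := hN.measurable_lintegral hf.ennreal_ofReal
    have h1 : ∫⁻ ω, ∫⁻ x, ENNReal.ofReal (f x) ∂(N ω) ∂P ≠ ∞ := by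
      rw [hN.lintegral_lintegral hf.ennreal_ofReal]; exact hfi.lintegral_lt_top.ne
    refine ⟨integrable_toReal_of_lintegral_ne_top hm.aemeasurable h1, ?_⟩
    rw [integral_toReal hm.aemeasurable (ae_lt_top hm h1), hN.lintegral_lintegral hf.ennreal_ofReal]
  have e : (fun ω => ∫ x, g x ∂(N ω)) =ᵐ[P] fun ω =>
      (∫⁻ x, ENNReal.ofReal (g x) ∂(N ω)).toReal -
        (∫⁻ x, ENNReal.ofReal (-g x) ∂(N ω)).toReal := by
    filter_upwards [hN.ae_integrable hg hgi] with ω hω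
    exact integral_eq_lintegral_pos_part_sub_lintegral_neg_part hω
  obtain ⟨i1, e1⟩ := part g hg hgi
  obtain ⟨i2, e2⟩ := part (fun x => -g x) hg.neg hgi.neg
  refine ⟨(i1.sub i2).congr e.symm, ?_⟩
  rw [integral_congr_ae e, integral_sub i1 i2, e1, e2]
  exact (integral_eq_lintegral_pos_part_sub_lintegral_neg_part hgi).symm

end Poisson

/-- Independence is postulated for families indexed by `Fin k`, while the fibres of a simple
function are indexed by a finset of values; an enumeration of the finset connects the two. -/
lemma iIndepFun_finset_of_fin {Ω ι : Type*} {β : Type*} [MeasurableSpace Ω] [MeasurableSpace β]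
    {P : Measure Ω} {s : Finset ι} {X : ι → Ω → β}
    (h : ∀ (k : ℕ) (e : Fin k → ι), Function.Injective e → (∀ i, e i ∈ s) →
      iIndepFun (fun i => X (e i)) P) : iIndepFun (s.restrict X) P := by
  have h1 := h s.card (fun i => (s.equivFin.symm i : ι))
    (Subtype.val_injective.comp s.equivFin.symm.injective) (fun i => (s.equivFin.symm i).2)
  have h2 := h1.precomp s.equivFin.injective
  convert h2 using 2 with i
  simp

lemma norm_exp_I_mul_sub_exp_I_mul_le (a b : ℝ) :
    ‖Complex.exp (Complex.I * a) - Complex.exp (Complex.I * b)‖ ≤ |a - b| := by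
  have e : Complex.exp (Complex.I * a) - Complex.exp (Complex.I * b) =
      Complex.exp (Complex.I * b) * (Complex.exp (Complex.I * (a - b : ℝ)) - 1) := by
    rw [mul_sub, ← Complex.exp_add]; push_cast; ring_nf
  rw [e, norm_mul, mul_comm Complex.I (b : ℂ), Complex.norm_exp_ofReal_mul_I, one_mul]
  exact Real.norm_exp_I_mul_ofReal_sub_one_le

lemma integrable_exp_I_mul_sub_one {E : Type*} [MeasurableSpace E] {n : Measure E} {g : E → ℝ}
    (hg : Integrable g n) : Integrable (fun x => Complex.exp (Complex.I * g x) - 1) n := by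
  have hm := hg.aestronglyMeasurable.aemeasurable
  refine hg.abs.mono' (by fun_prop : AEMeasurable
    (fun x => Complex.exp (Complex.I * g x) - 1) n).aestronglyMeasurable (.of_forall fun x => ?_)
  simpa using norm_exp_I_mul_sub_exp_I_mul_le (g x) 0

/-! ### Characteristic functionals of Poisson integrals -/

section PoissonCharFun

variable {Ω E : Type*} [MeasurableSpace Ω] [MeasurableSpace E]
  {N : Ω → Measure E} {n : Measure E} {P : Measure Ω}

lemma IsPoissonRandomMeasure.integral_exp_measureReal (hN : IsPoissonRandomMeasure N n P)
    {A : Set E} (hA : MeasurableSet A) (hnA : n A < ∞) (c : ℝ) :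
    ∫ ω, Complex.exp (Complex.I * (c * (N ω).real A : ℝ)) ∂P =
      Complex.exp (n.real A * (Complex.exp (Complex.I * c) - 1)) := by
  have hm : Measurable fun ω => N ω A := (Measure.measurable_coe hA).comp hN.measurable
  have h1 : ∫ ω, Complex.exp (Complex.I * (c * (N ω).real A : ℝ)) ∂P =
      ∫ x : ℝ≥0∞, Complex.exp (Complex.I * (c * x.toReal : ℝ)) ∂(P.map fun ω => N ω A) := by
    rw [integral_map hm.aemeasurable]
    · rfl
    · exact (by fun_prop : Measurable fun x : ℝ≥0∞ =>
        Complex.exp (Complex.I * (c * x.toReal : ℝ))).aestronglyMeasurable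
  rw [h1, hN.law A hA hnA, integral_map (AEMeasurable.of_discrete)]
  · have h2 := charFun_map_cast_poissonMeasure (n A).toNNReal c
    rw [charFun_apply_real, integral_map .of_discrete (by fun_prop)] at h2
    convert h2 using 3
    · simp; ring_nf
    · rfl
    · rw [mul_comm]
  · exact (by fun_prop : Measurable fun x : ℝ≥0∞ =>
        Complex.exp (Complex.I * (c * x.toReal : ℝ))).aestronglyMeasurable

/-- The fibres carry independent Poisson counts, so the expectation factorises and the Poisson
exponents add up to an integral. -/
lemma IsPoissonRandomMeasure.integral_exp_integral_simpleFunc [SigmaFinite n]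
    (hN : IsPoissonRandomMeasure N n P) (φ : SimpleFunc E ℝ) (hφ : Integrable φ n) :
    ∫ ω, Complex.exp (Complex.I * (∫ x, φ x ∂(N ω) : ℝ)) ∂P =
      Complex.exp (∫ x, (Complex.exp (Complex.I * φ x) - 1) ∂n) := by
  classical
  -- The fibre over zero may have infinite intensity; it contributes nothing to either side and is
  -- dropped.
  set s : Finset ℝ := φ.range.filter (· ≠ 0) with hs
  have hfin : ∀ c ∈ s, n (φ ⁻¹' {c}) < ∞ := fun c hc =>
    SimpleFunc.measure_preimage_lt_top_of_integrable φ hφ (Finset.mem_filter.1 hc).2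
  have hind : iIndepFun (s.restrict fun c ω => N ω (φ ⁻¹' {c})) P := by
    refine iIndepFun_finset_of_fin fun k e he _ => ?_
    refine hN.indep k (fun i => φ ⁻¹' {e i}) (fun i => φ.measurableSet_fiber _) fun i j hij => ?_
    exact Disjoint.preimage _ (by simpa using he.ne hij)
  have hf : ∀ c : ℝ, Measurable fun y : ℝ≥0∞ => Complex.exp (Complex.I * (c * y.toReal : ℝ)) :=
    fun c => by fun_prop
  have h1 : ∫ ω, Complex.exp (Complex.I * (∫ x, φ x ∂(N ω) : ℝ)) ∂P =
      ∫ ω, ∏ c : s, Complex.exp (Complex.I * ((c : ℝ) * (N ω).real (φ ⁻¹' {(c : ℝ)}) : ℝ)) ∂P := by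
    refine integral_congr_ae ?_
    filter_upwards [hN.ae_integrable φ.measurable hφ] with ω hω
    rw [← SimpleFunc.integral_eq_integral φ hω, SimpleFunc.integral_eq,
      ← Finset.sum_filter_of_ne (p := (· ≠ 0)), ← hs, ← Finset.sum_coe_sort, ← Complex.exp_sum,
      Complex.ofReal_sum, Finset.mul_sum]
    · simp [mul_comm]
    · intro c _ hc h0
      simp [h0] at hc
  have h2 : ∫ x, (Complex.exp (Complex.I * φ x) - 1) ∂n =
      ∑ c ∈ s, n.real (φ ⁻¹' {c}) * (Complex.exp (Complex.I * c) - 1) := by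
    have hm := SimpleFunc.map_integral φ (fun c : ℝ => Complex.exp (Complex.I * c) - 1) hφ (by simp)
    have hi : Integrable (φ.map fun c : ℝ => Complex.exp (Complex.I * c) - 1) n :=
      integrable_exp_I_mul_sub_one hφ
    rw [SimpleFunc.integral_eq_integral _ hi] at hm
    simp only [SimpleFunc.coe_map, Function.comp_def] at hm
    rw [hm, hs, Finset.sum_filter_of_ne]
    · simp
    · intro c _ hc h0
      simp [h0] at hc
  have h3 := hind.integral_fun_prod_comp
    (f := fun (c : s) (y : ℝ≥0∞) => Complex.exp (Complex.I * ((c : ℝ) * y.toReal : ℝ)))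
    (fun c => ((Measure.measurable_coe (φ.measurableSet_fiber _)).comp hN.measurable).aemeasurable)
    (fun c => (hf c).aestronglyMeasurable)
  rw [h1, h2, Complex.exp_sum, ← Finset.prod_coe_sort]
  refine h3.trans (Finset.prod_congr rfl fun c _ => ?_)
  exact hN.integral_exp_measureReal (φ.measurableSet_fiber _) (hfin c c.2) c

variable [IsProbabilityMeasure P]

/-- The characteristic functional of a Poisson random measure. -/
theorem IsPoissonRandomMeasure.integral_exp_integral [SigmaFinite n]
    (hN : IsPoissonRandomMeasure N n P) {g : E → ℝ} (hg : Measurable g) (hgi : Integrable g n) :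
    ∫ ω, Complex.exp (Complex.I * (∫ x, g x ∂(N ω) : ℝ)) ∂P =
      Complex.exp (∫ x, (Complex.exp (Complex.I * g x) - 1) ∂n) := by
  let φ : ℕ → SimpleFunc E ℝ := fun m =>
    SimpleFunc.approxOn g hg (Set.range g ∪ {0}) 0 (by simp) m
  have hφi : ∀ m, Integrable (φ m) n := fun m => SimpleFunc.integrable_approxOn_range hg hgi m
  -- Both the exponent on the right and the expectation on the left change by at most this `L¹`
  -- distance, the latter by Campbell's formula applied to `|φ m - g|`.
  have hφ : Tendsto (fun m => ∫ x, |φ m x - g x| ∂n) atTop (𝓝 0) := by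
    have h := SimpleFunc.tendsto_approxOn_range_L1_enorm hg hgi
    have h2 := (ENNReal.tendsto_toReal ENNReal.zero_ne_top).comp h
    refine h2.congr fun m => ?_
    exact (integral_norm_eq_lintegral_enorm ((hφi m).sub hgi).aestronglyMeasurable).symm
  have hI := fun f hf hfi => hN.integrable_integral_and_integral_integral (g := f) hf hfi
  have hexp' : ∀ f : E → ℝ, Integrable f n → Measurable f →
      Integrable (fun ω => Complex.exp (Complex.I * (∫ x, f x ∂(N ω) : ℝ))) P := fun f hf hfm => by
    refine (integrable_const (1 : ℝ)).mono' ?_ (.of_forall fun ω => ?_)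
    · have := (hI f hfm hf).1.aestronglyMeasurable.aemeasurable
      exact (by fun_prop : AEMeasurable
        (fun ω => Complex.exp (Complex.I * (∫ x, f x ∂(N ω) : ℝ))) P).aestronglyMeasurable
    · rw [mul_comm, Complex.norm_exp_ofReal_mul_I]
  have hR : Tendsto (fun m => Complex.exp (∫ x, (Complex.exp (Complex.I * φ m x) - 1) ∂n)) atTop
      (𝓝 (Complex.exp (∫ x, (Complex.exp (Complex.I * g x) - 1) ∂n))) := by
    refine (Complex.continuous_exp.tendsto _).comp ?_
    rw [tendsto_iff_norm_sub_tendsto_zero]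
    refine squeeze_zero (fun _ => norm_nonneg _) (fun m => ?_) hφ
    rw [← integral_sub (integrable_exp_I_mul_sub_one (hφi m)) (integrable_exp_I_mul_sub_one hgi)]
    refine (norm_integral_le_integral_norm _).trans (integral_mono_of_nonneg
      (.of_forall fun _ => norm_nonneg _) ((hφi m).sub hgi).abs (.of_forall fun x => ?_))
    simpa using norm_exp_I_mul_sub_exp_I_mul_le (φ m x) (g x)
  have hL : Tendsto (fun m => ∫ ω, Complex.exp (Complex.I * (∫ x, φ m x ∂(N ω) : ℝ)) ∂P) atTop
      (𝓝 (∫ ω, Complex.exp (Complex.I * (∫ x, g x ∂(N ω) : ℝ)) ∂P)) := by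
    rw [tendsto_iff_norm_sub_tendsto_zero]
    refine squeeze_zero (fun _ => norm_nonneg _) (fun m => ?_) hφ
    have hd := hI (fun x => |φ m x - g x|) ((φ m).measurable.sub hg).abs ((hφi m).sub hgi).abs
    rw [← integral_sub (hexp' _ (hφi m) (φ m).measurable) (hexp' _ hgi hg), ← hd.2]
    refine (norm_integral_le_integral_norm _).trans (integral_mono_of_nonneg
      (.of_forall fun _ => norm_nonneg _) hd.1 ?_)
    filter_upwards [hN.ae_integrable (φ m).measurable (hφi m), hN.ae_integrable hg hgi]
      with ω h1 h2
    refine (norm_exp_I_mul_sub_exp_I_mul_le _ _).trans ?_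
    rw [← integral_sub h1 h2]
    exact abs_integral_le_integral_abs
  refine tendsto_nhds_unique hL (hR.congr fun m => ?_)
  exact (hN.integral_exp_integral_simpleFunc (φ m) (hφi m)).symm

/-- The characteristic functional of a compensated Poisson random measure. -/
theorem IsPoissonRandomMeasure.integral_exp_centred [SigmaFinite n]
    (hN : IsPoissonRandomMeasure N n P) {g : E → ℝ} (hg : Measurable g) (hgi : Integrable g n) :
    ∫ ω, Complex.exp (Complex.I * (∫ x, g x ∂(N ω) - ∫ x, g x ∂n : ℝ)) ∂P =
      Complex.exp (∫ x, expRemainder (Complex.I * g x) ∂n) := by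
  have e : ∀ ω, Complex.exp (Complex.I * (∫ x, g x ∂(N ω) - ∫ x, g x ∂n : ℝ)) =
      Complex.exp (Complex.I * (∫ x, g x ∂(N ω) : ℝ)) *
        Complex.exp (-(Complex.I * (∫ x, g x ∂n : ℝ))) := fun ω => by
    rw [← Complex.exp_add]; push_cast; ring_nf
  simp only [e]
  rw [integral_mul_const, hN.integral_exp_integral hg hgi, ← Complex.exp_add]
  congr 1
  have i2 : Integrable (fun x => Complex.I * (g x : ℂ)) n := hgi.ofReal.const_mul _
  unfold expRemainder
  rw [integral_sub (integrable_exp_I_mul_sub_one hgi) i2, integral_const_mul,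
    integral_complex_ofReal]
  ring

end PoissonCharFun

/-! ### The continuity theorem for characteristic functions -/

section Levy

variable {ι Ω' : Type*} {Ω : ι → Type*} [∀ i, MeasurableSpace (Ω i)] [MeasurableSpace Ω']
  {P : ∀ i, Measure (Ω i)} [∀ i, IsProbabilityMeasure (P i)]
  {P' : Measure Ω'} [IsProbabilityMeasure P'] {l : Filter ι} [l.IsCountablyGenerated]

lemma charFun_map_toLp {Ω : Type*} [MeasurableSpace Ω] {P : Measure Ω} {k : ℕ}
    {X : Ω → Fin k → ℝ} (hX : AEMeasurable X P) (t : EuclideanSpace ℝ (Fin k)) :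
    charFun (P.map fun ω => WithLp.toLp 2 (X ω)) t =
      ∫ ω, Complex.exp (Complex.I * (∑ j, t j * X ω j : ℝ)) ∂P := by
  have hm : AEMeasurable (fun ω => WithLp.toLp 2 (X ω)) P :=
    (PiLp.continuous_toLp 2 _).measurable.comp_aemeasurable hX
  rw [charFun_apply, integral_map hm (by fun_prop)]
  congr 1
  ext ω
  rw [PiLp.inner_apply, mul_comm]
  simp

/-- Lévy's continuity theorem for random vectors on varying probability spaces. -/
theorem tendstoInDistribution_of_tendsto_integral_exp {k : ℕ} {X : ∀ i, Ω i → Fin k → ℝ}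
    {Z : Ω' → Fin k → ℝ} (hX : ∀ i, AEMeasurable (X i) (P i)) (hZ : AEMeasurable Z P')
    (h : ∀ t : Fin k → ℝ, Tendsto
      (fun i => ∫ ω, Complex.exp (Complex.I * (∑ j, t j * X i ω j : ℝ)) ∂(P i)) l
      (𝓝 (∫ ω, Complex.exp (Complex.I * (∑ j, t j * Z ω j : ℝ)) ∂P'))) :
    TendstoInDistribution X l Z P P' := by
  have hc : Continuous fun x : Fin k → ℝ => (WithLp.toLp 2 x : EuclideanSpace ℝ (Fin k)) :=
    PiLp.continuous_toLp 2 _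
  have h2 : TendstoInDistribution
      (fun i ω => (WithLp.toLp 2 (X i ω) : EuclideanSpace ℝ (Fin k))) l
      (fun ω => WithLp.toLp 2 (Z ω)) P P' := by
    refine ⟨fun i => hc.measurable.comp_aemeasurable (hX i),
      hc.measurable.comp_aemeasurable hZ, ?_⟩
    -- The filter is countably generated, so convergence may be tested along sequences.
    refine tendsto_of_seq_tendsto fun u hu => ?_
    refine ProbabilityMeasure.tendsto_of_tendsto_charFun fun t => ?_
    have h1 := (h t).comp hu
    rw [← charFun_map_toLp hZ] at h1
    refine h1.congr fun i => ?_
    exact (charFun_map_toLp (hX (u i)) t).symm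
  exact h2.continuous_comp (g := fun x : EuclideanSpace ℝ (Fin k) => WithLp.ofLp x)
    (PiLp.continuous_ofLp 2 _)

end Levy

/-! ### Convergence in measure -/

section InMeasure

variable {Ω : Type*} [MeasurableSpace Ω] {P : Measure Ω}

lemma tendstoInMeasure_add {X Y : ℕ → Ω → ℝ} {A B : Ω → ℝ}
    (hX : TendstoInMeasure P X atTop A) (hY : TendstoInMeasure P Y atTop B) :
    TendstoInMeasure P (fun n ω => X n ω + Y n ω) atTop (fun ω => A ω + B ω) := by
  rw [tendstoInMeasure_iff_norm] at *
  intro ε hε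
  have h := (hX (ε / 2) (half_pos hε)).add (hY (ε / 2) (half_pos hε))
  rw [add_zero] at h
  refine tendsto_of_tendsto_of_tendsto_of_le_of_le tendsto_const_nhds h (fun _ => zero_le) fun n => ?_
  refine (measure_mono ?_).trans (measure_union_le _ _)
  intro ω hω
  simp only [Set.mem_ofPred_eq, Set.mem_union, Real.norm_eq_abs] at hω ⊢
  by_contra! hc
  have e : X n ω + Y n ω - (A ω + B ω) = (X n ω - A ω) + (Y n ω - B ω) := by ring
  have := abs_add_le (X n ω - A ω) (Y n ω - B ω)
  rw [e] at hω
  linarith [hc.1, hc.2]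

lemma tendstoInMeasure_const_mul {X : ℕ → Ω → ℝ} {A : Ω → ℝ} (c : ℝ)
    (hX : TendstoInMeasure P X atTop A) :
    TendstoInMeasure P (fun n ω => c * X n ω) atTop (fun ω => c * A ω) := by
  rw [tendstoInMeasure_iff_norm] at *
  intro ε hε
  refine tendsto_of_tendsto_of_tendsto_of_le_of_le tendsto_const_nhds
    (hX (ε / (|c| + 1)) (by positivity)) (fun _ => zero_le) fun n => measure_mono ?_
  intro ω hω
  simp only [Set.mem_ofPred_eq, Real.norm_eq_abs] at hω ⊢
  rw [← mul_sub, abs_mul] at hω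
  rw [div_le_iff₀ (by positivity)]
  nlinarith [abs_nonneg (X n ω - A ω)]

/-- Every subsequence has a further one converging almost surely, and the integrands have modulus 1.
-/
lemma tendsto_integral_exp_of_tendstoInMeasure [IsProbabilityMeasure P] {X : ℕ → Ω → ℝ}
    {A : Ω → ℝ} (hX : ∀ n, AEMeasurable (X n) P) (h : TendstoInMeasure P X atTop A) :
    Tendsto (fun n => ∫ ω, Complex.exp (Complex.I * X n ω) ∂P) atTop
      (𝓝 (∫ ω, Complex.exp (Complex.I * A ω) ∂P)) := by
  refine tendsto_of_subseq_tendsto fun ns hns => ?_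
  obtain ⟨ms, -, hms⟩ := (h.comp hns).exists_seq_tendsto_ae
  refine ⟨ms, tendsto_integral_of_dominated_convergence (fun _ => 1) (fun n => ?_)
    (integrable_const _) (fun n => .of_forall fun ω => ?_) ?_⟩
  · have := hX (ns (ms n))
    exact (by fun_prop : AEMeasurable
      (fun ω => Complex.exp (Complex.I * X (ns (ms n)) ω)) P).aestronglyMeasurable
  · rw [mul_comm, Complex.norm_exp_ofReal_mul_I]
  · filter_upwards [hms] with ω hω
    have hc : Continuous fun y : ℝ => Complex.exp (Complex.I * y) := by fun_prop
    exact (hc.tendsto _).comp hω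

/-- A sequence whose increments are summably small in probability converges in probability. -/
lemma exists_tendstoInMeasure_of_summable [IsProbabilityMeasure P] {X : ℕ → Ω → ℝ}
    (hX : ∀ n, AEMeasurable (X n) P)
    (h : ∀ n, P {ω | (1 / 2 : ℝ) ^ n < |X (n + 1) ω - X n ω|} ≤ ENNReal.ofReal ((1 / 2) ^ n)) :
    ∃ Y, Measurable Y ∧ TendstoInMeasure P X atTop Y := by
  have hs : ∑' n, P {ω | (1 / 2 : ℝ) ^ n < |X (n + 1) ω - X n ω|} ≠ ∞ := by
    refine ne_top_of_le_ne_top ?_ (ENNReal.tsum_le_tsum h)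
    rw [← ENNReal.ofReal_tsum_of_nonneg (fun n => by positivity) summable_geometric_two]
    exact ENNReal.ofReal_ne_top
  have hae : ∀ᵐ ω ∂P, ∃ y, Tendsto (fun n => X n ω) atTop (𝓝 y) := by
    -- Borel–Cantelli: almost surely the increments are eventually at most `(1 / 2) ^ n`.
    filter_upwards [ae_eventually_notMem hs] with ω hω
    obtain ⟨m, hm⟩ := eventually_atTop.1 hω
    have hsum : Summable fun n => dist (X (n + m) ω) (X (n + m).succ ω) := by
      refine Summable.of_nonneg_of_le (fun _ => dist_nonneg) (fun n => ?_)
        ((summable_nat_add_iff m).2 summable_geometric_two)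
      have := hm (n + m) (by omega)
      rw [not_lt] at this
      rwa [dist_comm, Real.dist_eq]
    have hsum' := (summable_nat_add_iff (f := fun n => dist (X n ω) (X n.succ ω)) m).1 hsum
    exact cauchySeq_tendsto_of_complete (cauchySeq_of_summable_dist hsum')
  obtain ⟨Y, hYm, hY⟩ := measurable_limit_of_tendsto_metrizable_ae hX hae
  exact ⟨Y, hYm, tendstoInMeasure_of_tendsto_ae (fun n => (hX n).aestronglyMeasurable) hY⟩

end InMeasure

/-! ### Properties of the characteristic exponent -/

/-- Writing `|s| ^ α * sign s` as a difference of powers of the positive and negative parts removes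
the discontinuous sign. Continuity becomes visible. -/
lemma stableExponent_eq {α : ℝ} (hα : 0 < α) (s : ℝ) :
    stableExponent α s = -((|s| ^ α : ℝ) : ℂ) + Complex.I *
      ((Real.tan (Real.pi * α / 2) * (max s 0 ^ α - (-min s 0) ^ α) : ℝ) : ℂ) := by
  have h : |s| ^ α * Real.sign s = max s 0 ^ α - (-min s 0) ^ α := by
    rcases lt_trichotomy s 0 with h | rfl | h
    · rw [Real.sign_of_neg h, max_eq_right h.le, min_eq_left h.le, abs_of_neg h,
        Real.zero_rpow hα.ne']; ring
    · simp
    · rw [Real.sign_of_pos h, max_eq_left h.le, min_eq_right h.le, abs_of_pos h, neg_zero,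
        Real.zero_rpow hα.ne']; ring
  rw [← h, stableExponent]
  push_cast; ring

lemma continuous_stableExponent {α : ℝ} (hα : 0 < α) : Continuous (stableExponent α) := by
  have e : stableExponent α = fun s => -((|s| ^ α : ℝ) : ℂ) + Complex.I *
      ((Real.tan (Real.pi * α / 2) * (max s 0 ^ α - (-min s 0) ^ α) : ℝ) : ℂ) :=
    funext (stableExponent_eq hα)
  rw [e]
  have h : ∀ g : ℝ → ℝ, Continuous g → Continuous fun s => g s ^ α := fun g hg =>
    hg.rpow_const fun _ => .inr hα.le
  have h1 := h _ continuous_abs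
  have h2 := h (fun s => max s 0) (by fun_prop)
  have h3 := h (fun s => -min s 0) (by fun_prop)
  fun_prop

lemma norm_stableExponent_le (α s : ℝ) :
    ‖stableExponent α s‖ ≤ (1 + |Real.tan (Real.pi * α / 2)|) * |s| ^ α := by
  have hs : |Real.sign s| ≤ 1 := by
    rcases Real.sign_apply_eq s with h | h | h <;> simp [h]
  rw [stableExponent, norm_mul, norm_neg, Complex.norm_real,
    Real.norm_of_nonneg (by positivity), mul_comm]
  gcongr
  refine (norm_sub_le _ _).trans ?_
  rw [norm_one, norm_mul, Complex.norm_I, one_mul, Complex.norm_real, Real.norm_eq_abs, abs_mul]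
  gcongr
  exact mul_le_of_le_one_left (abs_nonneg _) hs

lemma re_stableExponent_nonpos (α s : ℝ) : (stableExponent α s).re ≤ 0 := by
  have : 0 ≤ |s| ^ α := by positivity
  rw [stableExponent, ← Complex.ofReal_neg, Complex.re_ofReal_mul]
  generalize Real.sign s * Real.tan (Real.pi * α / 2) = r
  simpa using this

lemma integrable_abs_rpow {E : Type*} [MeasurableSpace E] {m : Measure E} {α : ℝ} (hα : 0 < α)
    {f : E → ℝ} (hf : MemLp f (ENNReal.ofReal α) m) : Integrable (fun x => |f x| ^ α) m := by
  have h := hf.integrable_norm_rpow (by simpa using hα) ENNReal.ofReal_ne_top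
  simpa [ENNReal.toReal_ofReal hα.le] using h

lemma integrable_stableExponent {E : Type*} [MeasurableSpace E] {m : Measure E} {α : ℝ}
    (hα : 0 < α) {f : E → ℝ} (hf : MemLp f (ENNReal.ofReal α) m) :
    Integrable (fun x => stableExponent α (f x)) m :=
  ((integrable_abs_rpow hα hf).const_mul _).mono'
    ((continuous_stableExponent hα).comp_aestronglyMeasurable hf.1)
    (.of_forall fun _ => norm_stableExponent_le _ _)

/-- The tails of a random variable whose log-characteristic function is `O(|θ|^α)`. -/
lemma measureReal_lt_abs_le_of_integral_exp {Ω : Type*} [MeasurableSpace Ω] {P : Measure Ω}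
    [IsProbabilityMeasure P] {X : Ω → ℝ} (hX : AEMeasurable X P) {α K r : ℝ} (hα : 0 < α)
    (hK : 0 ≤ K) (hr : 0 < r) (z : ℝ → ℂ) (hz : ∀ θ, (z θ).re ≤ 0)
    (hzK : ∀ θ, ‖z θ‖ ≤ K * |θ| ^ α)
    (h : ∀ θ : ℝ, ∫ ω, Complex.exp (Complex.I * (θ * X ω : ℝ)) ∂P = Complex.exp (z θ)) :
    P.real {ω | r < |X ω|} ≤ 2 * (2 / r) ^ α * K := by
  have : IsProbabilityMeasure (P.map X) := Measure.isProbabilityMeasure_map hX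
  have h1 := measureReal_abs_gt_le_integral_charFun (μ := P.map X) hr
  have hc : ∀ θ, charFun (P.map X) θ = Complex.exp (z θ) := fun θ => by
    rw [charFun_apply_real, integral_map hX (by fun_prop), ← h θ]
    congr 1; ext ω; push_cast; ring_nf
  -- For `|t| ≤ 2 / r` the integrand `1 - exp (z t)` has modulus at most `‖z t‖ ≤ K * (2 / r) ^ α`,
  -- and the interval has length `4 / r`.
  have h2 : ‖∫ t in (-2 * r⁻¹)..(2 * r⁻¹), 1 - charFun (P.map X) t‖ ≤
      (K * (2 / r) ^ α) * |2 * r⁻¹ - -2 * r⁻¹| := by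
    refine intervalIntegral.norm_integral_le_of_norm_le_const fun t ht => ?_
    rw [hc, norm_sub_rev]
    refine (norm_exp_sub_one_le_norm (hz t)).trans ((hzK t).trans ?_)
    have hr' : 0 < r⁻¹ := by positivity
    rw [Set.uIoc_of_le (by linarith)] at ht
    gcongr
    rw [abs_le, div_eq_mul_inv]
    constructor <;> linarith [ht.1, ht.2]
  have h3 : (P.map X).real {x | r < |x|} = P.real {ω | r < |X ω|} := by
    rw [map_measureReal_apply_of_aemeasurable hX (measurableSet_lt measurable_const (by fun_prop))]
    rfl
  rw [h3] at h1
  refine h1.trans ?_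
  have hr' : 0 < r⁻¹ := by positivity
  have e : |2 * r⁻¹ - -2 * r⁻¹| = 4 * r⁻¹ := by rw [abs_of_pos (by linarith)]; ring
  rw [e] at h2
  calc _ ≤ 2⁻¹ * r * ((K * (2 / r) ^ α) * (4 * r⁻¹)) := by gcongr
    _ = _ := by field_simp; ring

/-! ### Integrals of simple functions -/

section Stable

variable {Ω E : Type*} [MeasurableSpace Ω] [MeasurableSpace E] {P : Measure Ω}
  {Λ : Set E → Ω → ℝ} {α : ℝ} {m : Measure E}

lemma IsStableRandomMeasure.integral_exp (hΛ : IsStableRandomMeasure Λ α m P) (hα : 0 < α)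
    {A : Set E} (hA : MeasurableSet A) (hmA : m A < ∞) (c : ℝ) :
    ∫ ω, Complex.exp (Complex.I * (c * Λ A ω : ℝ)) ∂P =
      Complex.exp (m.real A * stableExponent α c) := by
  have h := (hΛ.law A hA hmA).charFun_eq c
  rw [charFun_apply_real, integral_map (hΛ.law A hA hmA).aemeasurable (by fun_prop)] at h
  rw [← Real.rpow_mul ENNReal.toReal_nonneg, one_div_mul_cancel hα.ne', Real.rpow_one, one_mul] at h
  calc _ = _ := by congr 1; ext ω; push_cast; ring_nf
    _ = _ := h
    _ = _ := by rw [stableExponent, Measure.real]; push_cast; ring_nf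

/-- A null set has scale zero, so the tail estimate holds with `K = 0` at every level. In particular
`Λ ∅ = 0` almost surely, which is not among the axioms. -/
lemma IsStableRandomMeasure.ae_eq_zero [IsProbabilityMeasure P]
    (hΛ : IsStableRandomMeasure Λ α m P) (hα : 0 < α)
    {A : Set E} (hA : MeasurableSet A) (hmA : m A = 0) : ∀ᵐ ω ∂P, Λ A ω = 0 := by
  have hm : m A < ∞ := by simp [hmA]
  have h : ∀ n : ℕ, ∀ᵐ ω ∂P, |Λ A ω| ≤ 1 / ((n : ℝ) + 1) := fun n => by
    have h1 := measureReal_lt_abs_le_of_integral_exp (hΛ.measurable A hA hm).aemeasurable hα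
      le_rfl (by positivity : (0 : ℝ) < 1 / ((n : ℝ) + 1)) (fun _ => 0) (fun _ => le_rfl)
      (fun _ => by simp) (fun θ => by
        rw [hΛ.integral_exp hα hA hm, Measure.real, hmA]; simp)
    rw [mul_zero] at h1
    have h2 := (measureReal_eq_zero_iff (measure_ne_top _ _)).1 (le_antisymm h1 measureReal_nonneg)
    rw [ae_iff]
    simpa using h2
  filter_upwards [ae_all_iff.2 h] with ω hω
  have h1 := ge_of_tendsto' tendsto_one_div_add_atTop_nhds_zero_nat hω
  exact abs_eq_zero.1 (le_antisymm h1 (abs_nonneg _))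

/-- Countable additivity is applied to `A, B, ∅, ∅, …`; the padding vanishes almost surely. -/
lemma IsStableRandomMeasure.union [IsProbabilityMeasure P]
    (hΛ : IsStableRandomMeasure Λ α m P) (hα : 0 < α) {A B : Set E} (hA : MeasurableSet A)
    (hB : MeasurableSet B) (hmA : m A < ∞) (hmB : m B < ∞) (hAB : Disjoint A B) :
    ∀ᵐ ω ∂P, Λ (A ∪ B) ω = Λ A ω + Λ B ω := by
  let D : ℕ → Set E := fun i => if i = 0 then A else if i = 1 then B else ∅
  have hU : ⋃ i, D i = A ∪ B := by
    ext x
    simp only [Set.mem_iUnion, Set.mem_union]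
    constructor
    · rintro ⟨i, hi⟩
      by_cases h0 : i = 0
      · left; simpa [D, h0] using hi
      by_cases h1 : i = 1
      · right; simpa [D, h1] using hi
      · simp [D, h0, h1] at hi
    · rintro (h | h)
      · exact ⟨0, by simpa [D] using h⟩
      · exact ⟨1, by simpa [D] using h⟩
  have hD : ∀ i, MeasurableSet (D i) := fun i => by
    simp only [D]; split_ifs <;> simp [hA, hB]
  have hdis : Pairwise (fun i j => Disjoint (D i) (D j)) := fun i j hij => by
    simp only [D]
    split_ifs <;> simp_all [hAB.symm]
  have hs := hΛ.sigma_additive D hD hdis (by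
    rw [hU]; exact measure_union_lt_top hmA hmB)
  rw [hU] at hs
  filter_upwards [hs, hΛ.ae_eq_zero hα MeasurableSet.empty (by simp)] with ω h1 h2
  refine tendsto_nhds_unique h1 (tendsto_const_nhds.congr' ?_)
  filter_upwards [eventually_ge_atTop 2] with n hn
  obtain ⟨k, rfl⟩ := Nat.exists_eq_add_of_le hn
  rw [Finset.sum_range_add, Finset.sum_range_succ, Finset.sum_range_one]
  have h3 : ∀ i, D (2 + i) = ∅ := fun i => by
    simp only [D]; rw [if_neg (by omega), if_neg (by omega)]
  simp only [h3, h2, Finset.sum_const_zero, add_zero]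
  simp [D]

lemma IsStableRandomMeasure.biUnion_finset [IsProbabilityMeasure P]
    (hΛ : IsStableRandomMeasure Λ α m P) (hα : 0 < α) {ι : Type*} (s : Finset ι) {A : ι → Set E}
    (hA : ∀ i ∈ s, MeasurableSet (A i)) (hmA : ∀ i ∈ s, m (A i) < ∞)
    (hd : ∀ i j, i ≠ j → Disjoint (A i) (A j)) :
    ∀ᵐ ω ∂P, Λ (⋃ i ∈ s, A i) ω = ∑ i ∈ s, Λ (A i) ω := by
  classical
  induction s using Finset.induction_on with
  | empty => simpa using hΛ.ae_eq_zero hα MeasurableSet.empty (by simp)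
  | insert a s ha ih =>
    have hA' : ∀ i ∈ s, MeasurableSet (A i) := fun i hi => hA i (Finset.mem_insert_of_mem hi)
    have hm' : ∀ i ∈ s, m (A i) < ∞ := fun i hi => hmA i (Finset.mem_insert_of_mem hi)
    have hu := hΛ.union hα (hA a (Finset.mem_insert_self _ _)) (Finset.measurableSet_biUnion s hA')
      (hmA a (Finset.mem_insert_self _ _)) (measure_biUnion_lt_top s.finite_toSet hm') (by
        rw [Set.disjoint_iUnion₂_right]
        intro i hi
        exact hd _ _ (by rintro rfl; exact ha hi))
    filter_upwards [ih hA' hm', hu] with ω h1 h2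
    rw [Finset.set_biUnion_insert, h2, h1, Finset.sum_insert ha]

/-- The integral is defined through the fibres of the function itself; by finite additivity a finer
partition gives the same value. This allows two simple functions to be compared on a common
refinement. Fibres with coefficient zero may have infinite measure, where nothing is known about
`Λ`. -/
lemma IsStableRandomMeasure.simpleStableIntegral_map [IsProbabilityMeasure P]
    (hΛ : IsStableRandomMeasure Λ α m P) (hα : 0 < α) {β : Type*} (χ : SimpleFunc E β)
    (g : β → ℝ) (hfin : ∀ b ∈ χ.range, g b ≠ 0 → m (χ ⁻¹' {b}) < ∞) :
    ∀ᵐ ω ∂P, simpleStableIntegral Λ (χ.map g) ω = ∑ b ∈ χ.range, g b * Λ (χ ⁻¹' {b}) ω := by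
  classical
  have h : ∀ c ∈ (χ.map g).range, ∀ᵐ ω ∂P, c * Λ (χ.map g ⁻¹' {c}) ω =
      ∑ b ∈ χ.range with g b = c, g b * Λ (χ ⁻¹' {b}) ω := by
    intro c _
    have e : χ.map g ⁻¹' {c} = ⋃ b ∈ χ.range.filter (fun b => g b = c), χ ⁻¹' {b} := by
      rw [SimpleFunc.map_preimage_singleton]
      ext x; simp
    rcases eq_or_ne c 0 with rfl | hc
    · refine .of_forall fun ω => ?_
      rw [zero_mul, Finset.sum_eq_zero]
      intro b hb
      rw [(Finset.mem_filter.1 hb).2, zero_mul]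
    · have := hΛ.biUnion_finset hα (χ.range.filter fun b => g b = c) (A := fun b => χ ⁻¹' {b})
        (fun b _ => χ.measurableSet_fiber b)
        (fun b hb => hfin b (Finset.mem_filter.1 hb).1 (by rw [(Finset.mem_filter.1 hb).2]; exact hc))
        (fun b b' hb => Disjoint.preimage _ (by simpa using hb))
      filter_upwards [this] with ω hω
      rw [e, hω, Finset.mul_sum]
      refine Finset.sum_congr rfl fun b hb => ?_
      rw [(Finset.mem_filter.1 hb).2]
  filter_upwards [(Finset.eventually_all _).2 h] with ω hω
  rw [simpleStableIntegral, Finset.sum_congr rfl hω]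
  refine Finset.sum_fiberwise_of_maps_to (fun b hb => ?_) _
  rw [SimpleFunc.range_map]
  exact Finset.mem_image_of_mem g hb

lemma ennreal_ofReal_ne_zero {α : ℝ} (hα : 0 < α) : ENNReal.ofReal α ≠ 0 := by simpa using hα

lemma measure_fiber_lt_top (hα : 0 < α) {φ : SimpleFunc E ℝ}
    (hφ : MemLp φ (ENNReal.ofReal α) m) {c : ℝ} (hc : c ≠ 0) : m (φ ⁻¹' {c}) < ∞ :=
  SimpleFunc.measure_preimage_lt_top_of_memLp (ennreal_ofReal_ne_zero hα) ENNReal.ofReal_ne_top φ hφ c hc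

/-- Linearity of the integral of simple functions. -/
lemma IsStableRandomMeasure.simpleStableIntegral_add_const_mul [IsProbabilityMeasure P]
    (hΛ : IsStableRandomMeasure Λ α m P) (hα : 0 < α) {φ ψ : SimpleFunc E ℝ}
    (hφ : MemLp φ (ENNReal.ofReal α) m) (hψ : MemLp ψ (ENNReal.ofReal α) m) (c : ℝ) :
    ∀ᵐ ω ∂P, simpleStableIntegral Λ (φ + c • ψ) ω =
      simpleStableIntegral Λ φ ω + c * simpleStableIntegral Λ ψ ω := by
  -- The common refinement of the two partitions. A nonzero pair has a nonzero coordinate, hence its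
  -- fibre lies in one of finite measure.
  set χ := φ.pair ψ
  have hfin : ∀ b : ℝ × ℝ, b ≠ 0 → m (χ ⁻¹' {b}) < ∞ := by
    intro b hb
    have hsub1 : χ ⁻¹' {b} ⊆ φ ⁻¹' {b.1} := fun x hx => by
      have : (φ x, ψ x) = b := hx
      simp [← this]
    have hsub2 : χ ⁻¹' {b} ⊆ ψ ⁻¹' {b.2} := fun x hx => by
      have : (φ x, ψ x) = b := hx
      simp [← this]
    by_cases h1 : b.1 = 0
    · exact (measure_mono hsub2).trans_lt (measure_fiber_lt_top hα hψ
        fun h2 => hb (Prod.ext h1 h2))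
    · exact (measure_mono hsub1).trans_lt (measure_fiber_lt_top hα hφ h1)
  have e1 : χ.map Prod.fst = φ := by ext x; rfl
  have e2 : χ.map Prod.snd = ψ := by ext x; rfl
  have e3 : χ.map (fun b => b.1 + c * b.2) = φ + c • ψ := by ext x; rfl
  have h1 := hΛ.simpleStableIntegral_map hα χ Prod.fst (fun b _ hb => hfin b (by
    rintro rfl; simp at hb))
  have h2 := hΛ.simpleStableIntegral_map hα χ Prod.snd (fun b _ hb => hfin b (by
    rintro rfl; simp at hb))
  have h3 := hΛ.simpleStableIntegral_map hα χ (fun b => b.1 + c * b.2) (fun b _ hb => hfin b (by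
    rintro rfl; simp at hb))
  rw [e1] at h1
  rw [e2] at h2
  rw [e3] at h3
  filter_upwards [h1, h2, h3] with ω h1 h2 h3
  rw [h1, h2, h3, Finset.mul_sum, ← Finset.sum_add_distrib]
  exact Finset.sum_congr rfl fun b _ => by ring

lemma IsStableRandomMeasure.measurable_simpleStableIntegral
    (hΛ : IsStableRandomMeasure Λ α m P) (hα : 0 < α) {φ : SimpleFunc E ℝ}
    (hφ : MemLp φ (ENNReal.ofReal α) m) : Measurable (simpleStableIntegral Λ φ) := by
  unfold simpleStableIntegral
  refine Finset.measurable_fun_sum _ fun c _ => ?_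
  rcases eq_or_ne c 0 with rfl | hc
  · simp
  · exact (hΛ.measurable _ (φ.measurableSet_fiber c) (measure_fiber_lt_top hα hφ hc)).const_mul c

lemma IsStableRandomMeasure.integral_exp_simpleStableIntegral
    (hΛ : IsStableRandomMeasure Λ α m P) (hα : 0 < α) {φ : SimpleFunc E ℝ}
    (hφ : MemLp φ (ENNReal.ofReal α) m) :
    ∫ ω, Complex.exp (Complex.I * simpleStableIntegral Λ φ ω) ∂P =
      Complex.exp (∫ x, stableExponent α (φ x) ∂m) := by
  classical
  set s : Finset ℝ := φ.range.filter (· ≠ 0) with hs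
  have hfin : ∀ c ∈ s, m (φ ⁻¹' {c}) < ∞ := fun c hc =>
    measure_fiber_lt_top hα hφ (Finset.mem_filter.1 hc).2
  have hind : iIndepFun (s.restrict fun c => Λ (φ ⁻¹' {c})) P := by
    refine iIndepFun_finset_of_fin fun k e he hes => ?_
    refine hΛ.indep k (fun i => φ ⁻¹' {e i}) (fun i => φ.measurableSet_fiber _)
      (fun i => hfin _ (hes i)) fun i j hij => ?_
    exact Disjoint.preimage _ (by simpa using he.ne hij)
  have h1 : ∫ ω, Complex.exp (Complex.I * simpleStableIntegral Λ φ ω) ∂P =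
      ∫ ω, ∏ c : s, Complex.exp (Complex.I * ((c : ℝ) * Λ (φ ⁻¹' {(c : ℝ)}) ω : ℝ)) ∂P := by
    congr 1
    ext ω
    rw [simpleStableIntegral, ← Finset.sum_filter_of_ne (p := (· ≠ 0)), ← hs,
      ← Finset.sum_coe_sort, ← Complex.exp_sum, Complex.ofReal_sum, Finset.mul_sum]
    intro c _ hc h0
    simp [h0] at hc
  have h0 : stableExponent α 0 = 0 := stableExponent_zero hα.ne'
  have h2 : ∫ x, stableExponent α (φ x) ∂m =
      ∑ c ∈ s, m.real (φ ⁻¹' {c}) * stableExponent α c := by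
    have hi : Integrable (φ.map (stableExponent α)) m := integrable_stableExponent hα hφ
    have hm := SimpleFunc.map_integral φ (stableExponent α)
      ((SimpleFunc.memLp_iff_integrable (ennreal_ofReal_ne_zero hα) ENNReal.ofReal_ne_top).1 hφ) h0
    rw [SimpleFunc.integral_eq_integral _ hi] at hm
    simp only [SimpleFunc.coe_map, Function.comp_def] at hm
    rw [hm, hs, Finset.sum_filter_of_ne]
    · simp
    · intro c _ hc h
      simp [h, h0] at hc
  have h3 := hind.integral_fun_prod_comp
    (f := fun (c : s) (y : ℝ) => Complex.exp (Complex.I * ((c : ℝ) * y : ℝ)))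
    (fun c => (hΛ.measurable _ (φ.measurableSet_fiber _) (hfin c c.2)).aemeasurable)
    (fun c => (by fun_prop : Measurable
      fun y : ℝ => Complex.exp (Complex.I * ((c : ℝ) * y : ℝ))).aestronglyMeasurable)
  rw [h1, h2, Complex.exp_sum, ← Finset.prod_coe_sort]
  refine h3.trans (Finset.prod_congr rfl fun c _ => ?_)
  exact hΛ.integral_exp hα (φ.measurableSet_fiber _) (hfin c c.2) c

end Stable

/-! ### The stable integral: existence, linearity, characteristic function -/

section StableIntegral

variable {Ω E : Type*} [MeasurableSpace Ω] [MeasurableSpace E] {P : Measure Ω}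
  [IsProbabilityMeasure P] {Λ : Set E → Ω → ℝ} {α : ℝ} {m : Measure E}

lemma integral_abs_rpow_eq {f : E → ℝ} (hα : 0 < α) (hf : MemLp f (ENNReal.ofReal α) m) :
    ∫ x, |f x| ^ α ∂m = lpNorm f (ENNReal.ofReal α) m ^ α := by
  have h := lpNorm_eq_integral_norm_rpow_toReal (ennreal_ofReal_ne_zero hα) ENNReal.ofReal_ne_top hf.1
  rw [ENNReal.toReal_ofReal hα.le] at h
  simp only [Real.norm_eq_abs] at h
  rw [h, ← Real.rpow_mul (integral_nonneg fun _ => by positivity), inv_mul_cancel₀ hα.ne',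
    Real.rpow_one]

lemma IsStableRandomMeasure.simpleStableIntegral_const_smul
    (hΛ : IsStableRandomMeasure Λ α m P) (hα : 0 < α) {φ : SimpleFunc E ℝ}
    (hφ : MemLp φ (ENNReal.ofReal α) m) (c : ℝ) :
    ∀ᵐ ω ∂P, simpleStableIntegral Λ (c • φ) ω = c * simpleStableIntegral Λ φ ω := by
  have e : c • φ = φ.map (fun b => c * b) := by ext x; rfl
  have h := hΛ.simpleStableIntegral_map hα φ (fun b => c * b)
    (fun b _ hb => measure_fiber_lt_top hα hφ (right_ne_zero_of_mul hb))
  rw [e]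
  filter_upwards [h] with ω hω
  rw [hω, simpleStableIntegral, Finset.mul_sum]
  exact Finset.sum_congr rfl fun b _ => by ring

/-- The exponent at `θ` is at most a constant times `|θ| ^ α * ‖φ‖_α ^ α`, so the tail estimate
applies. This continuity at zero plays the role that an isometry has for square-integrable noise. -/
lemma IsStableRandomMeasure.measureReal_lt_abs_simpleStableIntegral_le
    (hΛ : IsStableRandomMeasure Λ α m P) (hα : 0 < α) {φ : SimpleFunc E ℝ}
    (hφ : MemLp φ (ENNReal.ofReal α) m) {r : ℝ} (hr : 0 < r) :
    P.real {ω | r < |simpleStableIntegral Λ φ ω|} ≤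
      2 * (2 / r) ^ α * ((1 + |Real.tan (Real.pi * α / 2)|) *
        lpNorm φ (ENNReal.ofReal α) m ^ α) := by
  refine measureReal_lt_abs_le_of_integral_exp
    (hΛ.measurable_simpleStableIntegral hα hφ).aemeasurable hα ?_ hr
    (fun θ => ∫ x, stableExponent α (θ * φ x) ∂m) (fun θ => ?_) (fun θ => ?_) (fun θ => ?_)
  · have : 0 ≤ lpNorm φ (ENNReal.ofReal α) m := lpNorm_nonneg
    positivity
  · have hi := integrable_stableExponent hα (hφ.const_mul θ)
    have h := integral_re hi
    simp only [RCLike.re_to_complex] at h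
    rw [← h]
    exact integral_nonpos fun x => re_stableExponent_nonpos _ _
  · rw [← integral_abs_rpow_eq hα hφ]
    refine (norm_integral_le_of_norm_le
      ((integrable_abs_rpow hα (hφ.const_mul θ)).const_mul (1 + |Real.tan (Real.pi * α / 2)|))
      (.of_forall fun x => norm_stableExponent_le _ _)).trans_eq ?_
    simp only [abs_mul, Real.mul_rpow (abs_nonneg _) (abs_nonneg _), integral_const_mul]
    ring
  · have hs : MemLp (θ • φ : SimpleFunc E ℝ) (ENNReal.ofReal α) m := hφ.const_mul θ
    refine Eq.trans ?_ (hΛ.integral_exp_simpleStableIntegral hα hs)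
    refine integral_congr_ae ?_
    filter_upwards [hΛ.simpleStableIntegral_const_smul hα hφ θ] with ω hω
    rw [hω]

lemma IsStableRandomMeasure.exists_forall_measure_le
    (hΛ : IsStableRandomMeasure Λ α m P) (hα : 0 < α) {r η : ℝ} (hr : 0 < r) (hη : 0 < η) :
    ∃ δ : ℝ≥0∞, 0 < δ ∧ ∀ φ : SimpleFunc E ℝ, MemLp φ (ENNReal.ofReal α) m →
      eLpNorm φ (ENNReal.ofReal α) m < δ →
      P {ω | r < |simpleStableIntegral Λ φ ω|} ≤ ENNReal.ofReal η := by
  set K := 2 * (2 / r) ^ α * (1 + |Real.tan (Real.pi * α / 2)|)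
  have hK : 0 < K := by positivity
  -- Chosen so that `K * ‖φ‖_α ^ α ≤ η`.
  refine ⟨ENNReal.ofReal ((η / K) ^ (1 / α)), by simp; positivity, fun φ hφ hδ => ?_⟩
  have h1 : lpNorm φ (ENNReal.ofReal α) m < (η / K) ^ (1 / α) := by
    rw [← toReal_eLpNorm hφ.1]
    exact (ENNReal.lt_ofReal_iff_toReal_lt hφ.2.ne).1 hδ
  have h2 : lpNorm φ (ENNReal.ofReal α) m ^ α ≤ η / K := by
    calc _ ≤ ((η / K) ^ (1 / α)) ^ α := by
          gcongr
          exact lpNorm_nonneg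
      _ = η / K := by
        rw [← Real.rpow_mul (by positivity), one_div_mul_cancel hα.ne', Real.rpow_one]
  have h3 := hΛ.measureReal_lt_abs_simpleStableIntegral_le hα hφ hr
  rw [← ofReal_measureReal]
  refine ENNReal.ofReal_le_ofReal (h3.trans ?_)
  calc _ = K * lpNorm φ (ENNReal.ofReal α) m ^ α := by simp only [K]; ring
    _ ≤ K * (η / K) := by gcongr
    _ = η := by field_simp

lemma IsStableRandomMeasure.tendstoInMeasure_zero
    (hΛ : IsStableRandomMeasure Λ α m P) (hα : 0 < α) {φ : ℕ → SimpleFunc E ℝ}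
    (hφ : ∀ n, MemLp (φ n) (ENNReal.ofReal α) m)
    (h : Tendsto (fun n => eLpNorm (φ n) (ENNReal.ofReal α) m) atTop (𝓝 0)) :
    TendstoInMeasure P (fun n => simpleStableIntegral Λ (φ n)) atTop (fun _ => 0) := by
  rw [tendstoInMeasure_iff_norm]
  intro ε hε
  rw [ENNReal.tendsto_nhds_zero]
  intro η hη
  obtain ⟨η', hη'0, hη'⟩ : ∃ η' : ℝ, 0 < η' ∧ ENNReal.ofReal η' ≤ η := by
    refine ⟨(min η 1).toReal, ENNReal.toReal_pos (by simp [hη.ne']) (by simp), ?_⟩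
    rw [ENNReal.ofReal_toReal (by simp)]
    exact min_le_left _ _
  obtain ⟨δ, hδ, H⟩ := hΛ.exists_forall_measure_le hα (half_pos hε) hη'0
  filter_upwards [h.eventually (gt_mem_nhds hδ)] with n hn
  refine ((measure_mono ?_).trans (H (φ n) (hφ n) hn)).trans hη'
  intro ω hω
  simp only [Set.mem_ofPred_eq, sub_zero, Real.norm_eq_abs] at hω ⊢
  linarith

lemma memLp_sub_simpleFunc {φ ψ : SimpleFunc E ℝ} (hφ : MemLp φ (ENNReal.ofReal α) m)
    (hψ : MemLp ψ (ENNReal.ofReal α) m) :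
    MemLp (φ + (-1 : ℝ) • ψ : SimpleFunc E ℝ) (ENNReal.ofReal α) m :=
  hφ.add (hψ.const_mul (-1))

lemma eLpNorm_sub_simpleFunc_le (hα : 1 ≤ α) {f : E → ℝ} (hf : MemLp f (ENNReal.ofReal α) m)
    {φ ψ : SimpleFunc E ℝ} (hφ : MemLp φ (ENNReal.ofReal α) m)
    (hψ : MemLp ψ (ENNReal.ofReal α) m) :
    eLpNorm (φ + (-1 : ℝ) • ψ : SimpleFunc E ℝ) (ENNReal.ofReal α) m ≤
      eLpNorm (fun x => φ x - f x) (ENNReal.ofReal α) m +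
        eLpNorm (fun x => ψ x - f x) (ENNReal.ofReal α) m := by
  have h := eLpNorm_sub_le (μ := m) (p := ENNReal.ofReal α) (f := fun x => φ x - f x)
    (g := fun x => ψ x - f x) (hφ.1.sub hf.1) (hψ.1.sub hf.1) (by simpa using hα)
  refine le_trans (le_of_eq ?_) h
  congr 1
  ext x
  simp only [SimpleFunc.coe_add, SimpleFunc.coe_smul, Pi.add_apply, Pi.smul_apply, smul_eq_mul,
    Pi.sub_apply]
  ring

/-- The limit in probability along one approximating sequence is the integral. -/
lemma IsStableRandomMeasure.isStableIntegral_of_tendsto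
    (hΛ : IsStableRandomMeasure Λ α m P) (hα : 1 ≤ α) {f : E → ℝ}
    (hf : MemLp f (ENNReal.ofReal α) m) {φ : ℕ → SimpleFunc E ℝ}
    (hφ : ∀ n, MemLp (φ n) (ENNReal.ofReal α) m)
    (hφf : Tendsto (fun n => eLpNorm (fun x => φ n x - f x) (ENNReal.ofReal α) m) atTop (𝓝 0))
    {Y : Ω → ℝ} (hY : AEMeasurable Y P)
    (hφY : TendstoInMeasure P (fun n => simpleStableIntegral Λ (φ n)) atTop Y) :
    IsStableIntegral Λ α m P f Y := by
  have hα0 : 0 < α := by linarith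
  refine ⟨hf, hY, fun ψ hψ hψf => ?_⟩
  -- Two approximating sequences differ by simple functions tending to zero in `L^α`, so the
  -- difference of their integrals tends to zero in probability.
  have h0 : Tendsto (fun n => eLpNorm (ψ n + (-1 : ℝ) • φ n : SimpleFunc E ℝ)
      (ENNReal.ofReal α) m) atTop (𝓝 0) := by
    have hs := hψf.add hφf
    rw [add_zero] at hs
    exact tendsto_of_tendsto_of_tendsto_of_le_of_le tendsto_const_nhds hs (fun _ => zero_le)
      fun n => eLpNorm_sub_simpleFunc_le hα hf (hψ n) (hφ n)
  have h1 := hΛ.tendstoInMeasure_zero hα0 (fun n => memLp_sub_simpleFunc (hψ n) (hφ n)) h0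
  refine (tendstoInMeasure_add h1 hφY).congr (fun n => ?_) (.of_forall fun ω => by simp)
  filter_upwards [hΛ.simpleStableIntegral_add_const_mul hα0 (hψ n) (hφ n) (-1)] with ω hω
  rw [hω]; ring

lemma exists_seq_simpleFunc_tendsto {f : E → ℝ} (hf : MemLp f (ENNReal.ofReal α) m) :
    ∃ φ : ℕ → SimpleFunc E ℝ, (∀ n, MemLp (φ n) (ENNReal.ofReal α) m) ∧
      Tendsto (fun n => eLpNorm (fun x => φ n x - f x) (ENNReal.ofReal α) m) atTop (𝓝 0) := by
  have h : ∀ n : ℕ, ∃ g : SimpleFunc E ℝ,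
      eLpNorm (f - ⇑g) (ENNReal.ofReal α) m < ((n : ℝ≥0∞) + 1)⁻¹ ∧
        MemLp g (ENNReal.ofReal α) m := fun n =>
    hf.exists_simpleFunc_eLpNorm_sub_lt ENNReal.ofReal_ne_top (by simp)
  choose φ hφ1 hφ2 using h
  refine ⟨φ, hφ2, ?_⟩
  have ht : Tendsto (fun n : ℕ => ((n : ℝ≥0∞) + 1)⁻¹) atTop (𝓝 0) := by
    have := (tendsto_add_atTop_iff_nat 1).2 ENNReal.tendsto_inv_nat_nhds_zero
    simpa using this
  refine tendsto_of_tendsto_of_tendsto_of_le_of_le tendsto_const_nhds ht (fun _ => zero_le)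
    fun n => ?_
  exact (eLpNorm_sub_comm (φ n) f _ m).trans_le (hφ1 n).le

/-- An approximating sequence is thinned out until consecutive terms are so close in `L^α` that the
increments of the integrals exceed `(1 / 2) ^ n` with probability at most `(1 / 2) ^ n`. The thinned
integrals then converge, and their limit serves for every approximating sequence. -/
theorem IsStableRandomMeasure.exists_isStableIntegral
    (hΛ : IsStableRandomMeasure Λ α m P) (hα : 1 ≤ α) {f : E → ℝ}
    (hf : MemLp f (ENNReal.ofReal α) m) : ∃ Y, IsStableIntegral Λ α m P f Y := by
  have hα0 : 0 < α := by linarith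
  obtain ⟨φ, hφ, hφf⟩ := exists_seq_simpleFunc_tendsto hf
  have hpos : ∀ n : ℕ, (0 : ℝ) < (1 / 2) ^ n := fun n => by positivity
  choose δ hδ H using fun n : ℕ => hΛ.exists_forall_measure_le hα0 (hpos n) (hpos n)
  have hev : ∀ n, ∀ᶠ k in atTop, ∀ j ≥ k,
      eLpNorm (fun x => φ j x - f x) (ENNReal.ofReal α) m < δ n / 2 := fun n => by
    obtain ⟨k, hk⟩ := eventually_atTop.1
      (hφf.eventually (gt_mem_nhds (ENNReal.half_pos (hδ n).ne')))
    filter_upwards [eventually_ge_atTop k] with i hi j hj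
    exact hk j (hi.trans hj)
  obtain ⟨u, hu, hδu⟩ := extraction_forall_of_eventually hev
  have hmeas := fun n => (hΛ.measurable_simpleStableIntegral hα0 (hφ (u n))).aemeasurable (μ := P)
  obtain ⟨Y, hYm, hY⟩ := exists_tendstoInMeasure_of_summable
    (X := fun n => simpleStableIntegral Λ (φ (u n))) hmeas fun n => by
      have hlt : eLpNorm (φ (u (n + 1)) + (-1 : ℝ) • φ (u n) : SimpleFunc E ℝ)
          (ENNReal.ofReal α) m < δ n := by
        refine (eLpNorm_sub_simpleFunc_le hα hf (hφ _) (hφ _)).trans_lt ?_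
        rw [← ENNReal.add_halves (δ n)]
        exact ENNReal.add_lt_add (hδu n _ (hu.monotone (Nat.le_succ n))) (hδu n _ le_rfl)
      refine le_trans (le_of_eq (measure_congr ?_))
        (H n _ (memLp_sub_simpleFunc (hφ _) (hφ _)) hlt)
      filter_upwards [hΛ.simpleStableIntegral_add_const_mul hα0 (hφ (u (n + 1))) (hφ (u n)) (-1)]
        with ω hω
      refine propext ?_
      change (_ < |_|) ↔ (_ < |_|)
      rw [hω, neg_one_mul, sub_eq_add_neg]
  exact ⟨Y, hΛ.isStableIntegral_of_tendsto hα hf (fun n => hφ (u n))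
    (hφf.comp hu.tendsto_atTop) hYm.aemeasurable hY⟩

theorem IsStableRandomMeasure.isStableIntegral_stableIntegral
    (hΛ : IsStableRandomMeasure Λ α m P) (hα : 1 ≤ α) {f : E → ℝ}
    (hf : MemLp f (ENNReal.ofReal α) m) :
    IsStableIntegral Λ α m P f (stableIntegral Λ α m P f) := by
  have h := hΛ.exists_isStableIntegral hα hf
  rw [stableIntegral, dif_pos h]
  exact h.choose_spec

/-- Linearity of the stable integral. -/
lemma IsStableIntegral.add_const_mul (hΛ : IsStableRandomMeasure Λ α m P) (hα : 1 ≤ α)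
    {f g : E → ℝ} {Y Z : Ω → ℝ} (hY : IsStableIntegral Λ α m P f Y)
    (hZ : IsStableIntegral Λ α m P g Z) (c : ℝ) :
    IsStableIntegral Λ α m P (fun x => f x + c * g x) (fun ω => Y ω + c * Z ω) := by
  have hα0 : 0 < α := by linarith
  obtain ⟨φ, hφ, hφf⟩ := exists_seq_simpleFunc_tendsto hY.memLp
  obtain ⟨ψ, hψ, hψg⟩ := exists_seq_simpleFunc_tendsto hZ.memLp
  have hmem : ∀ n, MemLp (φ n + c • ψ n : SimpleFunc E ℝ) (ENNReal.ofReal α) m := fun n =>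
    (hφ n).add ((hψ n).const_mul c)
  refine hΛ.isStableIntegral_of_tendsto hα (hY.memLp.add (hZ.memLp.const_mul c)) hmem ?_
    (hY.aemeasurable.add (hZ.aemeasurable.const_mul c)) ?_
  · have hs := hφf.add (ENNReal.Tendsto.const_mul (a := ‖c‖ₑ) hψg (.inr (by simp)))
    rw [mul_zero, add_zero] at hs
    refine tendsto_of_tendsto_of_tendsto_of_le_of_le tendsto_const_nhds hs (fun _ => zero_le)
      fun n => ?_
    have h1 := eLpNorm_add_le (μ := m) (p := ENNReal.ofReal α) (f := fun x => φ n x - f x)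
      (g := c • fun x => ψ n x - g x) ((hφ n).1.sub hY.memLp.1)
      (((hψ n).1.sub hZ.memLp.1).const_smul c) (by simpa using hα)
    rw [eLpNorm_const_smul] at h1
    refine le_trans (le_of_eq ?_) h1
    congr 1
    ext x
    simp only [SimpleFunc.coe_add, SimpleFunc.coe_smul, Pi.add_apply, Pi.smul_apply, smul_eq_mul]
    ring
  · refine (tendstoInMeasure_add (hY.tendsto φ hφ hφf)
      (tendstoInMeasure_const_mul c (hZ.tendsto ψ hψ hψg))).congr (fun n => ?_) (.of_forall fun _ => rfl)
    filter_upwards [hΛ.simpleStableIntegral_add_const_mul hα0 (hφ n) (hψ n) c] with ω hω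
    rw [hω]

lemma IsStableRandomMeasure.isStableIntegral_zero (hΛ : IsStableRandomMeasure Λ α m P)
    (hα : 1 ≤ α) : IsStableIntegral Λ α m P (fun _ => 0) (fun _ => 0) := by
  have h0 : MemLp (fun _ : E => (0 : ℝ)) (ENNReal.ofReal α) m := MemLp.zero
  refine hΛ.isStableIntegral_of_tendsto hα h0 (φ := fun _ => 0) (fun _ => MemLp.zero) ?_
    aemeasurable_const ?_
  · simp
  · refine hΛ.tendstoInMeasure_zero (by linarith) (fun _ => MemLp.zero) ?_
    simp

lemma IsStableIntegral.sum (hΛ : IsStableRandomMeasure Λ α m P) (hα : 1 ≤ α) {ι : Type*}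
    (s : Finset ι) (t : ι → ℝ) {f : ι → E → ℝ} {Y : ι → Ω → ℝ}
    (h : ∀ i, IsStableIntegral Λ α m P (f i) (Y i)) :
    IsStableIntegral Λ α m P (fun x => ∑ i ∈ s, t i * f i x) (fun ω => ∑ i ∈ s, t i * Y i ω) := by
  classical
  induction s using Finset.induction_on with
  | empty => simpa using hΛ.isStableIntegral_zero hα
  | insert a s ha ih =>
    simp only [Finset.sum_insert ha]
    convert ih.add_const_mul hΛ hα (h a) (t a) using 2 <;> exact add_comm _ _

/-- The characteristic function of the stable integral. -/
theorem IsStableIntegral.integral_exp (hΛ : IsStableRandomMeasure Λ α m P) (hα : 1 ≤ α)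
    {f : E → ℝ} (hf : Measurable f) {Y : Ω → ℝ} (hY : IsStableIntegral Λ α m P f Y) :
    ∫ ω, Complex.exp (Complex.I * Y ω) ∂P = Complex.exp (∫ x, stableExponent α (f x) ∂m) := by
  have hα0 : 0 < α := by linarith
  have h0 : (0 : ℝ) ∈ Set.range f ∪ {0} := by simp
  let φ : ℕ → SimpleFunc E ℝ := fun n => SimpleFunc.approxOn f hf (Set.range f ∪ {0}) 0 h0 n
  have hφ : ∀ n, MemLp (φ n) (ENNReal.ofReal α) m :=
    SimpleFunc.memLp_approxOn_range hf hY.memLp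
  have hφf : Tendsto (fun n => eLpNorm (fun x => φ n x - f x) (ENNReal.ofReal α) m) atTop (𝓝 0) :=
    SimpleFunc.tendsto_approxOn_range_Lp_eLpNorm ENNReal.ofReal_ne_top hf hY.memLp.2
  have h1 := tendsto_integral_exp_of_tendstoInMeasure
    (fun n => (hΛ.measurable_simpleStableIntegral hα0 (hφ n)).aemeasurable)
    (hY.tendsto φ hφ hφf)
  have h2 : Tendsto (fun n => ∫ x, stableExponent α (φ n x) ∂m) atTop
      (𝓝 (∫ x, stableExponent α (f x) ∂m)) := by
    refine tendsto_integral_of_dominated_convergence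
      -- The factor 2 comes from the bound `|φ n x| ≤ |f x| + |f x|` for the approximants.
      (fun x => (1 + |Real.tan (Real.pi * α / 2)|) * |2 * f x| ^ α)
      (fun n => (integrable_stableExponent hα0 (hφ n)).1)
      ((integrable_abs_rpow hα0 (hY.memLp.const_mul 2)).const_mul _) (fun n => ?_) ?_
    · refine .of_forall fun x => (norm_stableExponent_le _ _).trans
        (mul_le_mul_of_nonneg_left (Real.rpow_le_rpow (abs_nonneg _) ?_ hα0.le) (by positivity))
      have := SimpleFunc.norm_approxOn_zero_le hf h0 x n
      rw [abs_mul, abs_two, two_mul]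
      exact this
    · refine .of_forall fun x => ((continuous_stableExponent hα0).tendsto _).comp ?_
      exact SimpleFunc.tendsto_approxOn hf h0 (subset_closure (by simp))
  have h3 := (Complex.continuous_exp.tendsto _).comp h2
  refine tendsto_nhds_unique h1 (h3.congr fun n => ?_)
  exact (hΛ.integral_exp_simpleStableIntegral hα0 (hφ n)).symm

end StableIntegral

/-! ### The law of the stable integral -/

/-- A negative `θ` swaps the positive and negative parts of `s`, which is absorbed by `sign θ`. With
`θ` factored out, integration leaves the three norms in the scale and skewness. -/
lemma stableExponent_mul_eq {α s θ : ℝ} (hα : 0 < α) :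
    stableExponent α (θ * s) = ((|θ| ^ α : ℝ) : ℂ) * (-((|s| ^ α : ℝ) : ℂ) + Complex.I *
      ((Real.sign θ * Real.tan (Real.pi * α / 2) : ℝ) : ℂ) *
        ((max s 0 ^ α : ℝ) - ((-min s 0) ^ α : ℝ) : ℂ)) := by
  rw [stableExponent_eq hα, abs_mul, Real.mul_rpow (abs_nonneg _) (abs_nonneg _)]
  have key : max (θ * s) 0 ^ α - (-min (θ * s) 0) ^ α =
      |θ| ^ α * Real.sign θ * (max s 0 ^ α - (-min s 0) ^ α) := by
    rcases lt_trichotomy θ 0 with h | rfl | h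
    · have e1 : max (θ * s) 0 = -θ * -min s 0 := by
        rcases le_total s 0 with hs | hs
        · rw [min_eq_left hs, max_eq_left (mul_nonneg_of_nonpos_of_nonpos h.le hs)]; ring
        · rw [min_eq_right hs, max_eq_right (mul_nonpos_of_nonpos_of_nonneg h.le hs)]; ring
      have e2 : -min (θ * s) 0 = -θ * max s 0 := by
        rcases le_total s 0 with hs | hs
        · rw [max_eq_right hs, min_eq_right (mul_nonneg_of_nonpos_of_nonpos h.le hs)]; ring
        · rw [max_eq_left hs, min_eq_left (mul_nonpos_of_nonpos_of_nonneg h.le hs)]; ring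
      rw [e1, e2, Real.mul_rpow (by linarith) (by simp), Real.mul_rpow (by linarith) (by simp),
        Real.sign_of_neg h, abs_of_neg h]
      ring
    · simp
    · have e1 : max (θ * s) 0 = θ * max s 0 := by
        rw [mul_max_of_nonneg _ _ h.le, mul_zero]
      have e2 : -min (θ * s) 0 = θ * -min s 0 := by
        have : min (θ * s) 0 = θ * min s 0 := by rw [mul_min_of_nonneg _ _ h.le, mul_zero]
        rw [this]; ring
      rw [e1, e2, Real.mul_rpow h.le (by simp), Real.mul_rpow h.le (by simp),
        Real.sign_of_pos h, abs_of_pos h]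
      ring
  rw [key]
  push_cast; ring

lemma stableExponent_mul_of_nonneg {α c : ℝ} (hα : 0 < α) (hc : 0 ≤ c) (s : ℝ) :
    stableExponent α (c * s) = ((c ^ α : ℝ) : ℂ) * stableExponent α s := by
  rcases hc.eq_or_lt with rfl | hc
  · simp [stableExponent_zero hα.ne', Real.zero_rpow hα.ne']
  have h1 := stableExponent_mul_eq (s := s) (θ := c) hα
  have h2 := stableExponent_mul_eq (s := s) (θ := 1) hα
  rw [one_mul] at h2
  rw [h1, h2, abs_of_pos hc, Real.sign_of_pos hc, Real.sign_one]
  simp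

theorem IsStableIntegral.hasStableLaw {Ω : Type*} [MeasurableSpace Ω] {P : Measure Ω}
    [IsProbabilityMeasure P] {Λ : Set Plane → Ω → ℝ} {α : ℝ}
    (hΛ : IsStableRandomMeasure Λ α volume P) (hα : 1 ≤ α) {f : Plane → ℝ} (hf : Measurable f)
    {Y : Ω → ℝ} (hY : IsStableIntegral Λ α volume P f Y) :
    HasStableLaw Y α (stableScale α f) (stableSkewness α f) P := by
  have hα0 : 0 < α := by linarith
  refine ⟨hY.aemeasurable, fun θ => ?_⟩
  -- The characteristic function at `θ` is that of the integral of `θ f` at 1.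
  have hθ : IsStableIntegral Λ α volume P (fun x => 0 + θ * f x) (fun ω => 0 + θ * Y ω) :=
    (hΛ.isStableIntegral_zero hα).add_const_mul hΛ hα hY θ
  simp only [zero_add] at hθ
  have h1 := hθ.integral_exp hΛ hα (by fun_prop)
  have h2 : charFun (P.map Y) θ = ∫ ω, Complex.exp (Complex.I * (θ * Y ω : ℝ)) ∂P := by
    rw [charFun_apply_real, integral_map hY.aemeasurable (by fun_prop)]
    congr 1; ext ω; push_cast; ring_nf
  have hL := hY.memLp
  have hle : ∀ g : Plane → ℝ, Measurable g → (∀ x, |g x| ≤ |f x|) →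
      MemLp g (ENNReal.ofReal α) volume := fun g hg h =>
    hL.mono hg.aestronglyMeasurable (.of_forall h)
  have hmax : ∀ x, |max (f x) 0| ≤ |f x| := fun x => by
    rcases le_total (f x) 0 with h | h <;> simp [h]
  have hmin : ∀ x, |-min (f x) 0| ≤ |f x| := fun x => by
    rcases le_total (f x) 0 with h | h <;> simp [h]
  have hp := hle (fun x => max (f x) 0) (by fun_prop) hmax
  have hm := hle (fun x => -min (f x) 0) (by fun_prop) hmin
  have ia := integrable_abs_rpow hα0 hL
  have ip : Integrable (fun x => max (f x) 0 ^ α) := by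
    have h := integrable_abs_rpow hα0 hp
    simpa only [fun x => abs_of_nonneg (le_max_right (f x) 0)] using h
  have im : Integrable (fun x => (-min (f x) 0) ^ α) := by
    have h := integrable_abs_rpow hα0 hm
    have e : ∀ x, |-min (f x) 0| = -min (f x) 0 := fun x => abs_of_nonneg (by simp)
    simpa only [e] using h
  have ep : ∫ x, max (f x) 0 ^ α = lpNorm (fun x => max (f x) 0) (ENNReal.ofReal α) volume ^ α := by
    rw [← integral_abs_rpow_eq hα0 hp]
    simp only [fun x => abs_of_nonneg (le_max_right (f x) 0)]
  have em : ∫ x, (-min (f x) 0) ^ α =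
      lpNorm (fun x => -min (f x) 0) (ENNReal.ofReal α) volume ^ α := by
    rw [← integral_abs_rpow_eq hα0 hm]
    congr 1; ext x
    rw [abs_of_nonneg (show 0 ≤ -min (f x) 0 by simp)]
  have hint : ∫ x, stableExponent α (θ * f x) = ((|θ| ^ α : ℝ) : ℂ) *
      (-((lpNorm f (ENNReal.ofReal α) volume ^ α : ℝ) : ℂ) + Complex.I *
      ((Real.sign θ * Real.tan (Real.pi * α / 2) : ℝ) : ℂ) *
        ((lpNorm (fun x => max (f x) 0) (ENNReal.ofReal α) volume ^ α -
          lpNorm (fun x => -min (f x) 0) (ENNReal.ofReal α) volume ^ α : ℝ) : ℂ)) := by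
    simp only [stableExponent_mul_eq hα0]
    have i1 : Integrable (fun x => -((|f x| ^ α : ℝ) : ℂ)) := ia.ofReal.neg
    have i2 : Integrable (fun x => ((max (f x) 0 ^ α : ℝ) - ((-min (f x) 0) ^ α : ℝ) : ℂ)) :=
      ip.ofReal.sub im.ofReal
    rw [integral_const_mul, integral_add i1 (i2.const_mul _), integral_const_mul, integral_neg,
      integral_sub ip.ofReal im.ofReal, integral_complex_ofReal, integral_complex_ofReal,
      integral_complex_ofReal, integral_abs_rpow_eq hα0 hL, ep, em]
    push_cast; ring
  rw [h2, h1, hint, stableScale, stableSkewness]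
  congr 1
  set A := lpNorm f (ENNReal.ofReal α) volume with hA
  set D := lpNorm (fun x => max (f x) 0) (ENNReal.ofReal α) volume ^ α -
    lpNorm (fun x => -min (f x) 0) (ENNReal.ofReal α) volume ^ α with hD
  -- When the norm is zero, `f` vanishes almost everywhere and `D = 0`, so the identity survives
  -- this degenerate case.
  have hAD : A ^ α * (A ^ (-α) * D) = D := by
    rcases (lpNorm_nonneg : 0 ≤ lpNorm f (ENNReal.ofReal α) volume).eq_or_lt with h0 | h0
    · have hf0 := (lpNorm_eq_zero hL (ennreal_ofReal_ne_zero hα0)).1 h0.symm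
      have hp0 : lpNorm (fun x => max (f x) 0) (ENNReal.ofReal α) volume = 0 :=
        (lpNorm_eq_zero hp (ennreal_ofReal_ne_zero hα0)).2 (by
          filter_upwards [hf0] with x hx; simp [hx])
      have hm0 : lpNorm (fun x => -min (f x) 0) (ENNReal.ofReal α) volume = 0 :=
        (lpNorm_eq_zero hm (ennreal_ofReal_ne_zero hα0)).2 (by
          filter_upwards [hf0] with x hx; simp [hx])
      have : D = 0 := by rw [hD, hp0, hm0, sub_self]
      rw [this]; ring
    · rw [← mul_assoc, ← Real.rpow_add h0, add_neg_cancel, Real.rpow_zero, one_mul]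
  conv_lhs => rw [← hAD]
  push_cast; ring

/-! ### Exponentially decaying functions -/

/-- A continuous function on the plane of at least exponential decay. -/
structure IsDecaying (f : Plane → ℝ) : Prop where
  continuous : Continuous f
  decay : ∃ C > 0, ∃ c > 0, ∀ x : Plane, |f x| ≤ C * Real.exp (-c * (|x.1| + |x.2|))

lemma isDecaying_density (μ : pointsSpace) : IsDecaying (density μ) :=
  ⟨μ.2.choose_spec.continuous, μ.2.choose_spec.decay⟩

lemma IsDecaying.add_const_mul {f g : Plane → ℝ} (hf : IsDecaying f) (hg : IsDecaying g) (t : ℝ) :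
    IsDecaying (fun x => f x + t * g x) := by
  obtain ⟨C, hC, c, hc, hfC⟩ := hf.decay
  obtain ⟨D, hD, d, hd, hgD⟩ := hg.decay
  refine ⟨hf.continuous.add (continuous_const.mul hg.continuous), C + |t| * D, by positivity,
    min c d, lt_min hc hd, fun x => ?_⟩
  have hx : 0 ≤ |x.1| + |x.2| := by positivity
  have h1 : Real.exp (-c * (|x.1| + |x.2|)) ≤ Real.exp (-min c d * (|x.1| + |x.2|)) := by
    gcongr; exact min_le_left _ _
  have h2 : Real.exp (-d * (|x.1| + |x.2|)) ≤ Real.exp (-min c d * (|x.1| + |x.2|)) := by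
    gcongr; exact min_le_right _ _
  calc |f x + t * g x| ≤ |f x| + |t| * |g x| := by rw [← abs_mul]; exact abs_add_le _ _
    _ ≤ C * Real.exp (-min c d * (|x.1| + |x.2|)) +
        |t| * (D * Real.exp (-min c d * (|x.1| + |x.2|))) := by
      gcongr
      · exact (hfC x).trans (by gcongr)
      · exact (hgD x).trans (by gcongr)
    _ = _ := by ring

lemma isDecaying_zero : IsDecaying (fun _ => 0) :=
  ⟨continuous_const, 1, one_pos, 1, one_pos, fun x => by simp; positivity⟩

lemma isDecaying_sum {ι : Type*} (s : Finset ι) (t : ι → ℝ) {f : ι → Plane → ℝ}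
    (h : ∀ i, IsDecaying (f i)) : IsDecaying (fun x => ∑ i ∈ s, t i * f i x) := by
  classical
  induction s using Finset.induction_on with
  | empty => simpa using isDecaying_zero
  | insert a s ha ih =>
    simp only [Finset.sum_insert ha]
    convert ih.add_const_mul (h a) (t a) using 2
    exact add_comm _ _

lemma exp_neg_mul_le_div {c t : ℝ} (hc : 0 < c) (ht : 0 ≤ t) :
    Real.exp (-c * t) ≤ (1 + 1 / c) * (1 + t)⁻¹ := by
  have h1 : 1 + c * t ≤ Real.exp (c * t) := by linarith [Real.add_one_le_exp (c * t)]
  have h2 : 1 + t ≤ (1 + 1 / c) * (1 + c * t) := by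
    have : (1 + 1 / c) * (1 + c * t) = 1 + t + (c * t + 1 / c) := by field_simp; ring
    rw [this]
    have : 0 ≤ c * t + 1 / c := by positivity
    linarith
  rw [neg_mul, Real.exp_neg, ← div_eq_mul_inv, inv_eq_one_div, div_le_div_iff₀ (Real.exp_pos _)
    (by positivity), one_mul]
  exact h2.trans (by gcongr)

lemma integrable_inv_one_add_abs_rpow {p : ℝ} (hp : 1 < p) :
    Integrable (fun t : ℝ => (1 + |t|)⁻¹ ^ p) := by
  have h := integrable_one_add_norm (E := ℝ) (μ := volume) (r := p) (by simpa using hp)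
  refine h.congr (.of_forall fun t => ?_)
  simp only [Real.norm_eq_abs]
  rw [Real.rpow_neg (by positivity), Real.inv_rpow (by positivity)]

lemma integrable_exp_neg_mul_abs {c : ℝ} (hc : 0 < c) :
    Integrable (fun t : ℝ => Real.exp (-c * |t|)) := by
  refine ((integrable_inv_one_add_abs_rpow one_lt_two).const_mul ((1 + 1 / (c / 2)) ^ 2)).mono'
    (by fun_prop : Continuous fun t : ℝ => Real.exp (-c * |t|)).aestronglyMeasurable
    (.of_forall fun t => ?_)
  have h := exp_neg_mul_le_div (half_pos hc) (abs_nonneg t)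
  rw [Real.norm_of_nonneg (Real.exp_pos _).le, Real.rpow_ofNat, ← mul_pow]
  calc Real.exp (-c * |t|) = Real.exp (-(c / 2) * |t|) ^ 2 := by
        rw [← Real.exp_nat_mul]; congr 1; push_cast; ring
    _ ≤ _ := by gcongr

lemma exp_neg_mul_abs_add_eq (c : ℝ) (x : Plane) :
    Real.exp (-c * (|x.1| + |x.2|)) = Real.exp (-c * |x.1|) * Real.exp (-c * |x.2|) := by
  rw [mul_add, Real.exp_add]

lemma IsDecaying.integrable {f : Plane → ℝ} (hf : IsDecaying f) : Integrable f := by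
  obtain ⟨C, hC, c, hc, hfC⟩ := hf.decay
  have h := ((integrable_exp_neg_mul_abs hc).mul_prod (integrable_exp_neg_mul_abs hc)).const_mul C
  refine h.mono' hf.continuous.aestronglyMeasurable (.of_forall fun x => ?_)
  rw [← exp_neg_mul_abs_add_eq]
  exact hfC x

lemma IsDecaying.memLp {f : Plane → ℝ} (hf : IsDecaying f) {p : ℝ} (hp : 1 ≤ p) :
    MemLp f (ENNReal.ofReal p) volume := by
  obtain ⟨C, hC, c, hc, hfC⟩ := hf.decay
  have hb : ∀ x, |f x| ≤ C := fun x => (hfC x).trans (by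
    have : Real.exp (-c * (|x.1| + |x.2|)) ≤ 1 := by
      rw [Real.exp_le_one_iff]
      have : 0 ≤ c * (|x.1| + |x.2|) := by positivity
      linarith
    nlinarith)
  rw [← integrable_norm_rpow_iff hf.continuous.aestronglyMeasurable
    (ennreal_ofReal_ne_zero (by linarith)) ENNReal.ofReal_ne_top, ENNReal.toReal_ofReal (by linarith)]
  refine (hf.integrable.abs.const_mul (C ^ (p - 1))).mono' ?_ (.of_forall fun x => ?_)
  · have := hf.continuous.measurable
    exact (by fun_prop : Measurable fun x => ‖f x‖ ^ p).aestronglyMeasurable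
  · rw [Real.norm_of_nonneg (by positivity), Real.norm_eq_abs]
    rcases (abs_nonneg (f x)).eq_or_lt with h | h
    · rw [← h, Real.zero_rpow (by linarith)]; simp
    · calc |f x| ^ p = |f x| ^ (p - 1) * |f x| := by
            nth_rw 3 [← Real.rpow_one |f x|]
            rw [← Real.rpow_add h]; congr 1; ring
        _ ≤ _ := by gcongr; exact hb x

/-! ### Integrals over boxes -/

/-- If `h ≤ |t|`, the interval stays in `|s| ≥ |t| / 2`, where the integrand is at most `exp (-(c /
2) * |t|)`. If `h > |t|`, the integral is at most both `h` and the total integral `T`, so `1 + |t|`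
times it is at most `h + T * h`. -/
lemma setIntegral_exp_neg_mul_abs_le {c : ℝ} (hc : 0 < c) :
    ∃ k > 0, ∀ t h : ℝ, 0 < h →
      ∫ s in Set.Icc (t - h / 2) (t + h / 2), Real.exp (-c * |s|) ≤ h * (k * (1 + |t|)⁻¹) := by
  set T := ∫ s : ℝ, Real.exp (-c * |s|) with hT
  have hT0 : 0 ≤ T := integral_nonneg fun _ => (Real.exp_pos _).le
  have hi := integrable_exp_neg_mul_abs hc
  refine ⟨1 + 1 / (c / 2) + T, by positivity, fun t h hh => ?_⟩
  have hvol : (volume : Measure ℝ).real (Set.Icc (t - h / 2) (t + h / 2)) = h := by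
    rw [Real.volume_real_Icc_of_le (by linarith)]; ring
  have bound : ∀ B, (∀ s ∈ Set.Icc (t - h / 2) (t + h / 2), Real.exp (-c * |s|) ≤ B) →
      ∫ s in Set.Icc (t - h / 2) (t + h / 2), Real.exp (-c * |s|) ≤ h * B := fun B hB => by
    have := setIntegral_mono_on hi.integrableOn
      (integrableOn_const (C := B) (by simp)) measurableSet_Icc hB
    rwa [setIntegral_const, hvol, smul_eq_mul] at this
  have ht : 0 < (1 + |t|)⁻¹ := by positivity
  rcases le_or_gt h |t| with hle | hlt
  · refine (bound (Real.exp (-(c / 2) * |t|)) fun s hs => ?_).trans ?_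
    · have h1 : |t| - |s| ≤ |t - s| := abs_sub_abs_le_abs_sub t s
      have h2 : |t - s| ≤ h / 2 := by
        rw [abs_le]; constructor <;> linarith [hs.1, hs.2]
      refine Real.exp_le_exp.2 ?_
      nlinarith
    · have := exp_neg_mul_le_div (half_pos hc) (abs_nonneg t)
      gcongr
      exact this.trans (mul_le_mul_of_nonneg_right (by linarith) ht.le)
  · have b1 := bound 1 fun s _ => by
      rw [Real.exp_le_one_iff]
      have : 0 ≤ c * |s| := by positivity
      linarith
    have b2 : ∫ s in Set.Icc (t - h / 2) (t + h / 2), Real.exp (-c * |s|) ≤ T :=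
      setIntegral_le_integral hi (.of_forall fun _ => (Real.exp_pos _).le)
    set I := ∫ s in Set.Icc (t - h / 2) (t + h / 2), Real.exp (-c * |s|)
    have hI : I * (1 + |t|) ≤ h * (1 + 1 / (c / 2) + T) := by
      have h1 : I * |t| ≤ T * h := by gcongr
      have h2 : 0 ≤ h * (1 / (c / 2)) := by positivity
      nlinarith
    calc I = I * (1 + |t|) * (1 + |t|)⁻¹ := by field_simp
      _ ≤ h * (1 + 1 / (c / 2) + T) * (1 + |t|)⁻¹ := by gcongr
      _ = _ := by ring

lemma box_eq (x u : Plane) : box x u = Set.Icc (x.1 - u.1 / 2) (x.1 + u.1 / 2) ×ˢ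
    Set.Icc (x.2 - u.2 / 2) (x.2 + u.2 / 2) := rfl

lemma measurableSet_box (x u : Plane) : MeasurableSet (box x u) :=
  measurableSet_Icc.prod measurableSet_Icc

lemma volume_box (x u : Plane) :
    volume (box x u) = ENNReal.ofReal u.1 * ENNReal.ofReal u.2 := by
  rw [box_eq, Measure.volume_eq_prod, Measure.prod_prod, Real.volume_Icc, Real.volume_Icc]
  congr 2 <;> ring

/-- The strong maximal function of an exponentially decaying function is `O(1/((1+|x₁|)(1+|x₂|)))`. -/
lemma IsDecaying.abs_setIntegral_box_le {f : Plane → ℝ} (hf : IsDecaying f) :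
    ∃ K > 0, ∀ x u : Plane, 0 < u.1 → 0 < u.2 →
      |∫ y in box x u, f y| ≤ u.1 * u.2 * (K * ((1 + |x.1|)⁻¹ * (1 + |x.2|)⁻¹)) := by
  obtain ⟨C, hC, c, hc, hfC⟩ := hf.decay
  obtain ⟨k, hk, hkb⟩ := setIntegral_exp_neg_mul_abs_le hc
  refine ⟨C * k ^ 2, by positivity, fun x u hu1 hu2 => ?_⟩
  have hi := ((integrable_exp_neg_mul_abs hc).mul_prod (integrable_exp_neg_mul_abs hc)).const_mul C
  have h1 : ‖∫ y in box x u, f y‖ ≤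
      ∫ y in box x u, C * (Real.exp (-c * |y.1|) * Real.exp (-c * |y.2|)) :=
    norm_integral_le_of_norm_le hi.integrableOn (.of_forall fun y => by
      rw [← exp_neg_mul_abs_add_eq]; exact hfC y)
  refine h1.trans ?_
  rw [integral_const_mul, box_eq, Measure.volume_eq_prod,
    setIntegral_prod_mul (fun s : ℝ => Real.exp (-c * |s|)) (fun s : ℝ => Real.exp (-c * |s|))]
  have b1 := hkb x.1 u.1 hu1
  have b2 := hkb x.2 u.2 hu2
  have n2 : 0 ≤ ∫ s in Set.Icc (x.2 - u.2 / 2) (x.2 + u.2 / 2), Real.exp (-c * |s|) :=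
    integral_nonneg fun _ => (Real.exp_pos _).le
  calc _ ≤ C * ((u.1 * (k * (1 + |x.1|)⁻¹)) * (u.2 * (k * (1 + |x.2|)⁻¹))) := by gcongr
    _ = _ := by ring

/-- Averages over small boxes converge. -/
lemma tendsto_setIntegral_box_div {ι : Type*} {l : Filter ι} {f : Plane → ℝ} (hf : Continuous f)
    (x : Plane) {u : ι → Plane} (hu1 : ∀ᶠ i in l, 0 < (u i).1) (hu2 : ∀ᶠ i in l, 0 < (u i).2)
    (hu : Tendsto u l (𝓝 0)) :
    Tendsto (fun i => (∫ y in box x (u i), f y) / ((u i).1 * (u i).2)) l (𝓝 (f x)) := by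
  rw [Metric.tendsto_nhds]
  intro ε hε
  obtain ⟨δ, hδ, hfδ⟩ := Metric.continuousAt_iff.1 hf.continuousAt (ε / 2) (half_pos hε)
  filter_upwards [hu1, hu2, hu (Metric.ball_mem_nhds 0 hδ)] with i h1 h2 h3
  have h3' : dist (u i) 0 < δ := h3
  rw [Prod.dist_eq, max_lt_iff] at h3'
  have hd1 : (u i).1 < δ := by
    have := h3'.1; rw [Prod.fst_zero, Real.dist_0_eq_abs, abs_of_pos h1] at this; exact this
  have hd2 : (u i).2 < δ := by
    have := h3'.2; rw [Prod.snd_zero, Real.dist_0_eq_abs, abs_of_pos h2] at this; exact this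
  have hv : (volume : Measure Plane).real (box x (u i)) = (u i).1 * (u i).2 := by
    rw [Measure.real, volume_box, ENNReal.toReal_mul, ENNReal.toReal_ofReal h1.le,
      ENNReal.toReal_ofReal h2.le]
  have hvf : volume (box x (u i)) < ∞ := by
    rw [volume_box]; exact ENNReal.mul_lt_top ENNReal.ofReal_lt_top ENNReal.ofReal_lt_top
  have hfi : IntegrableOn f (box x (u i)) :=
    hf.continuousOn.integrableOn_compact (isCompact_Icc.prod isCompact_Icc)
  have hb : ‖∫ y in box x (u i), (f y - f x)‖ ≤ ε / 2 * volume.real (box x (u i)) := by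
    refine norm_setIntegral_le_of_norm_le_const hvf fun y hy => ?_
    refine (hfδ ?_).le
    rw [Prod.dist_eq, max_lt_iff, Real.dist_eq, Real.dist_eq, abs_lt, abs_lt]
    obtain ⟨⟨_, _⟩, ⟨_, _⟩⟩ := hy
    refine ⟨⟨?_, ?_⟩, ⟨?_, ?_⟩⟩ <;> linarith
  rw [integral_sub hfi (integrableOn_const hvf.ne), setIntegral_const, hv, smul_eq_mul] at hb
  have hp : 0 < (u i).1 * (u i).2 := mul_pos h1 h2
  rw [Real.dist_eq]
  have e : (∫ y in box x (u i), f y) / ((u i).1 * (u i).2) - f x =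
      ((∫ y in box x (u i), f y) - (u i).1 * (u i).2 * f x) / ((u i).1 * (u i).2) := by
    field_simp
  rw [e, abs_div, abs_of_pos hp, div_lt_iff₀ hp]
  refine hb.trans_lt ?_
  nlinarith

lemma measurable_setIntegral_box {f : Plane → ℝ} (hf : Continuous f) :
    Measurable fun p : Plane × Plane => ∫ y in box p.1 p.2, f y := by
  have hS : MeasurableSet {q : (Plane × Plane) × Plane | q.2 ∈ box q.1.1 q.1.2} := by
    have e : {q : (Plane × Plane) × Plane | q.2 ∈ box q.1.1 q.1.2} =
        {q | q.1.1.1 - q.1.2.1 / 2 ≤ q.2.1} ∩ {q | q.2.1 ≤ q.1.1.1 + q.1.2.1 / 2} ∩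
        ({q | q.1.1.2 - q.1.2.2 / 2 ≤ q.2.2} ∩ {q | q.2.2 ≤ q.1.1.2 + q.1.2.2 / 2}) := by
      ext q; simp only [box, Set.mem_prod, Set.mem_Icc, Set.mem_inter_iff, Set.mem_ofPred_eq]
    rw [e]
    refine IsClosed.measurableSet ((IsClosed.inter ?_ ?_).inter (IsClosed.inter ?_ ?_)) <;>
      exact isClosed_le (by fun_prop) (by fun_prop)
  have hm : StronglyMeasurable (Function.uncurry
      fun (p : Plane × Plane) (y : Plane) => (box p.1 p.2).indicator f y) :=
    ((hf.measurable.comp measurable_snd).indicator hS).stronglyMeasurable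
  have h := (hm.integral_prod_right (ν := (volume : Measure Plane))).measurable
  simpa only [integral_indicator (measurableSet_box _ _)] using h

/-! ### Densities with regularly varying tails -/

/-- Lebesgue measure on the positive half-line. -/
noncomputable abbrev posVolume : Measure ℝ := volume.restrict (Set.Ioi 0)

lemma ae_posVolume_pos : ∀ᵐ u ∂posVolume, 0 < u := ae_restrict_mem measurableSet_Ioi

/-- Up to a cut-off the power is bounded and `f` is integrable; beyond it the tail gives a multiple
of `u ^ (p - γ - 1)`, integrable as `p < γ`. -/
lemma integrable_rpow_mul_of_isEquivalent {f : ℝ → ℝ} (hf : Measurable f)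
    (hfi : Integrable f posVolume) {γ p : ℝ} (hp : 0 ≤ p) (hpγ : p < γ)
    (htail : Asymptotics.IsEquivalent atTop f (fun u => 1 / u ^ (γ + 1))) :
    Integrable (fun u => u ^ p * f u) posVolume := by
  obtain ⟨B, hB⟩ := htail.isBigO.bound
  obtain ⟨R, hR⟩ := eventually_atTop.1 hB
  set R' := max R 1
  have hR'0 : 0 < R' := lt_max_of_lt_right one_pos
  have hm : Measurable fun u : ℝ => u ^ p * f u := by fun_prop
  have hs : Set.Ioi (0 : ℝ) = Set.Ioc 0 R' ∪ Set.Ioi R' :=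
    (Set.Ioc_union_Ioi_eq_Ioi hR'0.le).symm
  change IntegrableOn _ (Set.Ioi 0) volume
  rw [hs]
  refine IntegrableOn.union ?_ ?_
  · have h1 : IntegrableOn f (Set.Ioc 0 R') :=
      IntegrableOn.mono_set (t := Set.Ioi 0) hfi Set.Ioc_subset_Ioi_self
    refine (h1.norm.const_mul (R' ^ p)).mono' hm.aestronglyMeasurable ?_
    filter_upwards [ae_restrict_mem measurableSet_Ioc] with u hu
    rw [norm_mul, Real.norm_of_nonneg (Real.rpow_nonneg hu.1.le p)]
    gcongr
    exacts [hu.1.le, hu.2]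
  · have h2 := (integrableOn_Ioi_rpow_of_lt (a := p - (γ + 1)) (by linarith) hR'0).const_mul B
    refine Integrable.mono' h2 hm.aestronglyMeasurable ?_
    filter_upwards [ae_restrict_mem measurableSet_Ioi] with u hu
    have hu' : R' < u := hu
    have hu0 : 0 < u := hR'0.trans hu'
    have h3 := hR u ((le_max_left _ _).trans hu'.le)
    rw [norm_mul, Real.norm_of_nonneg (Real.rpow_nonneg hu0.le p)]
    calc u ^ p * ‖f u‖ ≤ u ^ p * (B * ‖1 / u ^ (γ + 1)‖) := by gcongr
      _ = B * u ^ (p - (γ + 1)) := by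
        rw [Real.norm_of_nonneg (by positivity), Real.rpow_sub hu0]; ring

/-! ### The measure of edge lengths -/

lemma quadrant_volume_eq :
    (volume : Measure Plane).restrict (Set.Ioi (0 : ℝ) ×ˢ Set.Ioi (0 : ℝ)) =
      posVolume.prod posVolume := by
  rw [Measure.prod_restrict, Measure.volume_eq_prod]

lemma edgeMeasure_eq (f₁ f₂ : ℝ → ℝ) : edgeMeasure f₁ f₂ =
    (posVolume.prod posVolume).withDensity (fun u => ENNReal.ofReal (f₁ u.1 * f₂ u.2)) := by
  rw [edgeMeasure, quadrant_volume_eq]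

lemma ae_quadrant_pos : ∀ᵐ u ∂(posVolume.prod posVolume), 0 < u.1 ∧ 0 < u.2 := by
  rw [← quadrant_volume_eq]
  filter_upwards [ae_restrict_mem (measurableSet_Ioi.prod measurableSet_Ioi)] with u hu
  exact ⟨hu.1, hu.2⟩

section Edge

variable {f₁ f₂ : ℝ → ℝ}

lemma lintegral_mul_lintegral_eq_one (hf₁ : Measurable f₁) (hf₂ : Measurable f₂)
    (h₁ : ∀ u, 0 < u → 0 ≤ f₁ u) (hF : IsProbabilityMeasure (edgeMeasure f₁ f₂)) :
    (∫⁻ u, ENNReal.ofReal (f₁ u) ∂posVolume) * ∫⁻ u, ENNReal.ofReal (f₂ u) ∂posVolume = 1 := by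
  have h := hF.measure_univ
  rw [edgeMeasure_eq, withDensity_apply _ MeasurableSet.univ, Measure.restrict_univ] at h
  rw [← h, ← lintegral_prod_mul hf₁.ennreal_ofReal.aemeasurable hf₂.ennreal_ofReal.aemeasurable]
  refine lintegral_congr_ae ?_
  filter_upwards [ae_quadrant_pos] with u hu
  rw [ENNReal.ofReal_mul (h₁ _ hu.1)]

/-- Only the product of the two masses is known to be 1; an infinite factor would make it 0 or `∞`.
-/
lemma integrable_edge_densities (hf₁ : Measurable f₁) (hf₂ : Measurable f₂)
    (h₁ : ∀ u, 0 < u → 0 ≤ f₁ u) (h₂ : ∀ u, 0 < u → 0 ≤ f₂ u)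
    (hF : IsProbabilityMeasure (edgeMeasure f₁ f₂)) :
    Integrable f₁ posVolume ∧ Integrable f₂ posVolume := by
  have h := lintegral_mul_lintegral_eq_one hf₁ hf₂ h₁ hF
  have aux : ∀ {f : ℝ → ℝ}, Measurable f → (∀ u, 0 < u → 0 ≤ f u) →
      ∫⁻ u, ENNReal.ofReal (f u) ∂posVolume ≠ ∞ → Integrable f posVolume := by
    intro f hf h0 hlt
    refine ⟨hf.aestronglyMeasurable, ?_⟩
    rw [hasFiniteIntegral_iff_ofReal (by filter_upwards [ae_posVolume_pos] with u hu using h0 u hu)]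
    exact hlt.lt_top
  refine ⟨aux hf₁ h₁ fun ht => ?_, aux hf₂ h₂ fun ht => ?_⟩
  · rw [ht] at h
    rcases eq_or_ne (∫⁻ u, ENNReal.ofReal (f₂ u) ∂posVolume) 0 with h0 | h0
    · rw [h0] at h; simp at h
    · rw [ENNReal.top_mul h0] at h; simp at h
  · rw [ht] at h
    rcases eq_or_ne (∫⁻ u, ENNReal.ofReal (f₁ u) ∂posVolume) 0 with h0 | h0
    · rw [h0] at h; simp at h
    · rw [ENNReal.mul_top h0] at h; simp at h

/-- A vanishing moment would force `f₂ = 0` almost everywhere, against total mass 1. Positivity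
keeps the normalising constant away from zero. -/
lemma integral_rpow_mul_pos (hf₁ : Measurable f₁) (hf₂ : Measurable f₂)
    (h₁ : ∀ u, 0 < u → 0 ≤ f₁ u) (h₂ : ∀ u, 0 < u → 0 ≤ f₂ u)
    (hF : IsProbabilityMeasure (edgeMeasure f₁ f₂)) {p : ℝ}
    (hi : Integrable (fun u => u ^ p * f₂ u) posVolume) :
    0 < ∫ u, u ^ p * f₂ u ∂posVolume := by
  have hnn : 0 ≤ᵐ[posVolume] fun u => u ^ p * f₂ u := by
    filter_upwards [ae_posVolume_pos] with u hu
    exact mul_nonneg (Real.rpow_nonneg hu.le _) (h₂ u hu)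
  refine lt_of_le_of_ne (integral_nonneg_of_ae hnn) fun h0 => ?_
  have h0' := (integral_eq_zero_iff_of_nonneg_ae hnn hi).1 h0.symm
  have hz : ∫⁻ u, ENNReal.ofReal (f₂ u) ∂posVolume = 0 := by
    rw [lintegral_eq_zero_iff hf₂.ennreal_ofReal]
    filter_upwards [h0', ae_posVolume_pos] with u hu hu0
    have : u ^ p * f₂ u = 0 := hu
    have : f₂ u = 0 := (mul_eq_zero.1 this).resolve_left (Real.rpow_pos_of_pos hu0 p).ne'
    simp [this]
  have h := lintegral_mul_lintegral_eq_one hf₁ hf₂ h₁ hF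
  rw [hz, mul_zero] at h
  exact zero_ne_one h

lemma integrable_mul_edgeMeasure (hf₁ : Measurable f₁) (hf₂ : Measurable f₂)
    (h₁ : ∀ u, 0 < u → 0 ≤ f₁ u) (h₂ : ∀ u, 0 < u → 0 ≤ f₂ u)
    (i₁ : Integrable (fun u => u ^ (1 : ℝ) * f₁ u) posVolume)
    (i₂ : Integrable (fun u => u ^ (1 : ℝ) * f₂ u) posVolume) :
    Integrable (fun u : Plane => u.1 * u.2) (edgeMeasure f₁ f₂) := by
  have hm : Measurable fun u : Plane => ENNReal.ofReal (f₁ u.1 * f₂ u.2) :=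
    ((hf₁.comp measurable_fst).mul (hf₂.comp measurable_snd)).ennreal_ofReal
  rw [edgeMeasure_eq, integrable_withDensity_iff_integrable_smul' hm (by simp)]
  refine (i₁.mul_prod i₂).congr ?_
  filter_upwards [ae_quadrant_pos] with u hu
  rw [ENNReal.toReal_ofReal (mul_nonneg (h₁ _ hu.1) (h₂ _ hu.2)), Real.rpow_one, Real.rpow_one,
    smul_eq_mul]
  ring

/-- Rescaling of the first edge. -/
lemma edgeMeasure_eq_map (hf₁ : Measurable f₁) (hf₂ : Measurable f₂) {w : ℝ} (hw : 0 < w) :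
    edgeMeasure f₁ f₂ = ((posVolume.prod posVolume).withDensity
      (fun v => ENNReal.ofReal (w * (f₁ (w * v.1) * f₂ v.2)))).map (fun v => (w * v.1, v.2)) := by
  have hσ : Measurable fun v : Plane => (w * v.1, v.2) := by fun_prop
  have hd : Measurable fun u : Plane => ENNReal.ofReal (f₁ u.1 * f₂ u.2) :=
    ((hf₁.comp measurable_fst).mul (hf₂.comp measurable_snd)).ennreal_ofReal
  have h1 : posVolume = ENNReal.ofReal w • posVolume.map (fun u => w * u) := by
    have hpre : (fun u => w * u) ⁻¹' Set.Ioi 0 = Set.Ioi (0 : ℝ) := by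
      ext u; simp [hw]
    have h := Measure.restrict_map (μ := (volume : Measure ℝ)) (f := fun u => w * u)
      (by fun_prop) (measurableSet_Ioi (a := (0 : ℝ)))
    rw [hpre, Real.map_volume_mul_left hw.ne', Measure.restrict_smul] at h
    rw [posVolume, ← h, smul_smul, abs_of_pos (inv_pos.2 hw), ← ENNReal.ofReal_mul hw.le,
      mul_inv_cancel₀ hw.ne', ENNReal.ofReal_one, one_smul]
  have h2 : posVolume.prod posVolume = ENNReal.ofReal w •
      (posVolume.prod posVolume).map (fun v => (w * v.1, v.2)) := by
    have h := Measure.map_prod_map posVolume posVolume (f := fun u => w * u) (g := id)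
      (by fun_prop) measurable_id
    rw [Measure.map_id] at h
    conv_lhs => rw [h1]
    have e : (posVolume.prod posVolume).map (fun v => (w * v.1, v.2)) =
        (posVolume.map (fun u => w * u)).prod posVolume := h.symm
    rw [e, ← Measure.prod_smul_left, ← h1]
  rw [edgeMeasure_eq]
  ext s hs
  rw [Measure.map_apply hσ hs, withDensity_apply _ hs, withDensity_apply _ (hσ hs)]
  conv_lhs => rw [h2]
  rw [Measure.restrict_smul, lintegral_smul_measure, setLIntegral_map hs hd hσ, smul_eq_mul,
    ← lintegral_const_mul' _ _ ENNReal.ofReal_ne_top]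
  simp only [ENNReal.ofReal_mul hw.le]

lemma scaledEdgeMeasure_eq_map (hf₁ : Measurable f₁) (hf₂ : Measurable f₂) {w : ℝ} (hw : 0 < w)
    (ρ : ℝ) : scaledEdgeMeasure f₁ f₂ ρ = ((posVolume.prod posVolume).withDensity
      (fun v => ENNReal.ofReal (w * (f₁ (w * v.1) * f₂ v.2)))).map
        (fun v => (ρ * (w * v.1), ρ * v.2)) := by
  rw [scaledEdgeMeasure, edgeMeasure_eq_map hf₁ hf₂ hw, Measure.map_map (by fun_prop) (by fun_prop)]
  rfl

/-- Integrals with respect to the intensity measure, in rescaled coordinates. -/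
lemma integral_boxIntensity (hf₁ : Measurable f₁) (hf₂ : Measurable f₂)
    (h₁ : ∀ u, 0 < u → 0 ≤ f₁ u) (h₂ : ∀ u, 0 < u → 0 ≤ f₂ u) {lam w : ℝ} (hlam : 0 ≤ lam)
    (hw : 0 < w) (ρ : ℝ) {H : Plane × Plane → ℂ} (hH : Measurable H) :
    ∫ p, H p ∂(boxIntensity f₁ f₂ lam ρ) =
      ∫ q : Plane × Plane, ((lam * (w * (f₁ (w * q.2.1) * f₂ q.2.2)) : ℝ) : ℂ) *
        H (q.1, (ρ * (w * q.2.1), ρ * q.2.2))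
        ∂((volume : Measure Plane).prod (posVolume.prod posVolume)) := by
  have hd : Measurable fun v : Plane => ENNReal.ofReal (w * (f₁ (w * v.1) * f₂ v.2)) :=
    (measurable_const.mul ((hf₁.comp (measurable_const.mul measurable_fst)).mul
      (hf₂.comp measurable_snd))).ennreal_ofReal
  have hτ : Measurable fun v : Plane => (ρ * (w * v.1), ρ * v.2) := by fun_prop
  have hd' : Measurable fun z : Plane × Plane =>
      ENNReal.ofReal (w * (f₁ (w * z.2.1) * f₂ z.2.2)) := hd.comp measurable_snd
  have hsf : SFinite ((posVolume.prod posVolume).withDensity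
      (fun v => ENNReal.ofReal (w * (f₁ (w * v.1) * f₂ v.2)))) := inferInstance
  have h := Measure.map_prod_map (volume : Measure Plane) ((posVolume.prod posVolume).withDensity
      (fun v => ENNReal.ofReal (w * (f₁ (w * v.1) * f₂ v.2)))) (f := id) measurable_id hτ
  rw [Measure.map_id, ← scaledEdgeMeasure_eq_map hf₁ hf₂ hw ρ] at h
  rw [boxIntensity, integral_smul_measure, h, integral_map (by fun_prop) hH.aestronglyMeasurable,
    prod_withDensity_right hd,
    integral_withDensity_eq_integral_toReal_smul hd' (by simp),
    ← integral_smul]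
  have hae : ∀ᵐ q ∂((volume : Measure Plane).prod (posVolume.prod posVolume)),
      0 < q.2.1 ∧ 0 < q.2.2 := Measure.quasiMeasurePreserving_snd.ae ae_quadrant_pos
  refine integral_congr_ae ?_
  filter_upwards [hae] with q hq
  have h0 : 0 ≤ w * (f₁ (w * q.2.1) * f₂ q.2.2) :=
    mul_nonneg hw.le (mul_nonneg (h₁ _ (mul_pos hw hq.1)) (h₂ _ hq.2))
  rw [ENNReal.toReal_ofReal hlam, ENNReal.toReal_ofReal h0, Complex.real_smul, Complex.real_smul,
    ← mul_assoc, ← Complex.ofReal_mul]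
  rfl

lemma mem_box_comm {x y u : Plane} : y ∈ box x u ↔ x ∈ box y u := by
  simp only [box, Set.mem_prod, Set.mem_Icc]
  constructor <;> rintro ⟨⟨_, _⟩, ⟨_, _⟩⟩ <;>
    refine ⟨⟨?_, ?_⟩, ⟨?_, ?_⟩⟩ <;> linarith

lemma isProbabilityMeasure_scaledEdgeMeasure (hF : IsProbabilityMeasure (edgeMeasure f₁ f₂))
    (ρ : ℝ) : IsProbabilityMeasure (scaledEdgeMeasure f₁ f₂ ρ) :=
  Measure.isProbabilityMeasure_map (by fun_prop)

lemma sigmaFinite_boxIntensity (hF : IsProbabilityMeasure (edgeMeasure f₁ f₂)) (lam ρ : ℝ) :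
    SigmaFinite (boxIntensity f₁ f₂ lam ρ) := by
  have := isProbabilityMeasure_scaledEdgeMeasure hF ρ
  unfold boxIntensity
  change SigmaFinite (lam.toNNReal • (volume : Measure Plane).prod (scaledEdgeMeasure f₁ f₂ ρ))
  infer_instance

/-- Since `y ∈ box x u` iff `x ∈ box y u`, Tonelli bounds the integral over the centres by `‖f‖₁ *
u.1 * u.2`, and the mean area of a box is finite. -/
lemma integrable_setIntegral_box (hF : IsProbabilityMeasure (edgeMeasure f₁ f₂))
    (hi : Integrable (fun u : Plane => u.1 * u.2) (edgeMeasure f₁ f₂)) (lam : ℝ) {ρ : ℝ}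
    (hρ : 0 < ρ) {f : Plane → ℝ} (hf : Continuous f) (hfi : Integrable f) :
    Integrable (fun p : Plane × Plane => ∫ y in box p.1 p.2, f y)
      (boxIntensity f₁ f₂ lam ρ) := by
  have := isProbabilityMeasure_scaledEdgeMeasure hF ρ
  have hm := measurable_setIntegral_box hf
  unfold boxIntensity
  refine Integrable.smul_measure ⟨hm.aestronglyMeasurable, ?_⟩ ENNReal.ofReal_ne_top
  rw [HasFiniteIntegral, lintegral_prod_symm _ hm.enorm.aemeasurable]
  have hx : ∀ u : Plane, ∫⁻ x : Plane, ‖∫ y in box x u, f y‖ₑ ≤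
      (∫⁻ y, ‖f y‖ₑ) * (ENNReal.ofReal u.1 * ENNReal.ofReal u.2) := by
    intro u
    have hS : MeasurableSet {q : Plane × Plane | q.2 ∈ box q.1 u} := by
      have e : {q : Plane × Plane | q.2 ∈ box q.1 u} =
          {q | q.1.1 - u.1 / 2 ≤ q.2.1} ∩ {q | q.2.1 ≤ q.1.1 + u.1 / 2} ∩
          ({q | q.1.2 - u.2 / 2 ≤ q.2.2} ∩ {q | q.2.2 ≤ q.1.2 + u.2 / 2}) := by
        ext q; simp only [box, Set.mem_prod, Set.mem_Icc, Set.mem_inter_iff, Set.mem_ofPred_eq]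
      rw [e]
      refine IsClosed.measurableSet ((IsClosed.inter ?_ ?_).inter (IsClosed.inter ?_ ?_)) <;>
        exact isClosed_le (by fun_prop) (by fun_prop)
    have hmm : Measurable (Function.uncurry
        fun (x y : Plane) => (box x u).indicator (fun y => ‖f y‖ₑ) y) :=
      (hf.measurable.enorm.comp measurable_snd).indicator hS
    calc ∫⁻ x : Plane, ‖∫ y in box x u, f y‖ₑ
        ≤ ∫⁻ x : Plane, ∫⁻ y, (box x u).indicator (fun y => ‖f y‖ₑ) y := by
          refine lintegral_mono fun x => ?_
          rw [lintegral_indicator (measurableSet_box _ _)]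
          exact enorm_integral_le_lintegral_enorm _
      _ = ∫⁻ y : Plane, ∫⁻ x, (box x u).indicator (fun y => ‖f y‖ₑ) y :=
          lintegral_lintegral_swap hmm.aemeasurable
      _ = ∫⁻ y : Plane, ‖f y‖ₑ * (ENNReal.ofReal u.1 * ENNReal.ofReal u.2) := by
          refine lintegral_congr fun y => ?_
          have e : ∀ x, (box x u).indicator (fun y => ‖f y‖ₑ) y =
              (box y u).indicator (fun _ => ‖f y‖ₑ) x := fun x => by
            by_cases h : y ∈ box x u
            · rw [Set.indicator_of_mem h, Set.indicator_of_mem (mem_box_comm.1 h)]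
            · rw [Set.indicator_of_notMem h, Set.indicator_of_notMem fun h' => h (mem_box_comm.1 h')]
          simp only [e]
          rw [lintegral_indicator_const (measurableSet_box _ _), volume_box]
      _ = _ := lintegral_mul_const _ hf.measurable.enorm
  refine (lintegral_mono hx).trans_lt ?_
  have hmu : Measurable fun u : Plane => ENNReal.ofReal u.1 * ENNReal.ofReal u.2 := by fun_prop
  rw [lintegral_const_mul _ hmu]
  refine ENNReal.mul_lt_top hfi.2 ?_
  rw [scaledEdgeMeasure, lintegral_map hmu (by fun_prop)]
  have e : ∀ᵐ u ∂(edgeMeasure f₁ f₂), ENNReal.ofReal (ρ * u.1) * ENNReal.ofReal (ρ * u.2) =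
      ENNReal.ofReal (ρ ^ 2) * ‖u.1 * u.2‖ₑ := by
    rw [edgeMeasure_eq]
    refine (withDensity_absolutelyContinuous _ _).ae_le ?_
    filter_upwards [ae_quadrant_pos] with u hu
    rw [← ENNReal.ofReal_mul (mul_pos hρ hu.1).le, Real.enorm_of_nonneg (mul_pos hu.1 hu.2).le,
      ← ENNReal.ofReal_mul (by positivity)]
    congr 1; ring
  rw [lintegral_congr_ae e, lintegral_const_mul' _ _ ENNReal.ofReal_ne_top]
  exact ENNReal.mul_lt_top ENNReal.ofReal_lt_top hi.2

end Edge

/-! ### Dominated convergence for the rescaled intensity -/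

lemma min_sq_two_mul_le_rpow {s p : ℝ} (hs : 0 ≤ s) (h1 : 1 ≤ p) (h2 : p ≤ 2) :
    min (s ^ 2) (2 * s) ≤ 2 * s ^ p := by
  rcases hs.eq_or_lt with rfl | hs
  · simp [Real.zero_rpow (by linarith : p ≠ 0)]
  rcases le_total s 1 with h | h
  · have : s ^ 2 ≤ s ^ p := by
      rw [← Real.rpow_natCast]
      exact Real.rpow_le_rpow_of_exponent_ge hs h (by simpa using h2)
    exact (min_le_left _ _).trans (by nlinarith [Real.rpow_pos_of_pos hs p])
  · have : s ≤ s ^ p := by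
      nth_rw 1 [← Real.rpow_one s]
      exact Real.rpow_le_rpow_of_exponent_le h h1
    exact (min_le_right _ _).trans (by linarith)

/-- The part of `v^{p-γ-1}` on the set `s`. -/
noncomputable def powerPart (γ p : ℝ) (s : Set ℝ) : ℝ → ℝ := s.indicator fun v => v ^ (p - γ - 1)

lemma integrable_powerPart_Ioi {γ p : ℝ} (h : p < γ) :
    Integrable (powerPart γ p (Set.Ioi 1)) posVolume := by
  have h1 : IntegrableOn (fun v : ℝ => v ^ (p - γ - 1)) (Set.Ioi 1) :=
    integrableOn_Ioi_rpow_of_lt (by linarith) one_pos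
  exact ((integrable_indicator_iff measurableSet_Ioi).2 h1).integrableOn

lemma integrable_powerPart_Ioc {γ p : ℝ} (h : γ < p) :
    Integrable (powerPart γ p (Set.Ioc 0 1)) posVolume := by
  have h1 : IntegrableOn (fun v : ℝ => v ^ (p - γ - 1)) (Set.Ioc 0 1) := by
    rw [← intervalIntegrable_iff_integrableOn_Ioc_of_le zero_le_one]
    exact intervalIntegral.intervalIntegrable_rpow' (by linarith)
  exact ((integrable_indicator_iff measurableSet_Ioc).2 h1).integrableOn

/-- No single `p` makes `v ^ (p - γ - 1)` integrable on the whole half-line, so one exponent is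
reserved for `v > 1` and another for `v ≤ 1`. -/
lemma rpow_mul_min_le {γ p₁ p₂ B v : ℝ} (hB : 0 ≤ B) (hv : 0 < v) (h11 : 1 ≤ p₁) (h12 : p₁ ≤ 2)
    (h21 : 1 ≤ p₂) (h22 : p₂ ≤ 2) :
    v ^ (-γ - 1) * min ((B * v) ^ 2) (2 * (B * v)) ≤
      2 * (B ^ p₁ * powerPart γ p₁ (Set.Ioi 1) v + B ^ p₂ * powerPart γ p₂ (Set.Ioc 0 1) v) := by
  have key : ∀ p, 1 ≤ p → p ≤ 2 → v ^ (-γ - 1) * min ((B * v) ^ 2) (2 * (B * v)) ≤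
      2 * (B ^ p * v ^ (p - γ - 1)) := fun p h1 h2 => by
    calc _ ≤ v ^ (-γ - 1) * (2 * (B * v) ^ p) := by
          gcongr; exact min_sq_two_mul_le_rpow (by positivity) h1 h2
      _ = 2 * (B ^ p * (v ^ p * v ^ (-γ - 1))) := by rw [Real.mul_rpow hB hv.le]; ring
      _ = _ := by rw [← Real.rpow_add hv]; ring_nf
  rcases le_or_gt v 1 with h | h
  · rw [powerPart, powerPart, Set.indicator_of_notMem (by simpa using h),
      Set.indicator_of_mem (show v ∈ Set.Ioc (0 : ℝ) 1 from ⟨hv, h⟩), mul_zero, zero_add]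
    exact key p₂ h21 h22
  · rw [powerPart, powerPart, Set.indicator_of_mem (show v ∈ Set.Ioi 1 from h),
      Set.indicator_of_notMem (fun h' => absurd h'.2 (not_le.2 h)), mul_zero, add_zero]
    exact key p₁ h11 h12

/-- Averages over shrinking squares inherit the box bound and converge to `f x`, so one constant
serves both the rescaled integrands and their limit. -/
lemma IsDecaying.exists_maximal_bound {f : Plane → ℝ} (hf : IsDecaying f) :
    ∃ K > 0, (∀ x u : Plane, 0 < u.1 → 0 < u.2 →
      |∫ y in box x u, f y| ≤ u.1 * u.2 * (K * ((1 + |x.1|)⁻¹ * (1 + |x.2|)⁻¹))) ∧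
      ∀ x, |f x| ≤ K * ((1 + |x.1|)⁻¹ * (1 + |x.2|)⁻¹) := by
  obtain ⟨K, hK, h⟩ := hf.abs_setIntegral_box_le
  refine ⟨K, hK, h, fun x => ?_⟩
  have hpos : ∀ n : ℕ, (0 : ℝ) < 1 / ((n : ℝ) + 1) := fun n => by positivity
  have ht := tendsto_one_div_add_atTop_nhds_zero_nat (𝕜 := ℝ)
  have hlim := tendsto_setIntegral_box_div hf.continuous x (l := atTop)
    (u := fun n : ℕ => ((1 / ((n : ℝ) + 1), 1 / ((n : ℝ) + 1)) : Plane))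
    (.of_forall hpos) (.of_forall hpos) (ht.prodMk_nhds ht)
  refine le_of_tendsto' hlim.abs fun n => ?_
  have hp := mul_pos (hpos n) (hpos n)
  rw [abs_div, abs_of_pos hp, div_le_iff₀ hp]
  refine (h x (1 / ((n : ℝ) + 1), 1 / ((n : ℝ) + 1)) (hpos n) (hpos n)).trans_eq ?_
  ring

/-- The dominating function. -/
noncomputable def dominant (γ p : ℝ) (s : Set ℝ) (f₂ : ℝ → ℝ) (b : ℝ) (q : Plane × Plane) : ℝ :=
  b ^ p * (((1 + |q.1.1|)⁻¹ ^ p * (1 + |q.1.2|)⁻¹ ^ p) *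
    (powerPart γ p s q.2.1 * (q.2.2 ^ p * f₂ q.2.2)))

lemma integrable_dominant {γ p : ℝ} {s : Set ℝ} {f₂ : ℝ → ℝ} (b : ℝ) (hp : 1 < p)
    (hs : Integrable (powerPart γ p s) posVolume)
    (hf₂ : Integrable (fun u => u ^ p * f₂ u) posVolume) :
    Integrable (dominant γ p s f₂ b) ((volume : Measure Plane).prod (posVolume.prod posVolume)) :=
  (((integrable_inv_one_add_abs_rpow hp).mul_prod (integrable_inv_one_add_abs_rpow hp)).mul_prod
    (hs.mul_prod hf₂)).const_mul _

/-! ### Passage to the limit in the characteristic exponent -/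

section Limit

variable {γ₁ γ₂ : ℝ} {f₁ f₂ : ℝ → ℝ}

/-- Here `A` stands for the rescaled density of the first edge or its limit, and `s` for the
normalised mass of the box or its limit, so that a single estimate dominates both integrands. -/
lemma norm_mul_expRemainder_le {γ p₁ p₂ cf A v₁ v₂ b s : ℝ} {x : Plane} (hA : 0 ≤ A)
    (hv₁ : 0 < v₁) (hv₂ : 0 < v₂) (hb : 0 ≤ b) (hf₂ : 0 ≤ f₂ v₂) (hcf : 0 ≤ cf)
    (hAle : A ≤ cf * v₁ ^ (-γ - 1))
    (hs : |s| ≤ b * ((1 + |x.1|)⁻¹ * (1 + |x.2|)⁻¹) * v₂ * v₁)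
    (h11 : 1 ≤ p₁) (h12 : p₁ ≤ 2) (h21 : 1 ≤ p₂) (h22 : p₂ ≤ 2) :
    ‖((A * f₂ v₂ : ℝ) : ℂ) * expRemainder (Complex.I * s)‖ ≤
      2 * cf * (dominant γ p₁ (Set.Ioi 1) f₂ b (x, (v₁, v₂)) +
        dominant γ p₂ (Set.Ioc 0 1) f₂ b (x, (v₁, v₂))) := by
  set B := b * ((1 + |x.1|)⁻¹ * (1 + |x.2|)⁻¹) * v₂ with hB
  have hB0 : 0 ≤ B := by positivity
  have h1 : ‖expRemainder (Complex.I * s)‖ ≤ min ((B * v₁) ^ 2) (2 * (B * v₁)) :=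
    (norm_expRemainder_I_mul_le_min s).trans (min_le_min (by gcongr) (by gcongr))
  have h2 := rpow_mul_min_le (γ := γ) hB0 hv₁ h11 h12 h21 h22
  have hBp : ∀ p : ℝ, B ^ p = b ^ p * ((1 + |x.1|)⁻¹ ^ p * (1 + |x.2|)⁻¹ ^ p) * v₂ ^ p := fun p => by
    rw [hB, Real.mul_rpow (by positivity) hv₂.le, Real.mul_rpow hb (by positivity),
      Real.mul_rpow (by positivity) (by positivity)]
  rw [norm_mul, Complex.norm_real, Real.norm_of_nonneg (mul_nonneg hA hf₂)]
  calc _ ≤ (cf * v₁ ^ (-γ - 1)) * f₂ v₂ * min ((B * v₁) ^ 2) (2 * (B * v₁)) := by gcongr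
    _ = cf * f₂ v₂ * (v₁ ^ (-γ - 1) * min ((B * v₁) ^ 2) (2 * (B * v₁))) := by ring
    _ ≤ cf * f₂ v₂ * (2 * (B ^ p₁ * powerPart γ p₁ (Set.Ioi 1) v₁ +
          B ^ p₂ * powerPart γ p₂ (Set.Ioc 0 1) v₁)) := by gcongr
    _ = _ := by rw [hBp, hBp, dominant, dominant]; ring

lemma normConstant_pos (hγ₁ : 1 < γ₁) (hγ₁' : γ₁ < 2)
    (h : 0 < ∫ u, u ^ γ₁ * f₂ u ∂posVolume) : 0 < normConstant γ₁ f₂ :=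
  mul_pos (tailConstant_pos hγ₁ hγ₁') (Real.rpow_pos_of_pos h _)

lemma normConstant_rpow (hγ₁ : 1 < γ₁) (hγ₁' : γ₁ < 2)
    (h : 0 < ∫ u, u ^ γ₁ * f₂ u ∂posVolume) :
    normConstant γ₁ f₂ ^ γ₁ = tailConstant γ₁ ^ γ₁ * ∫ u, u ^ γ₁ * f₂ u ∂posVolume := by
  have hw : 0 ≤ widthConstant γ₁ f₂ := Real.rpow_nonneg h.le _
  rw [normConstant, Real.mul_rpow (tailConstant_pos hγ₁ hγ₁').le hw, widthConstant,
    ← Real.rpow_mul h.le, one_div_mul_cancel (by linarith), Real.rpow_one]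

/-- The limit of the rescaled integrands. -/
noncomputable def limitIntegrand (γ c : ℝ) (f₂ : ℝ → ℝ) (f : Plane → ℝ) (q : Plane × Plane) : ℂ :=
  ((q.2.1 ^ (-γ - 1) * f₂ q.2.2 : ℝ) : ℂ) *
    expRemainder (Complex.I * (q.2.2 * f q.1 / c * q.2.1 : ℝ))

/-- By Fubini the integral over `v₁` is a stable Lévy integral at `v₂ * f x / c`. Homogeneity
extracts `v₂ ^ γ₁ / c ^ γ₁`, and the remaining constants cancel by the definition of `normConstant`.
-/
lemma integral_limitIntegrand (hγ₁ : 1 < γ₁) (hγ₁' : γ₁ < 2)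
    (h : 0 < ∫ u, u ^ γ₁ * f₂ u ∂posVolume) {f : Plane → ℝ}
    (hi : Integrable (limitIntegrand γ₁ (normConstant γ₁ f₂) f₂ f)
      ((volume : Measure Plane).prod (posVolume.prod posVolume))) :
    ∫ q, limitIntegrand γ₁ (normConstant γ₁ f₂) f₂ f q
      ∂((volume : Measure Plane).prod (posVolume.prod posVolume)) =
      ∫ x, stableExponent γ₁ (f x) := by
  have hc := normConstant_pos hγ₁ hγ₁' h
  have hcγ := normConstant_rpow hγ₁ hγ₁' h
  set c := normConstant γ₁ f₂
  rw [integral_prod _ hi]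
  refine integral_congr_ae ?_
  filter_upwards [hi.prod_right_ae] with x hx
  rw [integral_prod_symm _ hx]
  have inner : ∀ᵐ v₂ ∂posVolume, ∫ v₁, limitIntegrand γ₁ c f₂ f (x, (v₁, v₂)) ∂posVolume =
      ((v₂ ^ γ₁ * f₂ v₂ : ℝ) : ℂ) *
        (((tailConstant γ₁ ^ γ₁ * (c ^ γ₁)⁻¹ : ℝ) : ℂ) * stableExponent γ₁ (f x)) := by
    filter_upwards [ae_posVolume_pos] with v₂ hv₂
    have e : ∀ v₁, limitIntegrand γ₁ c f₂ f (x, (v₁, v₂)) = ((f₂ v₂ : ℝ) : ℂ) *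
        (((v₁ ^ (-γ₁ - 1) : ℝ) : ℂ) * expRemainder (Complex.I * (v₂ * f x / c * v₁ : ℝ))) :=
      fun v₁ => by rw [limitIntegrand]; push_cast; ring
    simp only [e]
    rw [integral_const_mul, integral_rpow_mul_expRemainder_I_mul hγ₁ hγ₁']
    have e2 : v₂ * f x / c = (v₂ / c) * f x := by ring
    rw [e2, stableExponent_mul_of_nonneg (by linarith) (by positivity),
      Real.div_rpow hv₂.le hc.le, div_eq_mul_inv]
    push_cast; ring
  rw [integral_congr_ae inner, integral_mul_const, integral_complex_ofReal, ← mul_assoc,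
    ← Complex.ofReal_mul]
  have hone : (∫ u, u ^ γ₁ * f₂ u ∂posVolume) * (tailConstant γ₁ ^ γ₁ * (c ^ γ₁)⁻¹) = 1 := by
    rw [hcγ]
    have := (Real.rpow_pos_of_pos (tailConstant_pos hγ₁ hγ₁') γ₁).ne'
    have := h.ne'
    field_simp
  rw [hone, Complex.ofReal_one, one_mul]

instance : scaleToZero.IsCountablyGenerated := by unfold scaleToZero; infer_instance

/-- Convergence of the characteristic exponents of the centred field. -/
theorem tendsto_integral_expRemainder_boxIntensity
    (hγ₁ : 1 < γ₁) (hγ₁' : γ₁ < 2) (hγ₂ : γ₁ < γ₂)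
    (hf₁ : Measurable f₁) (hf₂ : Measurable f₂)
    (h₁ : ∀ u, 0 < u → 0 ≤ f₁ u) (h₂ : ∀ u, 0 < u → 0 ≤ f₂ u)
    (hF : IsProbabilityMeasure (edgeMeasure f₁ f₂))
    (ht₁ : Asymptotics.IsEquivalent atTop f₁ (fun u => 1 / u ^ (γ₁ + 1)))
    (ht₂ : Asymptotics.IsEquivalent atTop f₂ (fun u => 1 / u ^ (γ₂ + 1)))
    (hb : ∃ c > 0, ∀ u, 0 < u → f₁ u ≤ c / u ^ (γ₁ + 1))
    (lam : Set.Ioi (0 : ℝ) → ℝ) (hlam : ∀ ρ, 0 < lam ρ)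
    (hlam_top : Tendsto lam scaleToZero atTop)
    (hlam_zero : Tendsto (fun ρ => lam ρ * (ρ : ℝ) ^ γ₁) scaleToZero (𝓝 0))
    {f : Plane → ℝ} (hf : IsDecaying f) :
    Tendsto (fun ρ : Set.Ioi (0 : ℝ) => ∫ p, expRemainder (Complex.I *
        ((∫ y in box p.1 p.2, f y) / (normConstant γ₁ f₂ * lam ρ ^ (1 / γ₁) * (ρ : ℝ) ^ 2) : ℝ))
        ∂(boxIntensity f₁ f₂ (lam ρ) ρ)) scaleToZero
      (𝓝 (∫ x, stableExponent γ₁ (f x))) := by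
  have hγ0 : 0 < γ₁ := by linarith
  obtain ⟨-, i₂⟩ := integrable_edge_densities hf₁ hf₂ h₁ h₂ hF
  have hmom : ∀ p, 0 ≤ p → p < γ₂ → Integrable (fun u => u ^ p * f₂ u) posVolume :=
    fun p hp hp' => integrable_rpow_mul_of_isEquivalent hf₂ i₂ hp hp' ht₂
  have hpos := integral_rpow_mul_pos hf₁ hf₂ h₁ h₂ hF (hmom γ₁ hγ0.le hγ₂)
  have hc := normConstant_pos hγ₁ hγ₁' hpos
  obtain ⟨cf, hcf, hfb⟩ := hb
  obtain ⟨K, hK, hKbox, hKf⟩ := hf.exists_maximal_bound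
  set c := normConstant γ₁ f₂ with hcdef
  -- Both exponents exceed 1, for integrability in `x`, are at most 2, for the interpolation, and
  -- are below `γ₂`, for the moments of `f₂`. They enclose `γ₁`, for integrability in `v₁` at
  -- infinity and at zero.
  obtain ⟨p₁, hp₁, hp₁'⟩ := exists_between hγ₁
  obtain ⟨p₂, hp₂, hp₂'⟩ := exists_between (lt_min hγ₁' hγ₂)
  rw [lt_min_iff] at hp₂'
  -- the scale of the long edges
  set w : Set.Ioi (0 : ℝ) → ℝ := fun ρ => lam ρ ^ (1 / γ₁) with hwdef
  have hw : ∀ ρ, 0 < w ρ := fun ρ => Real.rpow_pos_of_pos (hlam ρ) _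
  have hwγ : ∀ ρ, w ρ ^ γ₁ = lam ρ := fun ρ => by
    rw [hwdef]
    simp only
    rw [← Real.rpow_mul (hlam ρ).le, one_div_mul_cancel hγ0.ne', Real.rpow_one]
  -- This power cancels the factor `w ^ (-γ₁ - 1)` produced by the tail of `f₁` at `w * v₁`.
  have hww : ∀ ρ, lam ρ * w ρ = w ρ ^ (γ₁ + 1) := fun ρ => by
    rw [Real.rpow_add (hw ρ), Real.rpow_one, hwγ]
  have hw_top : Tendsto w scaleToZero atTop :=
    (tendsto_rpow_atTop (by positivity)).comp hlam_top
  have hρ : Tendsto (fun ρ : Set.Ioi (0 : ℝ) => (ρ : ℝ)) scaleToZero (𝓝 0) := tendsto_comap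
  -- The points regime: the `γ₁`-th root of `lam ρ * ρ ^ γ₁ → 0`, so even the stretched edges
  -- shrink.
  have hρw : Tendsto (fun ρ : Set.Ioi (0 : ℝ) => (ρ : ℝ) * w ρ) scaleToZero (𝓝 0) := by
    have h := hlam_zero.rpow_const (p := 1 / γ₁) (.inr (by positivity))
    rw [Real.zero_rpow (by positivity)] at h
    refine h.congr fun ρ => ?_
    have hρ0 : (0 : ℝ) < ρ := ρ.2
    rw [Real.mul_rpow (hlam ρ).le (by positivity), ← Real.rpow_mul hρ0.le,
      mul_one_div_cancel hγ0.ne', Real.rpow_one, mul_comm]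
  -- the rescaled integrands
  let Φ : Set.Ioi (0 : ℝ) → Plane × Plane → ℂ := fun ρ q =>
    ((lam ρ * (w ρ * (f₁ (w ρ * q.2.1) * f₂ q.2.2)) : ℝ) : ℂ) * expRemainder (Complex.I *
      ((∫ y in box q.1 ((ρ : ℝ) * (w ρ * q.2.1), (ρ : ℝ) * q.2.2), f y) /
        (c * w ρ * (ρ : ℝ) ^ 2) : ℝ))
  have hGm := measurable_setIntegral_box hf.continuous
  have hΦ : ∀ ρ : Set.Ioi (0 : ℝ), ∫ p, expRemainder (Complex.I *
        ((∫ y in box p.1 p.2, f y) / (c * lam ρ ^ (1 / γ₁) * (ρ : ℝ) ^ 2) : ℝ))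
        ∂(boxIntensity f₁ f₂ (lam ρ) ρ) =
      ∫ q, Φ ρ q ∂((volume : Measure Plane).prod (posVolume.prod posVolume)) := fun ρ => by
    refine integral_boxIntensity hf₁ hf₂ h₁ h₂ (hlam ρ).le (hw ρ) ρ (H := fun p =>
      expRemainder (Complex.I *
        ((∫ y in box p.1 p.2, f y) / (c * lam ρ ^ (1 / γ₁) * (ρ : ℝ) ^ 2) : ℝ))) ?_
    refine continuous_expRemainder.measurable.comp ?_
    exact measurable_const.mul (Complex.measurable_ofReal.comp (hGm.div_const _))
  simp only [hΦ]
  have hΦm : ∀ ρ, Measurable (Φ ρ) := fun ρ => by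
    refine Measurable.mul ?_ (continuous_expRemainder.measurable.comp ?_)
    · refine Complex.measurable_ofReal.comp (measurable_const.mul (measurable_const.mul ?_))
      exact (hf₁.comp (by fun_prop)).mul (hf₂.comp (by fun_prop))
    · refine measurable_const.mul (Complex.measurable_ofReal.comp (Measurable.div_const ?_ _))
      exact hGm.comp (g := fun p : Plane × Plane => ∫ y in box p.1 p.2, f y)
        (f := fun q : Plane × Plane => (q.1, ((ρ : ℝ) * (w ρ * q.2.1), (ρ : ℝ) * q.2.2)))
        (by fun_prop)
  have hae : ∀ᵐ q ∂((volume : Measure Plane).prod (posVolume.prod posVolume)),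
      0 < q.2.1 ∧ 0 < q.2.2 := Measure.quasiMeasurePreserving_snd.ae ae_quadrant_pos
  -- The maximum covers the rescaled density, bounded with constant `cf`, and its limit, bounded
  -- with constant 1.
  let D : Plane × Plane → ℝ := fun q =>
    2 * max cf 1 * (dominant γ₁ p₁ (Set.Ioi 1) f₂ (K / c) q +
      dominant γ₁ p₂ (Set.Ioc 0 1) f₂ (K / c) q)
  have hDi : Integrable D ((volume : Measure Plane).prod (posVolume.prod posVolume)) :=
    ((integrable_dominant _ hp₁ (integrable_powerPart_Ioi hp₁')
      (hmom p₁ (by linarith) (by linarith))).add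
      (integrable_dominant _ (by linarith) (integrable_powerPart_Ioc hp₂)
        (hmom p₂ (by linarith) hp₂'.2))).const_mul _
  have hlimm : Measurable (limitIntegrand γ₁ c f₂ f) := by
    have hfm := hf.continuous.measurable
    refine Measurable.mul (by fun_prop) (continuous_expRemainder.measurable.comp (by fun_prop))
  have hlimi : Integrable (limitIntegrand γ₁ c f₂ f)
      ((volume : Measure Plane).prod (posVolume.prod posVolume)) := by
    refine hDi.mono' hlimm.aestronglyMeasurable ?_
    filter_upwards [hae] with q hq
    have hq1 := hq.1
    have hq2 := hq.2
    refine norm_mul_expRemainder_le (A := q.2.1 ^ (-γ₁ - 1)) (by positivity) hq1 hq2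
      (by positivity) (h₂ _ hq2) (by positivity)
      (le_mul_of_one_le_left (by positivity) (le_max_right _ _)) ?_ hp₁.le (by linarith)
      (by linarith) hp₂'.1.le
    rw [abs_mul, abs_div, abs_mul, abs_of_pos hq1, abs_of_pos hq2, abs_of_pos hc]
    calc _ ≤ q.2.2 * (K * ((1 + |q.1.1|)⁻¹ * (1 + |q.1.2|)⁻¹)) / c * q.2.1 := by
          gcongr; exact hKf q.1
      _ = _ := by ring
  rw [← integral_limitIntegrand hγ₁ hγ₁' hpos hlimi]
  refine tendsto_integral_filter_of_dominated_convergence D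
    (.of_forall fun ρ => (hΦm ρ).aestronglyMeasurable) (.of_forall fun ρ => ?_) hDi ?_
  · filter_upwards [hae] with q hq
    have hq1 := hq.1
    have hq2 := hq.2
    have hwρ := hw ρ
    have hlρ := hlam ρ
    have hρ0 : (0 : ℝ) < ρ := ρ.2
    have e : Φ ρ q = ((lam ρ * w ρ * f₁ (w ρ * q.2.1) * f₂ q.2.2 : ℝ) : ℂ) *
        expRemainder (Complex.I *
          ((∫ y in box q.1 ((ρ : ℝ) * (w ρ * q.2.1), (ρ : ℝ) * q.2.2), f y) /
            (c * w ρ * (ρ : ℝ) ^ 2) : ℝ)) := by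
      simp only [Φ]; push_cast; ring
    rw [e]
    refine norm_mul_expRemainder_le (A := lam ρ * w ρ * f₁ (w ρ * q.2.1))
      (mul_nonneg (by positivity) (h₁ _ (by positivity))) hq1 hq2
      (by positivity) (h₂ _ hq2) (by positivity) ?_ ?_ hp₁.le (by linarith)
      (by linarith) hp₂'.1.le
    · calc lam ρ * w ρ * f₁ (w ρ * q.2.1)
          ≤ lam ρ * w ρ * (cf / (w ρ * q.2.1) ^ (γ₁ + 1)) := by
            gcongr; exact hfb _ (by positivity)
        _ = cf * q.2.1 ^ (-γ₁ - 1) := by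
            rw [hww, Real.mul_rpow hwρ.le hq1.le, show -γ₁ - 1 = -(γ₁ + 1) by ring,
              Real.rpow_neg hq1.le]
            have := (Real.rpow_pos_of_pos hwρ (γ₁ + 1)).ne'
            field_simp
        _ ≤ _ := by gcongr; exact le_max_left _ _
    · rw [abs_div, abs_of_pos (show 0 < c * w ρ * (ρ : ℝ) ^ 2 by positivity),
        div_le_iff₀ (by positivity)]
      refine (hKbox q.1 ((ρ : ℝ) * (w ρ * q.2.1), (ρ : ℝ) * q.2.2) (by positivity)
        (by positivity)).trans_eq ?_
      field_simp
  · filter_upwards [hae] with q hq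
    have hq1 := hq.1
    have hq2 := hq.2
    -- Only the tail of `f₁` matters, because `w ρ * q.2.1 → ∞`.
    have hA : Tendsto (fun ρ => lam ρ * w ρ * f₁ (w ρ * q.2.1)) scaleToZero
        (𝓝 (q.2.1 ^ (-γ₁ - 1))) := by
      have hone := (Asymptotics.isEquivalent_iff_tendsto_one (by
        filter_upwards [eventually_gt_atTop 0] with u hu
        positivity)).1 ht₁
      have h := (hone.comp (hw_top.atTop_mul_const hq1)).mul_const (q.2.1 ^ (-γ₁ - 1))
      rw [one_mul] at h
      refine h.congr fun ρ => ?_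
      have hwρ := hw ρ
      simp only [Function.comp_apply, Pi.div_apply]
      rw [hww, Real.mul_rpow hwρ.le hq1.le, show -γ₁ - 1 = -(γ₁ + 1) by ring,
        Real.rpow_neg hq1.le]
      have := (Real.rpow_pos_of_pos hq1 (γ₁ + 1)).ne'
      field_simp
    have hS : Tendsto (fun ρ : Set.Ioi (0 : ℝ) =>
        (∫ y in box q.1 ((ρ : ℝ) * (w ρ * q.2.1), (ρ : ℝ) * q.2.2), f y) /
            (c * w ρ * (ρ : ℝ) ^ 2)) scaleToZero (𝓝 (q.2.2 * f q.1 / c * q.2.1)) := by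
      have hu0 : Tendsto (fun ρ : Set.Ioi (0 : ℝ) =>
          (((ρ : ℝ) * (w ρ * q.2.1), (ρ : ℝ) * q.2.2) : Plane)) scaleToZero (𝓝 0) := by
        have a := hρw.mul_const q.2.1
        have b := hρ.mul_const q.2.2
        rw [zero_mul] at a b
        refine (a.prodMk_nhds b).congr fun ρ => ?_
        rw [mul_assoc]
      have h := (tendsto_setIntegral_box_div hf.continuous q.1
        (.of_forall fun ρ : Set.Ioi (0 : ℝ) => mul_pos ρ.2 (mul_pos (hw ρ) hq1))
        (.of_forall fun ρ : Set.Ioi (0 : ℝ) => mul_pos ρ.2 hq2) hu0).mul_const (q.2.1 * q.2.2 / c)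
      have e : f q.1 * (q.2.1 * q.2.2 / c) = q.2.2 * f q.1 / c * q.2.1 := by ring
      rw [e] at h
      refine h.congr fun ρ => ?_
      have hρ0 : (0 : ℝ) < ρ := ρ.2
      have hwρ := hw ρ
      field_simp
    have hlim : Tendsto (fun ρ => ((lam ρ * w ρ * f₁ (w ρ * q.2.1) * f₂ q.2.2 : ℝ) : ℂ) *
        expRemainder (Complex.I *
          ((∫ y in box q.1 ((ρ : ℝ) * (w ρ * q.2.1), (ρ : ℝ) * q.2.2), f y) /
            (c * w ρ * (ρ : ℝ) ^ 2) : ℝ))) scaleToZero (𝓝 (limitIntegrand γ₁ c f₂ f q)) := by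
      have hcont : Continuous fun s : ℝ => expRemainder (Complex.I * s) :=
        continuous_expRemainder.comp (by fun_prop)
      exact ((Complex.continuous_ofReal.tendsto _).comp (hA.mul_const (f₂ q.2.2))).mul
        ((hcont.tendsto _).comp hS)
    refine hlim.congr fun ρ => ?_
    simp only [Φ]; push_cast; ring

end Limit

/-! ### The characteristic function of the centred field -/

lemma boxField_eq_integral_density {Ω : Type*} (N : Ω → Measure (Plane × Plane)) (μ : pointsSpace)
    (ω : Ω) :
    boxField N μ ω = ∫ p, (∫ y in box p.1 p.2, density μ y) ∂(N ω) := by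
  unfold boxField
  congr 1
  funext p
  exact μ.2.choose_spec.density _ (measurableSet_box _ _)

section Field

variable {Ω : Type*} [MeasurableSpace Ω] {P : Measure Ω} {N : Ω → Measure (Plane × Plane)}
  {n : Measure (Plane × Plane)}

lemma integrable_boxField [SigmaFinite n] (hN : IsPoissonRandomMeasure N n P) (μ : pointsSpace)
    (hi : Integrable (fun p : Plane × Plane => ∫ y in box p.1 p.2, density μ y) n) :
    Integrable (boxField N μ) P ∧
      ∫ ω, boxField N μ ω ∂P = ∫ p, (∫ y in box p.1 p.2, density μ y) ∂n := by
  have h := hN.integrable_integral_and_integral_integral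
    (measurable_setIntegral_box (isDecaying_density μ).continuous) hi
  simpa only [← boxField_eq_integral_density] using h

lemma setIntegral_box_sum {k : ℕ} (μ : Fin k → pointsSpace) (t : Fin k → ℝ) (x u : Plane) :
    ∫ y in box x u, ∑ j, t j * density (μ j) y = ∑ j, t j * ∫ y in box x u, density (μ j) y := by
  rw [integral_finsetSum _ fun j _ =>
    ((isDecaying_density (μ j)).integrable.const_mul (t j)).integrableOn]
  simp only [integral_const_mul]

/-- The joint characteristic function of the centred field. -/
lemma integral_exp_sum_centredBoxField [SigmaFinite n] [IsProbabilityMeasure P]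
    (hN : IsPoissonRandomMeasure N n P)
    (hi : ∀ μ : pointsSpace, Integrable (fun p => ∫ y in box p.1 p.2, density μ y) n)
    {k : ℕ} (μ : Fin k → pointsSpace) (t : Fin k → ℝ) (a : ℝ) :
    ∫ ω, Complex.exp (Complex.I * (∑ j, t j * (centredBoxField P N (μ j) ω / a) : ℝ)) ∂P =
      Complex.exp (∫ p, expRemainder (Complex.I *
        ((∫ y in box p.1 p.2, ∑ j, t j * density (μ j) y) / a : ℝ)) ∂n) := by
  have hint : Integrable
      (fun p : Plane × Plane => (∫ y in box p.1 p.2, ∑ j, t j * density (μ j) y) / a) n := by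
    simp only [setIntegral_box_sum]
    exact (integrable_finsetSum _ fun j _ => (hi (μ j)).const_mul (t j)).div_const a
  have hmeas := (measurable_setIntegral_box (isDecaying_sum Finset.univ t
    fun j => isDecaying_density (μ j)).continuous).div_const a
  -- Used both for almost every realisation `N ω` and for the intensity `n`.
  have hlin : ∀ m : Measure (Plane × Plane),
      (∀ j, Integrable (fun p : Plane × Plane => ∫ y in box p.1 p.2, density (μ j) y) m) →
      ∫ p, (∫ y in box p.1 p.2, ∑ j, t j * density (μ j) y) / a ∂m =
        (∑ j, t j * ∫ p, (∫ y in box p.1 p.2, density (μ j) y) ∂m) / a := fun m hm => by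
    simp only [setIntegral_box_sum]
    rw [integral_div, integral_finsetSum _ fun j _ => (hm j).const_mul (t j)]
    simp only [integral_const_mul]
  rw [← hN.integral_exp_centred hmeas hint]
  refine integral_congr_ae ?_
  have hae : ∀ᵐ ω ∂P, ∀ j,
      Integrable (fun p : Plane × Plane => ∫ y in box p.1 p.2, density (μ j) y) (N ω) :=
    ae_all_iff.2 fun j => hN.ae_integrable
      (measurable_setIntegral_box (isDecaying_density (μ j)).continuous) (hi (μ j))
  filter_upwards [hae] with ω hω
  rw [hlin _ hω, hlin _ fun j => hi (μ j)]
  congr 3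
  rw [← sub_div, ← Finset.sum_sub_distrib, Finset.sum_div]
  refine Finset.sum_congr rfl fun j _ => ?_
  rw [centredBoxField, (integrable_boxField hN (μ j) (hi (μ j))).2, boxField_eq_integral_density]
  ring

end Field

end RandomBoxes

/-! ### Convergence of the finite-dimensional distributions -/

theorem mainTheorem5
    (γ₁ γ₂ : ℝ) (hγ₁ : 1 < γ₁) (hγ₁' : γ₁ < 2) (hγ₂ : γ₁ < γ₂)
    -- the densities of the length and the width of a box
    (f₁ f₂ : ℝ → ℝ) (hf₁_meas : Measurable f₁) (hf₂_meas : Measurable f₂)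
    (hf₁_nonneg : ∀ u, 0 < u → 0 ≤ f₁ u) (hf₂_nonneg : ∀ u, 0 < u → 0 ≤ f₂ u)
    (hF : IsProbabilityMeasure (RandomBoxes.edgeMeasure f₁ f₂))
    (hf₁_tail : Asymptotics.IsEquivalent atTop f₁ (fun u => 1 / u ^ (γ₁ + 1)))
    (hf₂_tail : Asymptotics.IsEquivalent atTop f₂ (fun u => 1 / u ^ (γ₂ + 1)))
    (hf₁_bound : ∃ c > 0, ∀ u, 0 < u → f₁ u ≤ c / u ^ (γ₁ + 1))
    -- the intensities
    (lam : Set.Ioi (0 : ℝ) → ℝ) (hlam_pos : ∀ ρ, 0 < lam ρ)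
    (hlam_top : Tendsto lam RandomBoxes.scaleToZero atTop)
    (hlam_zero : Tendsto (fun ρ => lam ρ * (ρ : ℝ) ^ γ₁) RandomBoxes.scaleToZero (𝓝 0))
    -- the Poisson random measures
    {Ω : Set.Ioi (0 : ℝ) → Type*} [∀ ρ, MeasurableSpace (Ω ρ)]
    (P : ∀ ρ, Measure (Ω ρ)) [∀ ρ, IsProbabilityMeasure (P ρ)]
    (N : ∀ ρ, Ω ρ → Measure (RandomBoxes.Plane × RandomBoxes.Plane))
    (hN : ∀ ρ, RandomBoxes.IsPoissonRandomMeasure (N ρ)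
      (RandomBoxes.boxIntensity f₁ f₂ (lam ρ) ρ) (P ρ))
    -- the stable random measure
    {Ω' : Type*} [MeasurableSpace Ω'] (P' : Measure Ω') [IsProbabilityMeasure P']
    (Λ : Set RandomBoxes.Plane → Ω' → ℝ)
    (hΛ : RandomBoxes.IsStableRandomMeasure Λ γ₁ volume P') :
    let S : RandomBoxes.pointsSpace → Ω' → ℝ := fun μ =>
      RandomBoxes.stableIntegral Λ γ₁ volume P' (RandomBoxes.density μ)
    (∀ μ, RandomBoxes.IsStableIntegral Λ γ₁ volume P' (RandomBoxes.density μ) (S μ)) ∧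
    (∀ μ, RandomBoxes.HasStableLaw (S μ) γ₁
      (RandomBoxes.stableScale γ₁ (RandomBoxes.density μ))
      (RandomBoxes.stableSkewness γ₁ (RandomBoxes.density μ)) P') ∧
    ∀ (k : ℕ) (μ : Fin k → RandomBoxes.pointsSpace),
      TendstoInDistribution
        (fun (ρ : Set.Ioi (0 : ℝ)) (ω : Ω ρ) (j : Fin k) =>
          RandomBoxes.centredBoxField (P ρ) (N ρ) (μ j) ω /
            (RandomBoxes.normConstant γ₁ f₂ * lam ρ ^ (1 / γ₁) * (ρ : ℝ) ^ 2))
        RandomBoxes.scaleToZero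
        (fun ω j => S (μ j) ω) P P' := by
  intro S
  have hS : ∀ μ, RandomBoxes.IsStableIntegral Λ γ₁ volume P' (RandomBoxes.density μ) (S μ) :=
    fun μ => hΛ.isStableIntegral_stableIntegral hγ₁.le
      ((RandomBoxes.isDecaying_density μ).memLp hγ₁.le)
  have hmeas : ∀ μ : RandomBoxes.pointsSpace, Measurable (RandomBoxes.density μ) :=
    fun μ => (RandomBoxes.isDecaying_density μ).continuous.measurable
  refine ⟨hS, fun μ => (hS μ).hasStableLaw hΛ hγ₁.le (hmeas μ), fun k μ => ?_⟩
  obtain ⟨j₁, j₂⟩ := RandomBoxes.integrable_edge_densities hf₁_meas hf₂_meas hf₁_nonneg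
    hf₂_nonneg hF
  -- Both tail indices exceed 1, so the edges have finite means and the field is integrable.
  have hedge := RandomBoxes.integrable_mul_edgeMeasure hf₁_meas hf₂_meas hf₁_nonneg hf₂_nonneg
    (RandomBoxes.integrable_rpow_mul_of_isEquivalent hf₁_meas j₁ zero_le_one hγ₁ hf₁_tail)
    (RandomBoxes.integrable_rpow_mul_of_isEquivalent hf₂_meas j₂ zero_le_one (hγ₁.trans hγ₂)
      hf₂_tail)
  have hsf : ∀ ρ : Set.Ioi (0 : ℝ), SigmaFinite (RandomBoxes.boxIntensity f₁ f₂ (lam ρ) ρ) :=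
    fun ρ => RandomBoxes.sigmaFinite_boxIntensity hF _ _
  have hbox : ∀ (ρ : Set.Ioi (0 : ℝ)) (ν : RandomBoxes.pointsSpace), Integrable
      (fun p => ∫ y in RandomBoxes.box p.1 p.2, RandomBoxes.density ν y)
      (RandomBoxes.boxIntensity f₁ f₂ (lam ρ) ρ) := fun ρ ν =>
    RandomBoxes.integrable_setIntegral_box hF hedge (lam ρ) ρ.2
      (RandomBoxes.isDecaying_density ν).continuous (RandomBoxes.isDecaying_density ν).integrable
  refine RandomBoxes.tendstoInDistribution_of_tendsto_integral_exp
    (fun ρ => aemeasurable_pi_lambda _ fun j => ?_)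
    (aemeasurable_pi_lambda _ fun j => (hS (μ j)).aemeasurable) fun t => ?_
  · exact ((RandomBoxes.integrable_boxField (hN ρ) (μ j)
      (hbox ρ (μ j))).1.aemeasurable.sub_const _).div_const _
  -- By linearity, the combination of the limits with coefficients `t` is the stable integral of `∑
  -- j, t j * density (μ j)`, the same density as in the characteristic function of the field.
  · have hsum := RandomBoxes.IsStableIntegral.sum hΛ hγ₁.le Finset.univ t fun j => hS (μ j)
    have hdec := RandomBoxes.isDecaying_sum Finset.univ t
      fun j => RandomBoxes.isDecaying_density (μ j)
    rw [hsum.integral_exp hΛ hγ₁.le hdec.continuous.measurable]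
    simp only [fun ρ => RandomBoxes.integral_exp_sum_centredBoxField (hN ρ) (hbox ρ) μ t]
    exact (Complex.continuous_exp.tendsto _).comp
      (RandomBoxes.tendsto_integral_expRemainder_boxIntensity hγ₁ hγ₁' hγ₂ hf₁_meas hf₂_meas
        hf₁_nonneg hf₂_nonneg hF hf₁_tail hf₂_tail hf₁_bound lam hlam_pos hlam_top hlam_zero hdec)
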